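/- **Setting.** Let $(X,\mathfrak F,\mu)$ be a $\sigma$-finite atomless measure space. Call $\Delta\in\mathfrak F$ *integrable* if $\mu_\Delta=\mu(\Delta)<\infty$. Let $\mathfrak b$ be a monoid with unit $u$ and an involution $\star$, $(a\cdot c)^\star=c^\star\cdot a^\star$; write $a\star c=a\cdot c^\star$. Let $\mathfrak m$ be the $\star$-monoid (pointwise operations, unit $e\equiv u$) of integrable step maps: maps $g:X\to\mathfrak b$ with countable image, measurable level sets, and support $\{g\ne u\}$ of finite measure. For integrable $\Delta$ let $b_\Delta\in\mathfrak m$ be equal to $b$ on $\Delta$ and to $u$ elsewhere. If $g_1,g_2,\dots\in\mathfrak m$ have mutually disjoint supports, $\bigsqcup g_n$ is the map equal to $g_n$ on the support of $g_n$ and to $u$ elsewhere (considered when it lies in $\mathfrak m$). Let $S$ be a semigroup acting on $X$ by injections $x\mapsto sx$ which are measurable, map measurable sets to measurable sets, and preserve $\mu$ ($\mu(s^{-1}\Delta)=\mu(\Delta)$ for measurable $\Delta\subseteq sX$), and acting on $\mathfrak b$ by unital injective $\star$-endomorphisms $b\mapsto b_s$. For $g\in\mathfrak m$ put $g_s(sx)=g(x)_s$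 and $g_s=u$ off $sX$. A functional $\varphi$ on $\mathfrak m$ is *$S$-homogeneous* if $\varphi(g_s)=\varphi(g)$ for all $s,g$. Fix a *Vitali system*: for each $x$ a filter, written $\Delta\downarrow\{x\}$, on the integrable sets such that (a) for almost every $x$ it is proper, eventually $x\in\Delta$ and $\mu_\Delta>0$, and $\mu_\Delta\to0$; (b) (Vitali covering property) if $A\subseteq X$ has finite outer measure and for each $x\in A$ a family $F_x$ of integrable sets is met frequently as $\Delta\downarrow\{x\}$, then for every $\varepsilon>0$ there are countably many mutually disjoint sets, each taken from some $F_x$, $x\in A$, that cover almost all of $A$ and whose union has measure at most $\mu(A)+\varepsilon$. It is assumed to respect $S$: for each $s$ and almost every $x$, if $\Delta\downarrow\{x\}$ then $s\Delta\downarrow\{sx\}$. We say that *$l_x(b)$ is the Vitali derivative of $\nu_\Delta(b)$* if for almost every $x$ one has $\nu_\Delta(b)/\mu_\Delta\to l_x(b)$ as $\Delta\downarrow\{x\}$ for all $b\in\mathfrak b$ (one null set for all $b$). *Covariance* identities at points $x$, $sx$ below are required for each $s$, for almost every $x$ and all $b$. A *state* over a $\star$-monoid is a functional $\varphi$ with value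 $1$ at the unit and $\sum_{f,h}\kappa_f\varphi(f\star h)\kappa_h^*\ge0$ for all finitely supported $\kappa$. A state over $\mathfrak m$ is *chaotic* if $\varphi(\bigsqcup g_n)=\lim_N\prod_{n\le N}\varphi(g_n)$. A *cumulant functional* over $\mathfrak b$ is a functional $\lambda$ with $\lambda(u)=0$, $\lambda(b^\star)=\lambda(b)^*$ and $\sum_{a,c}\kappa_a\lambda(a\star c)\kappa_c^*\ge0$ for all finitely supported $\kappa$ with $\sum_b\kappa_b=0$. For a field $(K_x)_{x\in X}$ of complex pre-Hilbert spaces, a *pre-Hilbert subspace* of $\int^\oplus K_x\,dx$ is a linear space $K$ of sections, modulo equality almost everywhere, with $x\mapsto\langle\xi(x)|\eta(x)\rangle$ integrable for all $\xi,\eta\in K$; its scalar product is $\int\langle\xi(x)|\eta(x)\rangle dx$. An *isometric representation by fibre maps* consists of linear maps $V_s:K_x\to K_{sx}$, isometric for almost every $x$, such that the induced maps on sections, $(V_s\xi)(sx)=V_s\xi(x)$ and $V_s\xi=0$ off $sX$, satisfy $V_{st}=V_sV_t$ modulo null sets. **Theorem.** Let $\varphi:\mathfrak m\to\mathbb C$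 be an $S$-homogeneous functional, and $\varphi_\Delta(b)=\varphi(b_\Delta)$ for integrable $\Delta$. The following are equivalent. (i) The $\varphi_\Delta$ are infinitely divisible states over $\mathfrak b$, that is, each $\varphi_\Delta$ is a state and $\varphi$ is a chaotic state over $\mathfrak m$ without zeros; $\varphi_\Delta(b)=1$ for all $b$ whenever $\mu_\Delta=0$; and $\varphi_\Delta(b)-1$ has a Vitali derivative $l_x(b)$. (ii) $\lambda=\ln\varphi$ is defined: there is $\lambda:\mathfrak m\to\mathbb C$ with $e^{\lambda(g)}=\varphi(g)$ which is $\sigma$-additive ($\lambda(\bigsqcup g_n)=\sum\lambda(g_n)$, unconditionally), absolutely continuous ($\mu_\Delta=0\Rightarrow\lambda_\Delta(b):=\lambda(b_\Delta)=0$) and $S$-homogeneous, every $\lambda_\Delta$ is a cumulant functional over $\mathfrak b$, and there is an $S$-covariant Radon–Nikodym derivative $l_x(b)=l_{sx}(b_s)$: for all integrable $\Delta$ and all $b$, $x\mapsto l_x(b)$ is integrable on $\Delta$ with $\lambda_\Delta(b)=\int_\Delta l_x(b)\,dx$, and $l_x(b)$ is the Vitali derivative of $\lambda_\Delta(b)$.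 (iii) There are a field $(K_x)$ of pre-Hilbert spaces, a pre-Hilbert subspace $K\subseteq\int^\oplus K_x\,dx$, an isometric representation $V_s$ of $S$ by fibre maps, which maps $K$ isometrically into $K$, and (1) a density $l_x(b)\in\mathbb C$ such that $l_x(g(x))$ is integrable for all $g\in\mathfrak m$, $\lambda(g)=\int l_x(g(x))\,dx$ is $S$-homogeneous with $e^{\lambda(g)}=\varphi(g)$, $l_x(b)$ is the Vitali derivative of $\int_\Delta l_x(b)\,dx$, $l_{sx}(b_s)=l_x(b)$, $l_x(b^\star)=l_x(b)^*$ and $l_x(u)=0$; (2) vectors $k_x(b)\in K_x$ with $k_x(u)=0$, $k_{sx}(b_s)=V_sk_x(b)$, such that $k(g)=\int^\oplus k_x(g(x))\,dx\in K$ for all $g\in\mathfrak m$ and, with $k^\star(g)=\langle k(g^\star)|\,\cdot\,\rangle$, $k^\star(f)k(h)=\lambda(f\cdot h)-\lambda(f)-\lambda(h)$ for all $f,h\in\mathfrak m$; (3) linear operators $j_x(b)$ on $K_x$ with $j_x(u)=I_x$ such that the decomposable operators $j(g)=\int^\oplus j_x(g(x))\,dx$ map $K$ into $K$ and satisfy on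 $K$: $j(g\cdot h)=j(g)j(h)$, $j(g^\star)=j(g)^*$, $j(e)=I$, $V_sj(g)=j(g_s)V_s$, the cocycle identities $j(g)k(h)=k(g\cdot h)-k(g)$ and $k^\star(f)j(g)=k^\star(f\cdot g)-k^\star(g)$, and each $j(g)$ is continuous with respect to the family of seminorms $\|\xi\|^h=\left(\int\|j_x(h(x))\xi(x)\|^2dx\right)^{1/2}$, $h\in\mathfrak m$. (iv) There are a field $(K_x)$ of pre-Hilbert spaces, $l_x(b)\in\mathbb C$, $k_x(b)\in K_x$, linear operators $j_x(b)$ on $K_x$, and an isometric representation $V_s$ of $S$ by fibre maps, where $l_x(g(x))$ is integrable with $\exp\int l_x(g(x))\,dx=\varphi(g)$ for all $g\in\mathfrak m$ and $l_x(b)$ is the Vitali derivative of $\lambda_\Delta(b)=\int_\Delta l_x(b)\,dx$, and for each integrable $\Delta$ a pre-Hilbert subspace $K_\Delta\subseteq\int^\oplus_\Delta K_x\,dx$ such that, with $k_\Delta(b)=\int_\Delta^\oplus k_x(b)\,dx$, $k^\star_\Delta(b)=\langle k_\Delta(b^\star)|\,\cdot\,\rangle$ and $j_\Delta(b)=\int^\oplus_\Delta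 j_x(b)\,dx$, the triangular matrices $$\mathbf j_\Delta(b)=\begin{bmatrix}1&k^\star_\Delta(b)&\lambda_\Delta(b)\\0&j_\Delta(b)&k_\Delta(b)\\0&0&1\end{bmatrix}$$ act on $\mathbb K_\Delta=\mathbb C\oplus K_\Delta\oplus\mathbb C$ and form a unital $\dagger$-representation of $\mathfrak b$: $\mathbf j_\Delta(a\cdot b)=\mathbf j_\Delta(a)\mathbf j_\Delta(b)$, $\mathbf j_\Delta(u)=\mathbf I$, $\mathbf j_\Delta(b^\star)=\mathbf j_\Delta(b)^\dagger$, where $\dagger$ is the adjoint for the Minkowski scalar product $(\mathbf k|\mathbf k')=k_-^*k'_++\langle k_\circ|k'_\circ\rangle+k_+^*k'_-$ of columns $\mathbf k=(k_-,k_\circ,k_+)$; moreover $\lambda_\Delta(b)=(\mathbf e|\mathbf j_\Delta(b)\mathbf e)$ and $e^{\lambda_\Delta(b)}=\varphi_\Delta(b)$, where $\mathbf e=(0,0,1)$, $(\mathbf e|\mathbf e)=0$. Furthermore, for all $s$ and integrable $\Delta$, the block-diagonal operator $\mathbf V_s=\mathrm{diag}(1,V_s,1)$ maps $\mathbb K_\Delta$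 into $\mathbb K_{s\Delta}$, preserves the Minkowski scalar products, and satisfies $\mathbf V_s\mathbf j_\Delta(b)=\mathbf j_{s\Delta}(b_s)\mathbf V_s$ for all $b\in\mathfrak b$. -/

import Mathlib

open MeasureTheory Filter Topology
open scoped ComplexOrder ComplexConjugate ENNReal InnerProductSpace

noncomputable section

namespace LevyField

universe u v w

/-! ### Measurable sets of finite measure, atomless measures, Vitali systems -/

section Base

variable {X : Type v} [MeasurableSpace X]

/-- The integrable sets: measurable sets of finite measure. -/
def IntegrableSet (μ : Measure X) : Type v :=
  {D : Set X // MeasurableSet D ∧ μ D < ∞}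

/-- Every measurable set of positive measure has a measurable subset of strictly smaller
positive measure. (Mathlib's `NoAtoms` only says that points are null sets.) -/
def IsAtomless (μ : Measure X) : Prop :=
  ∀ A, MeasurableSet A → μ A ≠ 0 → ∃ B ⊆ A, MeasurableSet B ∧ 0 < μ B ∧ μ B < μ A

/-- A Vitali system on a measure space: for each point `x` a notion of convergence
`D ↓ {x}` of integrable sets, such that for almost every `x` the sets contain `x` and have
positive measure tending to zero, and such that the (strong) Vitali covering property holds: if
`s` is covered finely by a family of sets, countably many disjoint sets of the family cover
almost all of `s` with arbitrarily small overflow. -/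
structure VitaliSystem (μ : Measure X) where
  filterAt : X → Filter (IntegrableSet μ)
  neBot : ∀ᵐ x ∂μ, (filterAt x).NeBot
  mem_pos : ∀ᵐ x ∂μ, ∀ᶠ D in filterAt x, x ∈ D.1 ∧ 0 < μ D.1
  tendsto_zero : ∀ᵐ x ∂μ, Tendsto (fun D : IntegrableSet μ => μ D.1) (filterAt x) (𝓝 0)
  covering : ∀ (s : Set X) (F : X → Set (IntegrableSet μ)), μ s < ∞ →
    (∀ x ∈ s, ∃ᶠ D in filterAt x, D ∈ F x) → ∀ ε : ℝ≥0∞, 0 < ε →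
    ∃ T : Set (IntegrableSet μ), T.Countable ∧
      (∀ D ∈ T, ∃ x ∈ s, D ∈ F x) ∧
      T.PairwiseDisjoint (fun D => D.1) ∧
      μ (s \ ⋃ D ∈ T, D.1) = 0 ∧
      μ (⋃ D ∈ T, D.1) ≤ μ s + ε

end Base

/-! ### The monoid of integrable step maps -/

/-- Integrable step maps: maps `X → 𝔟` with countable image, measurable level sets, and a support
`{x | g x ≠ 1}` of finite measure. -/
structure StepMap {X : Type v} [MeasurableSpace X] (μ : Measure X) (𝔟 : Type u) [One 𝔟] where
  toFun : X → 𝔟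
  countable_range : (Set.range toFun).Countable
  measurableSet_fiber : ∀ b, MeasurableSet (toFun ⁻¹' {b})
  support_lt_top : μ {x | toFun x ≠ 1} < ∞

namespace StepMap

variable {X : Type v} [MeasurableSpace X] {μ : Measure X} {𝔟 : Type u}

instance [One 𝔟] : CoeFun (StepMap μ 𝔟) (fun _ => X → 𝔟) := ⟨StepMap.toFun⟩

@[ext] theorem ext [One 𝔟] {g h : StepMap μ 𝔟} (H : ∀ x, g x = h x) : g = h := by
  cases g; cases h
  congr
  exact funext H

/-- The support of a step map. -/
def supp [One 𝔟] (g : StepMap μ 𝔟) : Set X := {x | g x ≠ 1}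

theorem measurableSet_preimage [One 𝔟] (g : StepMap μ 𝔟) (A : Set 𝔟) :
    MeasurableSet (g ⁻¹' A) := by
  have h : g ⁻¹' A = ⋃ b ∈ A ∩ Set.range g, g ⁻¹' {b} := by
    ext x; simp
  rw [h]
  exact MeasurableSet.biUnion (g.countable_range.mono Set.inter_subset_right)
    fun b _ => g.measurableSet_fiber b

variable [Monoid 𝔟]

instance : One (StepMap μ 𝔟) where
  one :=
    { toFun := fun _ => 1
      countable_range := (Set.countable_singleton (1 : 𝔟)).mono (by rintro _ ⟨x, rfl⟩; rfl)
      measurableSet_fiber := fun b => MeasurableSet.const ((1 : 𝔟) = b)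
      support_lt_top := by simp }

instance : Mul (StepMap μ 𝔟) where
  mul f h :=
    { toFun := fun x => f x * h x
      countable_range := (f.countable_range.image2 h.countable_range (· * ·)).mono (by
        rintro _ ⟨x, rfl⟩
        exact ⟨f x, ⟨x, rfl⟩, h x, ⟨x, rfl⟩, rfl⟩)
      measurableSet_fiber := fun b => by
        have H : (fun x => f x * h x) ⁻¹' {b} =
            ⋃ a ∈ Set.range f, f ⁻¹' {a} ∩ h ⁻¹' {c | a * c = b} := by
          ext x
          simp only [Set.mem_preimage, Set.mem_singleton_iff, Set.mem_iUnion, Set.mem_inter_iff,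
            Set.mem_ofPred_eq, exists_prop]
          exact ⟨fun H => ⟨f x, ⟨x, rfl⟩, rfl, H⟩, fun ⟨a, _, h1, h2⟩ => by rw [h1, h2]⟩
        rw [H]
        exact MeasurableSet.biUnion f.countable_range fun a _ =>
          (f.measurableSet_fiber a).inter (h.measurableSet_preimage _)
      support_lt_top := by
        refine lt_of_le_of_lt (measure_mono (t := {x | f x ≠ 1} ∪ {x | h x ≠ 1}) ?_)
          (measure_union_lt_top f.support_lt_top h.support_lt_top)
        intro x hx
        by_contra hn
        simp only [Set.mem_union, Set.mem_ofPred_eq, not_or, not_not] at hn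
        exact hx (by simp [hn.1, hn.2]) }

@[simp] theorem one_apply (x : X) : (1 : StepMap μ 𝔟) x = 1 := rfl

@[simp] theorem mul_apply (f h : StepMap μ 𝔟) (x : X) : (f * h) x = f x * h x := rfl

instance : Monoid (StepMap μ 𝔟) where
  mul_assoc f g h := ext fun x => mul_assoc _ _ _
  one_mul f := ext fun x => one_mul _
  mul_one f := ext fun x => mul_one _

/-- The `b`-valued indicator `b_D` of an integrable set `D`: equal to `b` on `D` and to the unit
elsewhere. -/
def ind (b : 𝔟) (D : IntegrableSet μ) : StepMap μ 𝔟 := by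
  classical
  exact
    { toFun := fun x => if x ∈ D.1 then b else 1
      countable_range := ((Set.countable_singleton (1 : 𝔟)).insert b).mono (by
        rintro _ ⟨x, rfl⟩
        by_cases h : x ∈ D.1 <;> simp [h])
      measurableSet_fiber := fun c => by
        have H : (fun x => if x ∈ D.1 then b else 1) ⁻¹' {c} =
            (D.1 ∩ {_x | b = c}) ∪ (D.1ᶜ ∩ {_x | (1 : 𝔟) = c}) := by
          ext x
          by_cases h : x ∈ D.1 <;> simp [h]
        rw [H]
        exact (D.2.1.inter (MeasurableSet.const _)).union
          (D.2.1.compl.inter (MeasurableSet.const _))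
      support_lt_top := by
        refine lt_of_le_of_lt (measure_mono ?_) D.2.2
        intro x hx
        by_contra h
        exact hx (by simp [h]) }

theorem ind_of_mem (b : 𝔟) (D : IntegrableSet μ) {x : X} (h : x ∈ D.1) : ind b D x = b := by
  simp [ind, h]

theorem ind_of_notMem (b : 𝔟) (D : IntegrableSet μ) {x : X} (h : x ∉ D.1) : ind b D x = 1 := by
  simp [ind, h]

/-- `h = ⊔ g n`: the supports of the `g n` are mutually disjoint, `h` agrees with `g n` on the
support of `g n`, and `h` is the unit off the union of the supports. -/
def IsJoin (g : ℕ → StepMap μ 𝔟) (h : StepMap μ 𝔟) : Prop :=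
  Pairwise (fun m n => Disjoint (supp (g m)) (supp (g n))) ∧
  (∀ n, ∀ x ∈ supp (g n), h x = g n x) ∧
  (∀ x, (∀ n, x ∉ supp (g n)) → h x = 1)

variable [StarMul 𝔟]

instance : Star (StepMap μ 𝔟) where
  star g :=
    { toFun := fun x => star (g x)
      countable_range := (g.countable_range.image star).mono (by
        rintro _ ⟨x, rfl⟩
        exact ⟨g x, ⟨x, rfl⟩, rfl⟩)
      measurableSet_fiber := fun b => g.measurableSet_preimage (star ⁻¹' {b})
      support_lt_top := by
        refine lt_of_le_of_lt (measure_mono ?_) g.support_lt_top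
        intro x hx h
        exact hx (by simp [h]) }

@[simp] theorem star_apply (g : StepMap μ 𝔟) (x : X) : (star g) x = star (g x) := rfl

instance : StarMul (StepMap μ 𝔟) where
  star_involutive _ := ext fun _ => star_star _
  star_mul _ _ := ext fun _ => star_mul _ _

end StepMap

/-! ### States and cumulant functionals -/

section States

variable {M : Type w} [Monoid M] [StarMul M]

/-- A (generating) state over a `⋆`-monoid: normalised and positive definite. -/
def IsState (φ : M → ℂ) : Prop :=
  φ 1 = 1 ∧
  ∀ κ : M →₀ ℂ,
    0 ≤ ∑ f ∈ κ.support, ∑ h ∈ κ.support, κ f * φ (f * star h) * conj (κ h)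

/-- A cumulant generating functional over a `⋆`-monoid: conditionally positive definite, zero at the
unit, and Hermitian. -/
def IsCumulant (lam : M → ℂ) : Prop :=
  (∀ κ : M →₀ ℂ, ∑ b ∈ κ.support, κ b = 0 →
    0 ≤ ∑ a ∈ κ.support, ∑ c ∈ κ.support, κ a * lam (a * star c) * conj (κ c)) ∧
  lam 1 = 0 ∧
  ∀ b, lam (star b) = conj (lam b)

end States

/-! ### The symmetry semigroup -/

/-- An action of the symmetry semigroup `S` on the measure space `X` by measure-preserving
measurable injections `x ↦ s x` (which map measurable sets to measurable sets) together with a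
representation of `S` by unital injective `⋆`-endomorphisms `θ s` of the `⋆`-monoid `𝔟`. -/
structure Symmetry (S : Type w) [Semigroup S] {X : Type v} [MeasurableSpace X] (μ : Measure X)
    (𝔟 : Type u) [Monoid 𝔟] [StarMul 𝔟] where
  act : S → X → X
  act_mul : ∀ s t x, act (s * t) x = act s (act t x)
  measurableEmbedding : ∀ s, MeasurableEmbedding (act s)
  measure_preimage : ∀ s (D : Set X), MeasurableSet D → D ⊆ Set.range (act s) →
    μ (act s ⁻¹' D) = μ D
  θ : S → 𝔟 →* 𝔟
  θ_mul : ∀ s t b, θ (s * t) b = θ s (θ t b)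
  θ_star : ∀ s b, θ s (star b) = star (θ s b)
  θ_injective : ∀ s, Function.Injective (θ s)

namespace Symmetry

variable {S : Type w} [Semigroup S] {X : Type v} [MeasurableSpace X] {μ : Measure X}
  {𝔟 : Type u} [Monoid 𝔟] [StarMul 𝔟]

theorem measure_image (σ : Symmetry S μ 𝔟) (s : S) {D : Set X} (hD : MeasurableSet D) :
    μ (σ.act s '' D) = μ D := by
  have h := σ.measure_preimage s (σ.act s '' D)
    ((σ.measurableEmbedding s).measurableSet_image.2 hD) (Set.image_subset_range _ _)
  rw [Set.preimage_image_eq _ (σ.measurableEmbedding s).injective] at h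
  exact h.symm

/-- The image `sD` of an integrable set. -/
def image (σ : Symmetry S μ 𝔟) (s : S) (D : IntegrableSet μ) : IntegrableSet μ :=
  ⟨σ.act s '' D.1, (σ.measurableEmbedding s).measurableSet_image.2 D.2.1,
    (σ.measure_image s D.2.1).trans_lt D.2.2⟩

/-- The underlying map of `g_s`: `g_s (s x) = θ s (g x)`, and `g_s = 1` off `sX`. -/
def shiftFun (σ : Symmetry S μ 𝔟) (s : S) (g : X → 𝔟) : X → 𝔟 :=
  Function.extend (σ.act s) (fun x => σ.θ s (g x)) (fun _ => 1)

theorem shiftFun_act (σ : Symmetry S μ 𝔟) (s : S) (g : X → 𝔟) (x : X) :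
    σ.shiftFun s g (σ.act s x) = σ.θ s (g x) :=
  (σ.measurableEmbedding s).injective.extend_apply _ _ _

theorem shiftFun_of_notMem (σ : Symmetry S μ 𝔟) (s : S) (g : X → 𝔟) {y : X}
    (hy : y ∉ Set.range (σ.act s)) : σ.shiftFun s g y = 1 :=
  Function.extend_apply' _ _ _ hy

/-- The induced action `g ↦ g_s` on step maps. -/
def shift (σ : Symmetry S μ 𝔟) (s : S) (g : StepMap μ 𝔟) : StepMap μ 𝔟 where
  toFun := σ.shiftFun s g
  countable_range := ((g.countable_range.image (σ.θ s)).insert 1).mono (by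
    rintro _ ⟨y, rfl⟩
    by_cases hy : y ∈ Set.range (σ.act s)
    · obtain ⟨x, rfl⟩ := hy
      rw [σ.shiftFun_act]
      exact Or.inr ⟨g x, ⟨x, rfl⟩, rfl⟩
    · rw [σ.shiftFun_of_notMem s g hy]
      exact Or.inl rfl)
  measurableSet_fiber := fun b => by
    have H : σ.shiftFun s g ⁻¹' {b} =
        σ.act s '' (g ⁻¹' (σ.θ s ⁻¹' {b})) ∪ ((Set.range (σ.act s))ᶜ ∩ {_y | (1 : 𝔟) = b}) := by
      ext y
      by_cases hy : y ∈ Set.range (σ.act s)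
      · obtain ⟨x, rfl⟩ := hy
        simp [σ.shiftFun_act, (σ.measurableEmbedding s).injective.eq_iff]
      · have hy' : ∀ x, σ.act s x ≠ y := fun x hx => hy ⟨x, hx⟩
        simp [σ.shiftFun_of_notMem s g hy, hy']
    rw [H]
    exact ((σ.measurableEmbedding s).measurableSet_image.2 (g.measurableSet_preimage _)).union
      ((σ.measurableEmbedding s).measurableSet_range.compl.inter (MeasurableSet.const _))
  support_lt_top := by
    have hm : MeasurableSet {x | g x ≠ 1} := g.measurableSet_preimage {b | b ≠ 1}
    refine lt_of_le_of_lt (measure_mono (t := σ.act s '' {x | g x ≠ 1}) ?_)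
      ((σ.measure_image s hm).trans_lt g.support_lt_top)
    intro y hy
    by_cases hr : y ∈ Set.range (σ.act s)
    · obtain ⟨x, rfl⟩ := hr
      refine ⟨x, fun h => hy ?_, rfl⟩
      rw [σ.shiftFun_act, h, map_one]
    · exact absurd (σ.shiftFun_of_notMem s g hr) hy

/-- A functional on the step maps is `S`-homogeneous. -/
def IsHomogeneous (σ : Symmetry S μ 𝔟) (φ : StepMap μ 𝔟 → ℂ) : Prop :=
  ∀ s g, φ (σ.shift s g) = φ g

/-- The symmetry semigroup respects the Vitali system: for almost every `x`, if `D ↓ {x}` then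
`sD ↓ {sx}`. -/
def Respects (σ : Symmetry S μ 𝔟) (V : VitaliSystem μ) : Prop :=
  ∀ s, ∀ᵐ x ∂μ, Tendsto (σ.image s) (V.filterAt x) (V.filterAt (σ.act s x))

/-- A density `l x b` is `S`-covariant: `l (s x) (b_s) = l x b`. -/
def IsCovariantDensity (σ : Symmetry S μ 𝔟) (l : X → 𝔟 → ℂ) : Prop :=
  ∀ s, ∀ᵐ x ∂μ, ∀ b, l (σ.act s x) (σ.θ s b) = l x b

end Symmetry

/-! ### Direct integrals of pre-Hilbert spaces

`E : X → Type*` is a field of pre-Hilbert spaces. Elements of a direct integral are classes of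
sections modulo equality almost everywhere. -/

section DirectIntegral

variable {X : Type v} [MeasurableSpace X] (μ : Measure X)
  (E : X → Type u) [∀ x, NormedAddCommGroup (E x)] [∀ x, InnerProductSpace ℂ (E x)]

/-- The sections vanishing almost everywhere. -/
def nullSections : Submodule ℂ (∀ x, E x) where
  carrier := {ξ | ∀ᵐ x ∂μ, ξ x = 0}
  add_mem' := by
    intro ξ η hξ hη
    change ∀ᵐ x ∂μ, ξ x + η x = 0
    filter_upwards [hξ, hη] with x h1 h2
    simp [h1, h2]
  zero_mem' := by simp
  smul_mem' := by
    intro c ξ hξ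
    change ∀ᵐ x ∂μ, c • ξ x = 0
    filter_upwards [hξ] with x h1
    simp [h1]

/-- Sections modulo equality almost everywhere. -/
abbrev SectionClass : Type (max v u) := (∀ x, E x) ⧸ nullSections μ E

variable {E}

/-- The class of a section, written `∫^⊕ ξ(x) dx`. -/
def cls (ξ : ∀ x, E x) : SectionClass μ E := Submodule.Quotient.mk ξ

variable {μ}

/-- The scalar product `∫ ⟨ξ(x) | η(x)⟩ dx` (conjugate-linear in the first argument). -/
def sprod (ξ η : SectionClass μ E) : ℂ :=
  Quotient.liftOn₂' ξ η (fun ξ η => ∫ x, ⟪ξ x, η x⟫_ℂ ∂μ) (by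
    intro ξ η ξ' η' h h'
    rw [Submodule.quotientRel_def] at h h'
    refine integral_congr_ae ?_
    filter_upwards [h, h'] with x h1 h2
    rw [Pi.sub_apply, sub_eq_zero] at h1 h2
    simp [h1, h2])

theorem sprod_cls (ξ η : ∀ x, E x) :
    sprod (cls μ ξ) (cls μ η) = ∫ x, ⟪ξ x, η x⟫_ℂ ∂μ := rfl

/-- The decomposable operator `∫^⊕ T(x) dx`. -/
def decomposable (T : ∀ x, E x →ₗ[ℂ] E x) : SectionClass μ E →ₗ[ℂ] SectionClass μ E :=
  Submodule.mapQ _ _ (LinearMap.pi fun x => T x ∘ₗ LinearMap.proj x) (by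
    intro ξ hξ
    change ∀ᵐ x ∂μ, T x (ξ x) = 0
    filter_upwards [show ∀ᵐ x ∂μ, ξ x = 0 from hξ] with x h
    rw [h, map_zero])

theorem decomposable_cls (T : ∀ x, E x →ₗ[ℂ] E x) (ξ : ∀ x, E x) :
    decomposable T (cls μ ξ) = cls μ (fun x => T x (ξ x)) := rfl

/-- A space of classes of sections is a pre-Hilbert subspace of the direct integral
`∫^⊕ E_x dx`: the pointwise scalar products of its elements are (measurable and) integrable. In
particular its elements are square integrable. -/
def IsPreHilbert (K : Submodule ℂ (SectionClass μ E)) : Prop :=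
  ∀ ξ η : ∀ x, E x, cls μ ξ ∈ K → cls μ η ∈ K → Integrable (fun x => ⟪ξ x, η x⟫_ℂ) μ

/-- The Minkowski scalar product on `ℂ ⊕ K ⊕ ℂ`; the components of `(α, ξ, β)` are
`k_- = α`, `k_∘ = ξ`, `k_+ = β`. -/
def minkowski {K : Submodule ℂ (SectionClass μ E)} (p q : ℂ × K × ℂ) : ℂ :=
  conj p.1 * q.2.2 + sprod (p.2.1 : SectionClass μ E) (q.2.1 : SectionClass μ E)
    + conj p.2.2 * q.1

end DirectIntegral

/-! ### Transport of sections along the symmetry semigroup -/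

section Push

variable {S : Type w} [Semigroup S] {X : Type v} [MeasurableSpace X] {μ : Measure X}
  {𝔟 : Type u} [Monoid 𝔟] [StarMul 𝔟] (σ : Symmetry S μ 𝔟)
  {E : X → Type u} [∀ x, NormedAddCommGroup (E x)] [∀ x, InnerProductSpace ℂ (E x)]

open Classical in
/-- The section `V_s ξ` determined by fibre maps `V_s(x) : E_x → E_{sx}`: it is
`V_s(x) ξ(x)` at `s x`, and zero off `sX`. -/
def push (V : ∀ s x, E x →ₗ[ℂ] E (σ.act s x)) (s : S) (ξ : ∀ x, E x) : ∀ x, E x :=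
  fun y => if h : ∃ x, σ.act s x = y then h.choose_spec ▸ V s h.choose (ξ h.choose) else 0

theorem push_act (V : ∀ s x, E x →ₗ[ℂ] E (σ.act s x)) (s : S) (ξ : ∀ x, E x) (x : X) :
    push σ V s ξ (σ.act s x) = V s x (ξ x) := by
  have h : ∃ z, σ.act s z = σ.act s x := ⟨x, rfl⟩
  have key : ∀ z (hz : σ.act s z = σ.act s x), hz ▸ V s z (ξ z) = V s x (ξ x) := by
    intro z hz
    obtain rfl := (σ.measurableEmbedding s).injective hz
    rfl
  unfold push
  rw [dif_pos h]
  exact key _ h.choose_spec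

theorem push_of_notMem (V : ∀ s x, E x →ₗ[ℂ] E (σ.act s x)) (s : S) (ξ : ∀ x, E x) {y : X}
    (hy : ¬ ∃ x, σ.act s x = y) : push σ V s ξ y = 0 := by
  unfold push
  rw [dif_neg hy]

/-- The fibre maps `V_s(x) : E_x → E_{sx}` form an isometric representation of `S`: they are
isometric for almost every `x`, and `V_{st} = V_s V_t` on sections modulo null sets. -/
def IsIsometricRep (V : ∀ s x, E x →ₗ[ℂ] E (σ.act s x)) : Prop :=
  (∀ s, ∀ᵐ x ∂μ, ∀ e, ‖V s x e‖ = ‖e‖) ∧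
  ∀ s t (ξ : ∀ x, E x), cls μ (push σ V (s * t) ξ) = cls μ (push σ V s (push σ V t ξ))

end Push

/-! ### The four conditions -/

section Conditions

variable {S : Type w} [Semigroup S] {X : Type v} [MeasurableSpace X] {μ : Measure X}
  {𝔟 : Type u} [Monoid 𝔟] [StarMul 𝔟]

/-- A chaotic state over the step maps: a state with `φ (⊔ g n) = ∏ φ (g n)`. -/
def IsChaoticState (φ : StepMap μ 𝔟 → ℂ) : Prop :=
  IsState φ ∧
  ∀ (g : ℕ → StepMap μ 𝔟) (h : StepMap μ 𝔟), StepMap.IsJoin g h →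
    Tendsto (fun N => ∏ n ∈ Finset.range N, φ (g n)) atTop (𝓝 (φ h))

/-- `l` is the derivative of the set function `lam` in the sense of the Vitali system: for
almost every `x` and all `b`, `lam D b / μ D → l x b` as `D ↓ {x}`. -/
def IsVitaliDerivative (V : VitaliSystem μ) (lam : IntegrableSet μ → 𝔟 → ℂ)
    (l : X → 𝔟 → ℂ) : Prop :=
  ∀ᵐ x ∂μ, ∀ b,
    Tendsto (fun D : IntegrableSet μ => lam D b / (μ.real D.1 : ℂ)) (V.filterAt x) (𝓝 (l x b))

/-- The functionals `φ_D(b) = φ(b_D)` are infinitely divisible states (they come from a nowhere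
vanishing chaotic state), form an absolutely continuous multiplicative measure, and the limit of
`(φ_D(b) - 1) / μ_D` as `D ↓ {x}` exists. -/
structure InfinitelyDivisibleState (V : VitaliSystem μ) (φ : StepMap μ 𝔟 → ℂ) : Prop where
  isState : ∀ D, IsState (fun b : 𝔟 => φ (StepMap.ind b D))
  chaotic : IsChaoticState φ
  ne_zero : ∀ g, φ g ≠ 0
  absolutelyContinuous : ∀ (D : IntegrableSet μ) (b : 𝔟), μ D.1 = 0 → φ (StepMap.ind b D) = 1
  exists_derivative : ∃ l : X → 𝔟 → ℂ,
    IsVitaliDerivative V (fun D b => φ (StepMap.ind b D) - 1) l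

/-- `lam = ln φ` is an absolutely continuous (`σ`-additive) `S`-homogeneous cumulant generating
functional, with `S`-covariant Radon-Nikodym derivative `l`. -/
structure CumulantFunctional (σ : Symmetry S μ 𝔟) (V : VitaliSystem μ) (φ : StepMap μ 𝔟 → ℂ)
    (lam : StepMap μ 𝔟 → ℂ) (l : X → 𝔟 → ℂ) : Prop where
  exp_eq : ∀ g, Complex.exp (lam g) = φ g
  sigmaAdditive : ∀ (g : ℕ → StepMap μ 𝔟) (h : StepMap μ 𝔟), StepMap.IsJoin g h →
    HasSum (fun n => lam (g n)) (lam h)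
  absolutelyContinuous : ∀ (D : IntegrableSet μ) (b : 𝔟), μ D.1 = 0 → lam (StepMap.ind b D) = 0
  homogeneous : σ.IsHomogeneous lam
  cumulant : ∀ D, IsCumulant (fun b : 𝔟 => lam (StepMap.ind b D))
  integrableOn : ∀ (D : IntegrableSet μ) (b : 𝔟), IntegrableOn (fun x => l x b) D.1 μ
  eq_integral : ∀ (D : IntegrableSet μ) (b : 𝔟), lam (StepMap.ind b D) = ∫ x in D.1, l x b ∂μ
  derivative : IsVitaliDerivative V (fun D b => lam (StepMap.ind b D)) l
  covariant : σ.IsCovariantDensity l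

/-- `λ(g) = ∫ l(x, g) dx` with `l(x, g) = l_x(g(x))`. -/
def integralFunctional (μ : Measure X) (l : X → 𝔟 → ℂ) (g : StepMap μ 𝔟) : ℂ := ∫ x, l x (g x) ∂μ

/-- `φ = exp λ` for the integral functional `λ(g) = ∫ l_x(g(x)) dx` with density `l`, the density
being the Vitali derivative of `λ_D(b) = ∫_D l_x(b) dx`. -/
structure IsLogDensity (V : VitaliSystem μ) (φ : StepMap μ 𝔟 → ℂ) (l : X → 𝔟 → ℂ) : Prop where
  integrable : ∀ g : StepMap μ 𝔟, Integrable (fun x => l x (g x)) μ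
  exp_eq : ∀ g, Complex.exp (integralFunctional μ l g) = φ g
  derivative : IsVitaliDerivative V (fun D b => ∫ x in D.1, l x b ∂μ) l

variable {E : X → Type u} [∀ x, NormedAddCommGroup (E x)] [∀ x, InnerProductSpace ℂ (E x)]

/-- The vector `k(g) = ∫^⊕ k_x(g(x)) dx`. -/
def vec (k : ∀ x, 𝔟 → E x) (g : StepMap μ 𝔟) : SectionClass μ E := cls μ fun x => k x (g x)

/-- The linear functional `k^⋆(g) = k(g^⋆)^*`. -/
def covec (k : ∀ x, 𝔟 → E x) (g : StepMap μ 𝔟) (ξ : SectionClass μ E) : ℂ :=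
  sprod (vec k (star g)) ξ

/-- The decomposable operator `j(g) = ∫^⊕ j_x(g(x)) dx`. -/
def oper (j : ∀ x, 𝔟 → E x →ₗ[ℂ] E x) (g : StepMap μ 𝔟) :
    SectionClass μ E →ₗ[ℂ] SectionClass μ E :=
  decomposable fun x => j x (g x)

/-- The polynorm `‖ξ‖^h = (∫ ‖j(x, h) ξ(x)‖² dx)^{1/2}`. -/
def polynorm (j : ∀ x, 𝔟 → E x →ₗ[ℂ] E x) (h : StepMap μ 𝔟) (ξ : SectionClass μ E) : ℝ :=
  Real.sqrt (sprod (oper j h ξ) (oper j h ξ)).re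

/-- The covariant canonical triple: density `l`, cocycle `k` and representation `j`, intertwined by
the isometric representation `W` of `S`. -/
structure CanonicalTriple (σ : Symmetry S μ 𝔟) (V : VitaliSystem μ) (φ : StepMap μ 𝔟 → ℂ)
    (l : X → 𝔟 → ℂ) (k : ∀ x, 𝔟 → E x) (j : ∀ x, 𝔟 → E x →ₗ[ℂ] E x)
    (W : ∀ s x, E x →ₗ[ℂ] E (σ.act s x)) (K : Submodule ℂ (SectionClass μ E)) : Prop where
  -- the integral functional and its density
  logDensity : IsLogDensity V φ l
  homogeneous : σ.IsHomogeneous (integralFunctional μ l)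
  covariant : σ.IsCovariantDensity l
  l_star : ∀ x b, l x (star b) = conj (l x b)
  l_one : ∀ x, l x 1 = 0
  -- the vector map and the isometric representation
  preHilbert : IsPreHilbert K
  vec_mem : ∀ g : StepMap μ 𝔟, vec k g ∈ K
  k_one : ∀ x, k x 1 = 0
  isometricRep : IsIsometricRep σ W
  push_mem : ∀ s (ξ : ∀ x, E x), cls μ ξ ∈ K → cls μ (push σ W s ξ) ∈ K
  push_isometric : ∀ s (ξ : ∀ x, E x), cls μ ξ ∈ K →
    sprod (cls μ (push σ W s ξ)) (cls μ (push σ W s ξ)) = sprod (cls μ ξ) (cls μ ξ)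
  k_covariant : ∀ s, ∀ᵐ x ∂μ, ∀ b, k (σ.act s x) (σ.θ s b) = W s x (k x b)
  covec_vec : ∀ f h : StepMap μ 𝔟, covec k f (vec k h) =
    integralFunctional μ l (f * h) - integralFunctional μ l f - integralFunctional μ l h
  -- the representation
  j_one : ∀ x, j x 1 = LinearMap.id
  oper_mem : ∀ g, ∀ ξ ∈ K, oper j g ξ ∈ K
  oper_mul : ∀ g h, ∀ ξ ∈ K, oper j (g * h) ξ = oper j g (oper j h ξ)
  oper_star : ∀ g, ∀ ξ ∈ K, ∀ η ∈ K, sprod (oper j (star g) ξ) η = sprod ξ (oper j g η)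
  oper_one : ∀ ξ ∈ K, oper j 1 ξ = ξ
  oper_covariant : ∀ s g (ξ : ∀ x, E x), cls μ ξ ∈ K →
    cls μ (push σ W s fun x => j x (g x) (ξ x)) = oper j (σ.shift s g) (cls μ (push σ W s ξ))
  oper_vec : ∀ g h : StepMap μ 𝔟, oper j g (vec k h) = vec k (g * h) - vec k g
  covec_oper : ∀ f g : StepMap μ 𝔟, ∀ ξ ∈ K, covec k f (oper j g ξ) = covec k (f * g) ξ - covec k g ξ
  oper_continuous : ∀ g h, ∃ (F : Finset (StepMap μ 𝔟)) (C : ℝ), ∀ ξ ∈ K,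
    polynorm j h (oper j g ξ) ≤ C * ∑ f ∈ F, polynorm j f ξ

/-- The covariant family of `†`-representations `J D` of `𝔟` by triangular operators on the
pseudo-Hilbert spaces `ℂ ⊕ K D ⊕ ℂ`, intertwined by the block-diagonal pseudo-isometries `U s D`. -/
structure MinkowskiRep (σ : Symmetry S μ 𝔟) (V : VitaliSystem μ) (φ : StepMap μ 𝔟 → ℂ)
    (l : X → 𝔟 → ℂ) (k : ∀ x, 𝔟 → E x) (j : ∀ x, 𝔟 → E x →ₗ[ℂ] E x)
    (W : ∀ s x, E x →ₗ[ℂ] E (σ.act s x))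
    (K : ∀ D : IntegrableSet μ, Submodule ℂ (SectionClass (μ.restrict D.1) E))
    (J : ∀ D, 𝔟 → Module.End ℂ (ℂ × K D × ℂ))
    (U : ∀ s D, (ℂ × K D × ℂ) →ₗ[ℂ] (ℂ × K (σ.image s D) × ℂ)) : Prop where
  logDensity : IsLogDensity V φ l
  preHilbert : ∀ D, IsPreHilbert (K D)
  -- unital `†`-representation
  map_mul : ∀ D a b, J D (a * b) = J D a * J D b
  map_star : ∀ D b p q, minkowski (J D (star b) p) q = minkowski p (J D b q)
  map_one : ∀ D, J D 1 = 1
  -- triangular form, with rows `(1, k^⋆_D(b), λ_D(b))`, `(0, j_D(b), k_D(b))`, `(0, 0, 1)`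
  row_minus : ∀ D b (p : ℂ × K D × ℂ), (J D b p).1 =
    p.1 + sprod (cls (μ.restrict D.1) fun x => k x (star b)) (p.2.1 : SectionClass _ E)
      + (∫ x in D.1, l x b ∂μ) * p.2.2
  row_circ : ∀ D b (p : ℂ × K D × ℂ), ((J D b p).2.1 : SectionClass (μ.restrict D.1) E) =
    decomposable (fun x => j x b) (p.2.1 : SectionClass (μ.restrict D.1) E)
      + p.2.2 • cls (μ.restrict D.1) fun x => k x b
  row_plus : ∀ D b (p : ℂ × K D × ℂ), (J D b p).2.2 = p.2.2
  -- `λ_D(b)` is the vector form of the null vector `e`, and it is a logarithm of `φ_D(b)`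
  corner : ∀ D b, minkowski ((0, 0, 1) : ℂ × K D × ℂ) (J D b (0, 0, 1)) = ∫ x in D.1, l x b ∂μ
  null_vector : ∀ D, minkowski ((0, 0, 1) : ℂ × K D × ℂ) (0, 0, 1) = 0
  exp_corner : ∀ D b, Complex.exp (∫ x in D.1, l x b ∂μ) = φ (StepMap.ind b D)
  -- covariance
  isometricRep : IsIsometricRep σ W
  block_minus : ∀ s D (p : ℂ × K D × ℂ), (U s D p).1 = p.1
  block_circ : ∀ s D (p : ℂ × K D × ℂ) (ξ : ∀ x, E x),
    (p.2.1 : SectionClass (μ.restrict D.1) E) = cls (μ.restrict D.1) ξ →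
    ((U s D p).2.1 : SectionClass (μ.restrict (σ.image s D).1) E) =
      cls (μ.restrict (σ.image s D).1) (push σ W s ξ)
  block_plus : ∀ s D (p : ℂ × K D × ℂ), (U s D p).2.2 = p.2.2
  pseudoIsometric : ∀ s D p q, minkowski (U s D p) (U s D q) = minkowski p q
  intertwines : ∀ s D b p, U s D (J D b p) = J (σ.image s D) (σ.θ s b) (U s D p)

end Conditions

end LevyField

end

/-! All four conditions are compared with a fifth, `IsCumulantDensity`: φ(g) = exp ∫ l_x(g(x)) dx
for a density l that is the Vitali derivative of its own integrals and a cumulant functional at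
every point. Positivity passes from φ_Δ to l by differentiation, and back by integration and
Schoenberg's theorem; the pre-Hilbert spaces come from a GNS construction in each fibre.

From (i) to the density: for a step map g, the set function A ↦ φ(g|A) is nowhere zero,
σ-multiplicative and trivial on null sets. A gliding-hump argument (`exists_pos_forall_lt`) shows
that it is close to 1 on sets of small measure. There the principal logarithm is additive and
defines a complex measure (`logMeasure`). Vitali covering splits the support of g into finitely many
small sets, so Radon–Nikodym gives ρ_g on supp g with φ(g|A) = exp ∫ ρ_g over A ∩ supp g. Such
densities are unique almost everywhere, since multiples of 2πi cannot occur as integrals over small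
sets, and so they agree wherever the step maps do. By the differentiation theorem
`ae_tendsto_average`, and because exp z - 1 ~ z, they coincide with the given derivative l of φ_Δ -
1. A step map has only countably many values, hence ρ_g(x) = l_x(g(x)) almost everywhere on supp g
even if 𝔟 is uncountable (`isLogDensity`). Each φ_Δ - 1 is a cumulant functional, and so is the
limit l_x.

From (ii), only the integrability of l_x(g(x)) over infinitely many level sets is missing; it
follows from unconditional σ-additivity and `exists_integral_norm_le`.

From the density to (iii) and (iv): the kernel λ(a⋆c) - λ(a⋆) - λ(c) of a cumulant functional is
positive definite. Its pre-Hilbert space carries the cocycle k and the operators j(g)k(c) = k(gc) -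
k(g). Homogeneity of φ and uniqueness of the derivative make l covariant, so the cocycles at x and
sx have equal Gram matrices and are related by an isometry V_s. Conversely, the coboundary of λ is a
scalar product, explicitly in (iii) and as the corner entry of a product of triangular matrices in
(iv). Hence the λ_Δ are cumulant functionals, and differentiation returns a cumulant density. -/

noncomputable section

namespace LevyField

universe u v w

/-! ### Multiplicative measures -/

section Multiplicative

variable {X : Type v} [MeasurableSpace X]

/-- A nowhere vanishing `σ`-multiplicative set function, absolutely continuous with respect
to `ν`. -/
structure IsMultiplicativeMeasure (ν : Measure X) (Φ : Set X → ℂ) : Prop where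
  tendsto_prod : ∀ A : ℕ → Set X, (∀ n, MeasurableSet (A n)) →
    Pairwise (Function.onFun Disjoint A) →
    Tendsto (fun N => ∏ n ∈ Finset.range N, Φ (A n)) atTop (𝓝 (Φ (⋃ n, A n)))
  ne_zero : ∀ A, MeasurableSet A → Φ A ≠ 0
  null : ∀ A, MeasurableSet A → ν A = 0 → Φ A = 1

namespace IsMultiplicativeMeasure

variable {ν : Measure X} {Φ : Set X → ℂ}

theorem empty (h : IsMultiplicativeMeasure ν Φ) : Φ ∅ = 1 :=
  h.null ∅ MeasurableSet.empty measure_empty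

theorem union (h : IsMultiplicativeMeasure ν Φ) {A B : Set X} (hA : MeasurableSet A)
    (hB : MeasurableSet B) (hAB : Disjoint A B) : Φ (A ∪ B) = Φ A * Φ B := by
  -- σ-multiplicativity is applied to A, B, ∅, ∅, …; as Φ ∅ = 1, the partial products are constant
  -- from N = 2 on.
  let C : ℕ → Set X := fun n => if n = 0 then A else if n = 1 then B else ∅
  have hC : ∀ n, MeasurableSet (C n) := by
    intro n
    by_cases h0 : n = 0
    · simp [C, h0, hA]
    · by_cases h1 : n = 1 <;> simp [C, h0, h1, hB]
  have hd : Pairwise (Function.onFun Disjoint C) := by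
    intro m n hmn
    by_cases m0 : m = 0 <;> by_cases n0 : n = 0 <;> by_cases m1 : m = 1 <;>
      by_cases n1 : n = 1 <;> simp_all [C, Function.onFun, hAB.symm]
  have hU : ⋃ n, C n = A ∪ B := by
    ext x
    simp only [Set.mem_iUnion, Set.mem_union]
    constructor
    · rintro ⟨n, hn⟩
      by_cases h0 : n = 0
      · exact Or.inl (by simpa [C, h0] using hn)
      · by_cases h1 : n = 1
        · exact Or.inr (by simpa [C, h1] using hn)
        · simp [C, h0, h1] at hn
    · rintro (hx | hx)
      · exact ⟨0, by simpa [C] using hx⟩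
      · exact ⟨1, by simpa [C] using hx⟩
  have ht := h.tendsto_prod C hC hd
  rw [hU] at ht
  refine tendsto_nhds_unique ht (tendsto_atTop_of_eventually_const (i₀ := 2) fun N hN => ?_)
  obtain ⟨m, rfl⟩ := Nat.exists_eq_add_of_le hN
  rw [Finset.prod_range_add]
  have : ∀ x ∈ Finset.range m, Φ (C (2 + x)) = 1 := by
    intro x _
    have : C (2 + x) = ∅ := by
      simp [C, show 2 + x ≠ 1 by omega]
    rw [this, h.empty]
  rw [Finset.prod_eq_one this]
  simp [Finset.prod_range_succ, C]

theorem biUnion_finset (h : IsMultiplicativeMeasure ν Φ) {ι : Type*} (F : Finset ι)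
    {A : ι → Set X} (hA : ∀ i, MeasurableSet (A i)) (hd : Pairwise (Function.onFun Disjoint A)) :
    Φ (⋃ i ∈ F, A i) = ∏ i ∈ F, Φ (A i) := by
  classical
  induction F using Finset.induction_on with
  | empty => simp [h.empty]
  | insert a F ha ih =>
    rw [Finset.set_biUnion_insert, Finset.prod_insert ha,
      h.union (hA a) (F.measurableSet_biUnion fun i _ => hA i), ih]
    rw [Set.disjoint_iUnion₂_right]
    intro i hi
    exact hd fun e => ha (e ▸ hi)

theorem tendsto_monotone (h : IsMultiplicativeMeasure ν Φ) {B : ℕ → Set X}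
    (hB : ∀ n, MeasurableSet (B n)) (hm : Monotone B) :
    Tendsto (fun n => Φ (B n)) atTop (𝓝 (Φ (⋃ n, B n))) := by
  have hd := disjoint_disjointed B
  have ht := h.tendsto_prod (disjointed B) (fun n => MeasurableSet.disjointed hB n) hd
  rw [iUnion_disjointed] at ht
  have : ∀ n, Φ (B n) = ∏ k ∈ Finset.range (n + 1), Φ (disjointed B k) := by
    intro n
    rw [← h.biUnion_finset _ (fun n => MeasurableSet.disjointed hB n) hd]
    congr 1
    have h1 := biUnion_range_succ_disjointed B n
    have h2 : partialSups B n = B n := congrFun hm.partialSups_eq n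
    rw [← h2, ← h1]
  simp_rw [this]
  exact ht.comp (tendsto_add_atTop_nat 1)

/-- Φ (A n) is the quotient of two consecutive partial products, which tend to the same nonzero
limit. -/
theorem tendsto_one (h : IsMultiplicativeMeasure ν Φ) {A : ℕ → Set X}
    (hA : ∀ n, MeasurableSet (A n)) (hd : Pairwise (Function.onFun Disjoint A)) :
    Tendsto (fun n => Φ (A n)) atTop (𝓝 1) := by
  have ht := h.tendsto_prod A hA hd
  have hne := h.ne_zero _ (MeasurableSet.iUnion hA)
  have ht' := (ht.comp (tendsto_add_atTop_nat 1)).div ht hne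
  rw [div_self hne] at ht'
  refine ht'.congr fun n => ?_
  have : ∏ k ∈ Finset.range n, Φ (A k) ≠ 0 :=
    Finset.prod_ne_zero_iff.2 fun k _ => h.ne_zero _ (hA k)
  simp only [Function.comp, Pi.div_apply, Finset.prod_range_succ]
  field_simp

/-- Absolute continuity in the `ε`-`δ` form. -/
theorem exists_pos_forall_lt (h : IsMultiplicativeMeasure ν Φ) {ε : ℝ} (hε : 0 < ε) :
    ∃ δ : ℝ≥0∞, 0 < δ ∧ ∀ A, MeasurableSet A → ν A < δ → ‖Φ A - 1‖ < ε := by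
  by_contra! hcon
  obtain ⟨δ, hδ0, hδs⟩ := ENNReal.exists_pos_sum_of_countable' (ε := 1) one_ne_zero ℕ
  choose A hA hνA hΦA using fun n => hcon (δ n) (hδ0 n)
  -- Gliding hump: the bad sets A n have summable measures, so the tails E n decrease to a null set.
  -- Removing a far enough tail from A n spoils its badness by at most half; iterating gives
  -- disjoint bad sets, against `tendsto_one`.
  let E : ℕ → Set X := fun n => ⋃ m, A (n + m)
  have hE : ∀ n, MeasurableSet (E n) := fun n => MeasurableSet.iUnion fun m => hA _
  have hEanti : Antitone E := by
    intro m n hmn x hx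
    obtain ⟨k, hk⟩ := Set.mem_iUnion.1 hx
    refine Set.mem_iUnion.2 ⟨n - m + k, ?_⟩
    rwa [show m + (n - m + k) = n + k by omega]
  have hAE : ∀ n, A n ⊆ E n := fun n x hx => Set.mem_iUnion.2 ⟨0, by simpa using hx⟩
  have hnull : ν (⋂ n, E n) = 0 := by
    have hs : ∑' n, ν (A n) ≠ ∞ :=
      ne_top_of_le_ne_top (ne_of_lt (lt_trans hδs ENNReal.one_lt_top))
        (ENNReal.tsum_le_tsum fun n => (hνA n).le)
    have ht := ENNReal.tendsto_sum_nat_add (fun n => ν (A n)) hs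
    refine le_antisymm (ge_of_tendsto' ht fun n => ?_) zero_le
    calc ν (⋂ n, E n) ≤ ν (E n) := measure_mono (Set.iInter_subset _ _)
      _ ≤ ∑' m, ν (A (n + m)) := measure_iUnion_le _
      _ = _ := by simp_rw [add_comm n]
  have hstep : ∀ n, ∃ M, n < M ∧ ε / 2 < ‖Φ (A n \ E M) - 1‖ := by
    intro n
    have hmono : Monotone fun M => A n \ E M := fun M N hMN => Set.sdiff_subset_sdiff_right (hEanti hMN)
    have ht := h.tendsto_monotone (fun M => (hA n).diff (hE M)) hmono
    have hU : Φ (⋃ M, A n \ E M) = Φ (A n) := by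
      have hdec : A n = (⋃ M, A n \ E M) ∪ (A n ∩ ⋂ M, E M) := by
        ext x
        simp only [Set.mem_union, Set.mem_iUnion, Set.mem_sdiff, Set.mem_inter_iff, Set.mem_iInter]
        by_cases hx : ∀ i, x ∈ E i
        · simp [hx]
        · obtain ⟨i, hi⟩ := not_forall.1 hx
          exact ⟨fun hxA => Or.inl ⟨i, hxA, hi⟩, fun hx' => hx'.elim (fun ⟨_, hxA, _⟩ => hxA) And.left⟩
      have hdis : Disjoint (⋃ M, A n \ E M) (A n ∩ ⋂ M, E M) := by
        rw [Set.disjoint_left]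
        rintro x hx ⟨_, hx'⟩
        obtain ⟨M, hM⟩ := Set.mem_iUnion.1 hx
        exact hM.2 (Set.mem_iInter.1 hx' M)
      have hmi := (hA n).inter (MeasurableSet.iInter hE)
      have := h.union (MeasurableSet.iUnion fun M => (hA n).diff (hE M)) hmi hdis
      rw [← hdec, h.null _ hmi (measure_mono_null Set.inter_subset_right hnull), mul_one] at this
      exact this.symm
    rw [hU] at ht
    have ht2 : Tendsto (fun M => ‖Φ (A n \ E M) - 1‖) atTop (𝓝 ‖Φ (A n) - 1‖) :=
      (ht.sub_const 1).norm
    have hlt : ε / 2 < ‖Φ (A n) - 1‖ := lt_of_lt_of_le (half_lt_self hε) (hΦA n)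
    obtain ⟨M, hM⟩ := ((ht2.eventually (lt_mem_nhds hlt)).and (eventually_gt_atTop n)).exists
    exact ⟨M, hM.2, hM.1⟩
  choose next hnext hnextΦ using hstep
  let s : ℕ → ℕ := fun k => Nat.rec 0 (fun _ n => next n) k
  have hs : ∀ k, s (k + 1) = next (s k) := fun k => rfl
  have hsmono : StrictMono s := strictMono_nat_of_lt_succ fun k => by rw [hs]; exact hnext _
  -- Disjoint, because E (s (k + 1)) contains every A (s i) with i > k.
  let B : ℕ → Set X := fun k => A (s k) \ E (s (k + 1))
  have hB : ∀ k, MeasurableSet (B k) := fun k => (hA _).diff (hE _)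
  have hlt : ∀ j k, j < k → Disjoint (B j) (B k) := by
    intro j k hjk
    rw [Set.disjoint_left]
    rintro x ⟨_, hx⟩ ⟨hx', _⟩
    exact hx (hEanti (hsmono.monotone (Nat.succ_le_of_lt hjk)) (hAE _ hx'))
  have hd : Pairwise (Function.onFun Disjoint B) := by
    intro j k hjk
    rcases lt_or_gt_of_ne hjk with hl | hl
    · exact hlt j k hl
    · exact (hlt k j hl).symm
  have ht : Tendsto (fun k => ‖Φ (B k) - 1‖) atTop (𝓝 0) := by
    simpa using ((h.tendsto_one hB hd).sub_const 1).norm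
  obtain ⟨k, hk⟩ := (ht.eventually (gt_mem_nhds (half_pos hε))).exists
  exact absurd hk (not_lt.2 (by simpa only [B, hs] using (hnextΦ (s k)).le))

/-- In the right half plane both arguments are below π/2 in absolute value, so their sum does not
cross the branch cut. -/
theorem log_union (h : IsMultiplicativeMeasure ν Φ) {A B : Set X} (hA : MeasurableSet A)
    (hB : MeasurableSet B) (hAB : Disjoint A B) (hA' : 0 < (Φ A).re) (hB' : 0 < (Φ B).re) :
    Complex.log (Φ (A ∪ B)) = Complex.log (Φ A) + Complex.log (Φ B) := by
  rw [h.union hA hB hAB, Complex.log_mul (h.ne_zero _ hA) (h.ne_zero _ hB)]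
  have h1 := abs_lt.1 (Complex.abs_arg_lt_pi_div_two_iff.2 (Or.inl hA'))
  have h2 := abs_lt.1 (Complex.abs_arg_lt_pi_div_two_iff.2 (Or.inl hB'))
  constructor <;> linarith [h1.1, h1.2, h2.1, h2.2]

open Classical in
/-- If `Φ` has values in the right half plane on all subsets of `P`, then `A ↦ log Φ (A ∩ P)` is a
complex measure. -/
def logMeasure [IsFiniteMeasure ν] (h : IsMultiplicativeMeasure ν Φ) {P : Set X}
    (hP : MeasurableSet P)
    (hpos : ∀ A ⊆ P, MeasurableSet A → 0 < (Φ A).re) : ComplexMeasure X where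
  measureOf' A := if MeasurableSet A then Complex.log (Φ (A ∩ P)) else 0
  empty' := by simp [h.empty]
  not_measurable' A hA := if_neg hA
  m_iUnion' := by
    intro f hf hd
    have hf' : ∀ i, MeasurableSet (f i ∩ P) := fun i => (hf i).inter hP
    have hd' : Pairwise (Function.onFun Disjoint fun i => f i ∩ P) := fun i j hij =>
      (hd hij).mono Set.inter_subset_left Set.inter_subset_left
    simp only [hf, if_true, MeasurableSet.iUnion hf, Set.iUnion_inter]
    have hFm : ∀ F : Finset ℕ, MeasurableSet (⋃ i ∈ F, f i ∩ P) :=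
      fun F => F.measurableSet_biUnion fun i _ => hf' i
    have hFs : ∀ F : Finset ℕ, ⋃ i ∈ F, f i ∩ P ⊆ P :=
      fun F => Set.iUnion₂_subset fun i _ => Set.inter_subset_right
    have hsum : ∀ F : Finset ℕ,
        ∑ i ∈ F, Complex.log (Φ (f i ∩ P)) = Complex.log (Φ (⋃ i ∈ F, f i ∩ P)) := by
      intro F
      induction F using Finset.induction_on with
      | empty => simp [h.empty]
      | insert a F ha ih =>
        rw [Finset.set_biUnion_insert, Finset.sum_insert ha, ih, h.log_union (hf' a) (hFm F) _
          (hpos _ Set.inter_subset_right (hf' a)) (hpos _ (hFs F) (hFm F))]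
        rw [Set.disjoint_iUnion₂_right]
        intro i hi
        exact hd' fun e => ha (e ▸ hi)
    have hU : MeasurableSet (⋃ i, f i ∩ P) := MeasurableSet.iUnion hf'
    have hUs : ⋃ i, f i ∩ P ⊆ P := Set.iUnion_subset fun i => Set.inter_subset_right
    unfold HasSum
    simp_rw [hsum]
    refine Tendsto.clog ?_ (Or.inl (hpos _ hUs hU))
    -- `tendsto_prod` speaks only of initial segments, whereas `HasSum` needs all finite sets F. The
    -- sets outside F have small total measure, so Φ of their union is near 1, and dividing by it
    -- gives convergence along F.
    have hrest : Tendsto (fun F : Finset ℕ => Φ (⋃ i : {i // i ∉ F}, f i ∩ P)) atTop (𝓝 1) := by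
      rw [Metric.tendsto_nhds]
      intro ε hε
      obtain ⟨δ, hδ, hδΦ⟩ := h.exists_pos_forall_lt hε
      have hs : ∑' i, ν (f i ∩ P) ≠ ∞ := by
        rw [← measure_iUnion hd' hf']
        exact measure_ne_top _ _
      filter_upwards [(ENNReal.tendsto_tsum_compl_atTop_zero hs).eventually (gt_mem_nhds hδ)] with F hF
      rw [dist_eq_norm]
      exact hδΦ _ (MeasurableSet.iUnion fun i => hf' i) ((measure_iUnion_le _).trans_lt hF)
    have hsplit : ∀ F : Finset ℕ, Φ (⋃ i ∈ F, f i ∩ P) =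
        Φ (⋃ i, f i ∩ P) / Φ (⋃ i : {i // i ∉ F}, f i ∩ P) := by
      intro F
      have hRm : MeasurableSet (⋃ i : {i // i ∉ F}, f i ∩ P) := MeasurableSet.iUnion fun i => hf' i
      rw [eq_div_iff (h.ne_zero _ hRm), ← h.union (hFm F) hRm]
      · congr 1
        ext x
        simp only [Set.mem_union, Set.mem_iUnion, Subtype.exists, exists_prop]
        constructor
        · rintro (⟨i, _, hi⟩ | ⟨i, _, hi⟩) <;> exact ⟨i, hi⟩
        · rintro ⟨i, hi⟩
          by_cases hiF : i ∈ F
          · exact Or.inl ⟨i, hiF, hi⟩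
          · exact Or.inr ⟨i, hiF, hi⟩
      · rw [Set.disjoint_iUnion₂_left]
        intro i hi
        rw [Set.disjoint_iUnion_right]
        intro j
        exact hd' fun e => j.2 (e ▸ hi)
    simp_rw [hsplit]
    have := (tendsto_const_nhds (x := Φ (⋃ i, f i ∩ P))).div hrest one_ne_zero
    rwa [div_one] at this

theorem logMeasure_apply [IsFiniteMeasure ν] (h : IsMultiplicativeMeasure ν Φ) {P : Set X}
    (hP : MeasurableSet P) (hpos : ∀ A ⊆ P, MeasurableSet A → 0 < (Φ A).re) {A : Set X}
    (hA : MeasurableSet A) : h.logMeasure hP hpos A = Complex.log (Φ (A ∩ P)) :=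
  if_pos hA

end IsMultiplicativeMeasure

/-- A complex measure which vanishes on the null sets of a `σ`-finite measure has a density. -/
theorem exists_density_of_null (ν : Measure X) [SigmaFinite ν] (c : ComplexMeasure X)
    (hc : ∀ A, MeasurableSet A → ν A = 0 → c A = 0) :
    ∃ ρ : X → ℂ, Integrable ρ ν ∧ ∀ A, MeasurableSet A → c A = ∫ x in A, ρ x ∂ν := by
  have hac : ∀ s : SignedMeasure X, (∀ A, MeasurableSet A → ν A = 0 → s A = 0) →
      s ≪ᵥ ν.toENNRealVectorMeasure := by
    intro s hs
    refine VectorMeasure.AbsolutelyContinuous.mk fun A hA h0 => hs A hA ?_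
    rwa [Measure.toENNRealVectorMeasure_apply_measurable hA] at h0
  have hre : ∀ A, MeasurableSet A → ν A = 0 → ComplexMeasure.re c A = 0 := by
    intro A hA h0
    change (c A).re = 0
    rw [hc A hA h0, Complex.zero_re]
  have him : ∀ A, MeasurableSet A → ν A = 0 → ComplexMeasure.im c A = 0 := by
    intro A hA h0
    change (c A).im = 0
    rw [hc A hA h0, Complex.zero_im]
  have h1 := SignedMeasure.withDensityᵥ_rnDeriv_eq _ ν (hac _ hre)
  have h2 := SignedMeasure.withDensityᵥ_rnDeriv_eq _ ν (hac _ him)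
  have hi := c.integrable_rnDeriv ν
  refine ⟨c.rnDeriv ν, hi, fun A hA => Complex.ext ?_ ?_⟩
  · have e1 : (c A).re = ComplexMeasure.re c A := rfl
    rw [e1, ← h1, withDensityᵥ_apply (SignedMeasure.integrable_rnDeriv _ _) hA]
    exact integral_re hi.integrableOn
  · have e1 : (c A).im = ComplexMeasure.im c A := rfl
    rw [e1, ← h2, withDensityᵥ_apply (SignedMeasure.integrable_rnDeriv _ _) hA]
    exact integral_im hi.integrableOn

/-- Radon–Nikodym for the logarithm of Φ on a single small piece P. -/
theorem IsMultiplicativeMeasure.exists_density_inter {ν : Measure X} [IsFiniteMeasure ν]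
    {Φ : Set X → ℂ} (h : IsMultiplicativeMeasure ν Φ) {P : Set X} (hP : MeasurableSet P)
    (hpos : ∀ A ⊆ P, MeasurableSet A → 0 < (Φ A).re) :
    ∃ ρ : X → ℂ, Integrable ρ ν ∧
      ∀ A, MeasurableSet A → Φ (A ∩ P) = Complex.exp (∫ x in A, ρ x ∂ν) := by
  obtain ⟨ρ, hρ, H⟩ := exists_density_of_null ν (h.logMeasure hP hpos) (fun A hA h0 => by
    rw [h.logMeasure_apply hP hpos hA, h.null _ (hA.inter hP)
      (measure_mono_null Set.inter_subset_left h0), Complex.log_one])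
  refine ⟨ρ, hρ, fun A hA => ?_⟩
  rw [← H A hA, h.logMeasure_apply hP hpos hA, Complex.exp_log (h.ne_zero _ (hA.inter hP))]

/-- If the space splits into finitely many sets of arbitrarily small measure, a multiplicative
measure is the exponential of an integral. -/
theorem IsMultiplicativeMeasure.exists_density {ν : Measure X} [IsFiniteMeasure ν]
    {Φ : Set X → ℂ} (h : IsMultiplicativeMeasure ν Φ)
    (hsplit : ∀ δ : ℝ≥0∞, 0 < δ → ∃ (N : ℕ) (P : ℕ → Set X), (∀ n, MeasurableSet (P n)) ∧
      Pairwise (Function.onFun Disjoint P) ∧ (∀ n, ν (P n) < δ) ∧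
      ⋃ n ∈ Finset.range N, P n = Set.univ) :
    ∃ ρ : X → ℂ, Integrable ρ ν ∧
      ∀ A, MeasurableSet A → Φ A = Complex.exp (∫ x in A, ρ x ∂ν) := by
  -- The bound ‖Φ A - 1‖ < 1 forces a positive real part on all subsets of a piece of measure below
  -- δ.
  obtain ⟨δ, hδ, hδΦ⟩ := h.exists_pos_forall_lt one_pos
  obtain ⟨N, P, hP, hd, hPδ, hU⟩ := hsplit δ hδ
  have hpos : ∀ n, ∀ A ⊆ P n, MeasurableSet A → 0 < (Φ A).re := by
    intro n A hAP hA
    have h1 := hδΦ A hA ((measure_mono hAP).trans_lt (hPδ n))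
    have h2 := (abs_lt.1 ((Complex.abs_re_le_norm _).trans_lt h1)).1
    simp only [Complex.sub_re, Complex.one_re] at h2
    linarith
  choose ρ hρ H using fun n => h.exists_density_inter (hP n) (hpos n)
  refine ⟨fun x => ∑ n ∈ Finset.range N, ρ n x, integrable_finsetSum _ fun n _ => hρ n,
    fun A hA => ?_⟩
  rw [integral_finsetSum _ fun n _ => (hρ n).integrableOn, Complex.exp_sum]
  simp_rw [← H _ A hA]
  rw [← h.biUnion_finset _ (A := fun n => A ∩ P n) (fun n => hA.inter (hP n))
    (fun i j hij => (hd hij).mono Set.inter_subset_right Set.inter_subset_right),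
    ← Set.inter_iUnion₂, hU, Set.inter_univ]

end Multiplicative

/-! ### Small partitions and differentiation in a Vitali system -/

section Vitali

variable {X : Type v} [MeasurableSpace X] {μ : Measure X}

/-- The sets shrinking to a point have measures tending to zero, so those of measure below δ cover A
finely. Countably many of them cover A up to a null set, which enters the partition as a further
member. -/
theorem VitaliSystem.exists_partition (V : VitaliSystem μ) {A : Set X} (hA : MeasurableSet A)
    (hAf : μ A < ∞) {δ : ℝ≥0∞} (hδ : 0 < δ) :
    ∃ P : ℕ → Set X, (∀ n, MeasurableSet (P n)) ∧ Pairwise (Function.onFun Disjoint P) ∧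
      (∀ n, μ (P n) < δ) ∧ ⋃ n, P n = A := by
  let G : Set X := {x | (V.filterAt x).NeBot ∧
    Tendsto (fun D : IntegrableSet μ => μ D.1) (V.filterAt x) (𝓝 0)}
  have hG : ∀ᵐ x ∂μ, x ∈ G := by
    filter_upwards [V.neBot, V.tendsto_zero] with x h1 h2 using ⟨h1, h2⟩
  obtain ⟨T, hTc, hTF, -, hT0, -⟩ := V.covering (A ∩ G) (fun _ => {D | μ D.1 < δ})
    ((measure_mono Set.inter_subset_left).trans_lt hAf)
    (fun x hx => by
      have := hx.2.1
      exact (hx.2.2.eventually (gt_mem_nhds hδ)).frequently) 1 one_pos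
  -- Adjoining ∅ makes the family nonempty, so that it can be enumerated by ℕ.
  let D₀ : IntegrableSet μ := ⟨∅, MeasurableSet.empty, by simp⟩
  obtain ⟨f, hf⟩ := (hTc.insert D₀).exists_eq_range (Set.insert_nonempty _ _)
  have hfδ : ∀ n, μ (f n).1 < δ := by
    intro n
    have hn : f n ∈ insert D₀ T := hf ▸ Set.mem_range_self n
    rcases hn with hn | hn
    · rw [hn]
      simpa [D₀] using hδ
    · obtain ⟨x, _, hx⟩ := hTF _ hn
      exact hx
  let R : Set X := A \ ⋃ n, (f n).1
  have hRm : MeasurableSet R := hA.diff (MeasurableSet.iUnion fun n => (f n).2.1)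
  have hR : μ R = 0 := by
    refine measure_mono_null (t := ((A ∩ G) \ ⋃ D ∈ T, D.1) ∪ Gᶜ) ?_
      (measure_union_null hT0 hG)
    rintro x ⟨hxA, hx⟩
    by_cases hxG : x ∈ G
    · refine Or.inl ⟨⟨hxA, hxG⟩, fun hx' => hx ?_⟩
      obtain ⟨D, hD, hxD⟩ := Set.mem_iUnion₂.1 hx'
      obtain ⟨n, rfl⟩ : D ∈ Set.range f := hf ▸ Set.mem_insert_of_mem _ hD
      exact Set.mem_iUnion.2 ⟨n, hxD⟩
    · exact Or.inr hxG
  let Q : ℕ → Set X := fun n => Nat.casesOn n R fun n => (f n).1 ∩ A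
  have hQ : ∀ n, MeasurableSet (Q n) := by
    rintro (_ | n)
    · exact hRm
    · exact (f n).2.1.inter hA
  refine ⟨disjointed Q, fun n => MeasurableSet.disjointed hQ n, disjoint_disjointed Q,
    fun n => (measure_mono (disjointed_subset Q n)).trans_lt ?_, ?_⟩
  · rcases n with _ | n
    · exact hR.trans_lt hδ
    · exact (measure_mono Set.inter_subset_left).trans_lt (hfδ n)
  · rw [iUnion_disjointed]
    ext x
    rw [Set.mem_iUnion]
    constructor
    · rintro ⟨_ | n, hn⟩
      · exact hn.1
      · exact hn.2
    · intro hx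
      by_cases hx' : x ∈ ⋃ n, (f n).1
      · obtain ⟨n, hn⟩ := Set.mem_iUnion.1 hx'
        exact ⟨n + 1, hn, hx⟩
      · exact ⟨0, hx, hx'⟩

/-- A tail of a countable partition has total measure below δ. It is merged into one set R together
with the complement of A, which the restricted measure does not see. -/
theorem VitaliSystem.exists_finite_partition (V : VitaliSystem μ) {A : Set X}
    (hA : MeasurableSet A) (hAf : μ A < ∞) {δ : ℝ≥0∞} (hδ : 0 < δ) :
    ∃ (N : ℕ) (P : ℕ → Set X), (∀ n, MeasurableSet (P n)) ∧
      Pairwise (Function.onFun Disjoint P) ∧ (∀ n, μ.restrict A (P n) < δ) ∧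
      ⋃ n ∈ Finset.range N, P n = Set.univ := by
  obtain ⟨P, hP, hd, hPδ, hU⟩ := V.exists_partition hA hAf hδ
  have hs : ∑' n, μ (P n) ≠ ∞ := by
    rw [← measure_iUnion hd hP, hU]
    exact hAf.ne
  obtain ⟨N, hN⟩ :=
    ((ENNReal.tendsto_sum_nat_add (fun n => μ (P n)) hs).eventually (gt_mem_nhds hδ)).exists
  let R : Set X := (⋃ n ∈ Finset.range N, P n)ᶜ
  have hRm : MeasurableSet R := (Finset.measurableSet_biUnion _ fun n _ => hP n).compl
  have hR : μ.restrict A R < δ := by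
    rw [Measure.restrict_apply hRm]
    refine lt_of_le_of_lt (measure_mono (t := ⋃ n, P (n + N)) ?_)
      ((measure_iUnion_le _).trans_lt hN)
    rintro x ⟨hxR, hxA⟩
    rw [← hU] at hxA
    obtain ⟨n, hn⟩ := Set.mem_iUnion.1 hxA
    have hnN : N ≤ n := by
      by_contra hlt
      exact hxR (Set.mem_iUnion₂.2 ⟨n, Finset.mem_range.2 (not_le.1 hlt), hn⟩)
    exact Set.mem_iUnion.2 ⟨n - N, by rwa [Nat.sub_add_cancel hnN]⟩
  have hdR : ∀ n < N, Disjoint (P n) R := fun n hn =>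
    Set.disjoint_compl_right_iff_subset.2
      (Set.subset_biUnion_of_mem (u := P) (Finset.mem_coe.2 (Finset.mem_range.2 hn)))
  let Q : ℕ → Set X := fun n => if n < N then P n else if n = N then R else ∅
  have hQ : ∀ m n, m < n → Disjoint (Q m) (Q n) := by
    intro m n hmn
    rcases lt_trichotomy n N with h | h | h
    · simpa only [Q, h, hmn.trans h, if_true] using hd hmn.ne
    · simpa only [Q, h, h ▸ hmn, lt_irrefl, if_true, if_false] using hdR m (h ▸ hmn)
    · simp only [Q, h.not_gt, h.ne', if_false, Set.disjoint_empty]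
  refine ⟨N + 1, Q, fun n => ?_, fun m n hmn => ?_, fun n => ?_, ?_⟩
  · by_cases h1 : n < N
    · simp [Q, h1, hP]
    · by_cases h2 : n = N <;> simp [Q, h1, h2, hRm]
  · rcases lt_or_gt_of_ne hmn with h | h
    · exact hQ m n h
    · exact (hQ n m h).symm
  · by_cases h1 : n < N
    · simp only [Q, h1, if_true]
      exact (Measure.restrict_apply_le _ _).trans_lt (hPδ n)
    · by_cases h2 : n = N
      · simp only [Q, h2, lt_irrefl, if_true, if_false]
        exact hR
      · simpa [Q, h1, h2] using hδ
  · rw [Set.eq_univ_iff_forall]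
    intro x
    rw [Set.mem_iUnion₂]
    by_cases hx : x ∈ R
    · exact ⟨N, by simp, by simpa [Q] using hx⟩
    · obtain ⟨n, hn, hxn⟩ := Set.mem_iUnion₂.1 (not_not.1 hx)
      have hn' := Finset.mem_range.1 hn
      exact ⟨n, Finset.mem_range.2 (by omega), by simpa [Q, hn'] using hxn⟩

/-- The kernel 2πiℤ of the exponential meets the unit disc only in zero. -/
theorem eq_zero_of_exp_eq_one_of_norm_lt {z : ℂ} (h : Complex.exp z = 1) (hz : ‖z‖ < 1) :
    z = 0 := by
  have h1 := (abs_lt.1 ((Complex.abs_im_le_norm z).trans_lt hz))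
  have hpi := Real.pi_gt_three
  rw [← Complex.log_exp (x := z) (by linarith [h1.1]) (by linarith [h1.2]), h, Complex.log_one]

/-- A density is determined by the exponentials of its integrals. -/
theorem VitaliSystem.ae_eq_zero_of_exp_integral_eq_one (V : VitaliSystem μ) {A : Set X}
    (hA : MeasurableSet A) (hAf : μ A < ∞) {f : X → ℂ} (hf : IntegrableOn f A μ)
    (hexp : ∀ B ⊆ A, MeasurableSet B → Complex.exp (∫ x in B, f x ∂μ) = 1) :
    ∀ᵐ x ∂μ.restrict A, f x = 0 := by
  -- On sets of measure below δ the integral of f has norm less than 1, so it cannot be a nonzero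
  -- multiple of 2πi.
  obtain ⟨δ, hδ, H⟩ := exists_pos_setLIntegral_lt_of_measure_lt
    (μ := μ.restrict A) (f := fun x => ‖f x‖ₑ) (ne_of_lt hf.2) (ε := 1) one_ne_zero
  obtain ⟨P, hP, hd, hPδ, hU⟩ := V.exists_partition hA hAf hδ
  have hPA : ∀ n, P n ⊆ A := fun n => hU ▸ Set.subset_iUnion P n
  rw [← hU, ae_restrict_iUnion_iff]
  intro n
  have hfn : IntegrableOn f (P n) μ := hf.mono_set (hPA n)
  refine Integrable.ae_eq_zero_of_forall_setIntegral_eq_zero hfn fun s hs _ => ?_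
  rw [Measure.restrict_restrict hs]
  have hsub : s ∩ P n ⊆ A := Set.inter_subset_right.trans (hPA n)
  have hsm : MeasurableSet (s ∩ P n) := hs.inter (hP n)
  refine eq_zero_of_exp_eq_one_of_norm_lt (hexp _ hsub hsm) ?_
  have h1 := H (s ∩ P n) (by
    rw [Measure.restrict_apply hsm]
    exact (measure_mono (Set.inter_subset_left.trans Set.inter_subset_right)).trans_lt (hPδ n))
  rw [Measure.restrict_restrict hsm, Set.inter_eq_left.2 hsub] at h1
  have h2 := (enorm_integral_le_lintegral_enorm (μ := μ.restrict (s ∩ P n)) f).trans_lt h1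
  rw [← ofReal_norm] at h2
  exact ENNReal.ofReal_lt_one.1 h2

/-- A function that is integrable on all sets of finite measure has uniformly absolutely continuous
integrals. -/
theorem exists_pos_setLIntegral_lt_of_integrableOn {F : Type*} [NormedAddCommGroup F]
    {f : X → F} (hf : ∀ D : IntegrableSet μ, IntegrableOn f D.1 μ) {ε : ℝ≥0∞} (hε : 0 < ε) :
    ∃ δ : ℝ≥0∞, 0 < δ ∧ ∀ A, MeasurableSet A → μ A < δ → ∫⁻ x in A, ‖f x‖ₑ ∂μ < ε := by
  by_contra! hcon
  obtain ⟨δ, hδ0, hδs⟩ := ENNReal.exists_pos_sum_of_countable' (ε := 1) one_ne_zero ℕ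
  choose A hA hμA hfA using fun n => hcon (δ n) (hδ0 n)
  have hs : ∑' n, μ (A n) ≠ ∞ := ne_top_of_le_ne_top (ne_of_lt (lt_trans hδs ENNReal.one_lt_top))
        (ENNReal.tsum_le_tsum fun n => (hμA n).le)
  -- The counterexamples have summable measures, hence lie in one integrable set, where the ordinary
  -- absolute continuity of the integral contradicts them.
  let D : IntegrableSet μ := ⟨⋃ n, A n, MeasurableSet.iUnion hA,
    (measure_iUnion_le _).trans_lt (lt_top_iff_ne_top.2 hs)⟩
  obtain ⟨η, hη, H⟩ := exists_pos_setLIntegral_lt_of_measure_lt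
    (μ := μ.restrict D.1) (f := fun x => ‖f x‖ₑ) (ne_of_lt (hf D).2) hε.ne'
  have ht := ENNReal.tendsto_atTop_zero_of_tsum_ne_top hs
  obtain ⟨n, hn⟩ := (ht.eventually (gt_mem_nhds hη)).exists
  have h1 := H (A n) ((Measure.restrict_apply_le _ _).trans_lt hn)
  rw [Measure.restrict_restrict (hA n), Set.inter_eq_left.2 (Set.subset_iUnion A n)] at h1
  exact absurd h1 (not_lt.2 (hfA n))

/-- Suppose that points with f < c carry arbitrarily small sets with positive integral. Disjoint
such sets cover almost all of these points with little overflow, and the integral over their union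
is nonnegative. Yet it is at most c times the measure of the points covered plus a small error, so
that measure is zero. -/
theorem VitaliSystem.ae_eventually_integral_nonpos [SigmaFinite μ] (V : VitaliSystem μ) {f : X → ℝ}
    (hfm : Measurable f) (hf : ∀ D : IntegrableSet μ, IntegrableOn f D.1 μ) {c : ℝ} (hc : c < 0) :
    ∀ᵐ x ∂μ, f x < c → ∀ᶠ D in V.filterAt x, ∫ y in D.1, f y ∂μ ≤ 0 := by
  let B : Set X := {x | f x < c ∧ ∃ᶠ D in V.filterAt x, 0 < ∫ y in D.1, f y ∂μ}
  suffices hB : ∀ n, μ (B ∩ spanningSets μ n) = 0 by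
    have h0 : μ B = 0 := by
      rw [← Set.inter_univ B, ← iUnion_spanningSets μ, Set.inter_iUnion]
      exact measure_iUnion_null hB
    filter_upwards [measure_eq_zero_iff_ae_notMem.1 h0] with x hx hxc
    by_contra hcon
    refine hx ⟨hxc, fun h => hcon ?_⟩
    filter_upwards [h] with D hD using not_lt.1 hD
  intro n
  set A : Set X := B ∩ spanningSets μ n
  have hAf : μ A < ∞ := (measure_mono Set.inter_subset_right).trans_lt (measure_spanningSets_lt_top μ n)
  -- A need not be measurable; A' is a measurable set containing it, of the same measure, on which f
  -- < c still holds.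
  set A' : Set X := toMeasurable μ A ∩ {x | f x < c}
  have hA'm : MeasurableSet A' :=
    (measurableSet_toMeasurable μ A).inter (measurableSet_lt hfm measurable_const)
  have hAA' : A ⊆ A' := fun x hx => ⟨subset_toMeasurable μ A hx, hx.1.1⟩
  have hA' : μ A' = μ A := le_antisymm
    ((measure_mono Set.inter_subset_left).trans (measure_toMeasurable A).le) (measure_mono hAA')
  -- η bounds the integral over the overflow U \ A', whose measure is below δ by the choice of ε < δ
  -- in the covering property.
  have hkey : ∀ η : ℝ, 0 < η → 0 ≤ c * μ.real A' + η := by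
    intro η hη
    obtain ⟨δ, hδ, H⟩ := exists_pos_setLIntegral_lt_of_integrableOn hf (ENNReal.ofReal_pos.2 hη)
    obtain ⟨ε, hε, hεδ⟩ := exists_between hδ
    obtain ⟨T, hTc, hTF, hTd, hT0, hTε⟩ := V.covering A
      (fun _ => {D | 0 < ∫ y in D.1, f y ∂μ}) hAf (fun x hx => hx.1.2) ε hε
    have := hTc.to_subtype
    set U : Set X := ⋃ D : T, D.1.1
    have hUeq : ⋃ D ∈ T, D.1 = U := Set.biUnion_eq_iUnion T fun D _ => D.1
    rw [hUeq] at hT0 hTε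
    have hUm : MeasurableSet U := MeasurableSet.iUnion fun D => D.1.2.1
    have hUf : μ U < ∞ := hTε.trans_lt (ENNReal.add_lt_top.2 ⟨hAf, hεδ.trans_le le_top⟩)
    have hfU : IntegrableOn f U μ := hf ⟨U, hUm, hUf⟩
    have hU0 : 0 ≤ ∫ y in U, f y ∂μ := by
      refine (hasSum_integral_iUnion (fun D : T => D.1.2.1) ?_ hfU).nonneg fun D => ?_
      · intro D D' hDD'
        exact hTd D.2 D'.2 fun e => hDD' (Subtype.ext e)
      · obtain ⟨x, _, hx⟩ := hTF D.1 D.2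
        exact le_of_lt hx
    have hmeas : μ A' ≤ μ (U ∩ A') := by
      calc μ A' = μ A := hA'
        _ ≤ μ (A ∩ U) + μ (A \ U) := measure_le_inter_add_sdiff μ A U
        _ = μ (A ∩ U) := by rw [hT0, add_zero]
        _ ≤ μ (U ∩ A') := measure_mono fun x hx => ⟨hx.2, hAA' hx.1⟩
    have hmeas' : μ (U ∩ A') = μ A' := le_antisymm (measure_mono Set.inter_subset_right) hmeas
    have hdiff : μ (U \ A') < δ := by
      have h1 := measure_inter_add_sdiff U hA'm (μ := μ)
      rw [hmeas', hA'] at h1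
      have h2 : μ A + μ (U \ A') ≤ μ A + ε := h1.trans_le hTε
      exact ((ENNReal.add_le_add_iff_left hAf.ne).1 h2).trans_lt hεδ
    have hI1 : ∫ y in U ∩ A', f y ∂μ ≤ c * μ.real A' := by
      have h1 : ∫ y in U ∩ A', f y ∂μ ≤ ∫ y in U ∩ A', c ∂μ :=
        setIntegral_mono_on (hfU.mono_set Set.inter_subset_left)
          (integrableOn_const (by rw [hmeas', hA']; exact hAf.ne)) (hUm.inter hA'm)
          fun x hx => hx.2.2.le
      rwa [setIntegral_const, smul_eq_mul, mul_comm, Measure.real, hmeas'] at h1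
    have hI2 : ∫ y in U \ A', f y ∂μ ≤ η := by
      have h1 := H _ (hUm.diff hA'm) hdiff
      have h2 := (enorm_integral_le_lintegral_enorm (μ := μ.restrict (U \ A')) f).trans_lt h1
      rw [← ofReal_norm] at h2
      exact (le_abs_self _).trans ((ENNReal.ofReal_lt_ofReal_iff hη).1 h2).le
    rw [← integral_inter_add_sdiff hA'm hfU] at hU0
    linarith
  have hA'0 : μ.real A' = 0 := by
    by_contra hne
    have hpos : 0 < μ.real A' := lt_of_le_of_ne measureReal_nonneg (Ne.symm hne)
    have := hkey (-c * μ.real A' / 2) (by have := mul_pos (neg_pos.2 hc) hpos; linarith)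
    nlinarith [mul_pos (neg_pos.2 hc) hpos]
  rw [measureReal_eq_zero_iff (by rw [hA']; exact hAf.ne)] at hA'0
  rw [← hA', hA'0]

/-- The sign lemma is applied to f - q and q - f for rational q. The gaps 1/(n+1) provide its
strictly negative constant, and countably many null sets suffice. -/
theorem VitaliSystem.ae_tendsto_average_of_measurable [SigmaFinite μ] (V : VitaliSystem μ)
    {f : X → ℝ} (hfm : Measurable f) (hf : ∀ D : IntegrableSet μ, IntegrableOn f D.1 μ) :
    ∀ᵐ x ∂μ, Tendsto (fun D : IntegrableSet μ => (∫ y in D.1, f y ∂μ) / μ.real D.1)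
      (V.filterAt x) (𝓝 (f x)) := by
  have hconst : ∀ (q : ℝ) (D : IntegrableSet μ), IntegrableOn (fun _ : X => q) D.1 μ :=
    fun q D => integrableOn_const D.2.2.ne
  have h1 : ∀ᵐ x ∂μ, ∀ (q : ℚ) (n : ℕ), f x - q < -(1 / ((n : ℝ) + 1)) →
      ∀ᶠ D in V.filterAt x, ∫ y in D.1, (f y - q) ∂μ ≤ 0 := by
    refine ae_all_iff.2 fun q => ae_all_iff.2 fun n => ?_
    exact V.ae_eventually_integral_nonpos (hfm.sub_const _) (fun D => (hf D).sub (hconst q D))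
      (neg_lt_zero.2 Nat.one_div_pos_of_nat)
  have h2 : ∀ᵐ x ∂μ, ∀ (q : ℚ) (n : ℕ), q - f x < -(1 / ((n : ℝ) + 1)) →
      ∀ᶠ D in V.filterAt x, ∫ y in D.1, (q - f y) ∂μ ≤ 0 := by
    refine ae_all_iff.2 fun q => ae_all_iff.2 fun n => ?_
    exact V.ae_eventually_integral_nonpos (measurable_const.sub hfm)
      (fun D => (hconst q D).sub (hf D)) (neg_lt_zero.2 Nat.one_div_pos_of_nat)
  have hpos : ∀ D : IntegrableSet μ, 0 < μ D.1 → 0 < μ.real D.1 := fun D hD =>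
    ENNReal.toReal_pos hD.ne' D.2.2.ne
  filter_upwards [h1, h2, V.mem_pos] with x h1 h2 h3
  refine tendsto_order.2 ⟨fun a ha => ?_, fun a ha => ?_⟩
  · obtain ⟨q, haq, hqf⟩ := exists_rat_btwn ha
    obtain ⟨n, hn⟩ := exists_nat_one_div_lt (sub_pos.2 hqf)
    filter_upwards [h2 q n (by linarith), h3] with D hD hD'
    rw [integral_sub (hconst q D) (hf D), setIntegral_const, smul_eq_mul, sub_nonpos] at hD
    refine haq.trans_le ((le_div_iff₀ (hpos D hD'.2)).2 ?_)
    rwa [mul_comm]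
  · obtain ⟨q, hfq, hqa⟩ := exists_rat_btwn ha
    obtain ⟨n, hn⟩ := exists_nat_one_div_lt (sub_pos.2 hfq)
    filter_upwards [h1 q n (by linarith), h3] with D hD hD'
    rw [integral_sub (hf D) (hconst q D), setIntegral_const, smul_eq_mul, sub_nonpos] at hD
    refine lt_of_le_of_lt ((div_le_iff₀ (hpos D hD'.2)).2 ?_) hqa
    rwa [mul_comm]

theorem aestronglyMeasurable_of_forall_integrableOn [SigmaFinite μ] {F : Type*}
    [NormedAddCommGroup F] {f : X → F} (hf : ∀ D : IntegrableSet μ, IntegrableOn f D.1 μ) :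
    AEStronglyMeasurable f μ := by
  rw [← Measure.restrict_univ (μ := μ), ← iUnion_spanningSets μ, aestronglyMeasurable_iUnion_iff]
  exact fun n => (hf ⟨spanningSets μ n, measurableSet_spanningSets μ n,
    measure_spanningSets_lt_top μ n⟩).1

theorem VitaliSystem.ae_tendsto_average_real [SigmaFinite μ] (V : VitaliSystem μ)
    {f : X → ℝ} (hf : ∀ D : IntegrableSet μ, IntegrableOn f D.1 μ) :
    ∀ᵐ x ∂μ, Tendsto (fun D : IntegrableSet μ => (∫ y in D.1, f y ∂μ) / μ.real D.1)
      (V.filterAt x) (𝓝 (f x)) := by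
  have hm := aestronglyMeasurable_of_forall_integrableOn hf
  have he := hm.ae_eq_mk
  have hint : ∀ D : IntegrableSet μ, ∫ y in D.1, f y ∂μ = ∫ y in D.1, hm.mk f y ∂μ := fun D =>
    integral_congr_ae (ae_restrict_of_ae he)
  filter_upwards [he, V.ae_tendsto_average_of_measurable hm.stronglyMeasurable_mk.measurable
    (fun D => (hf D).congr (ae_restrict_of_ae he))] with x hx H
  simp_rw [hint, hx]
  exact H

/-- The Lebesgue differentiation theorem for a Vitali system. -/
theorem VitaliSystem.ae_tendsto_average [SigmaFinite μ] (V : VitaliSystem μ)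
    {f : X → ℂ} (hf : ∀ D : IntegrableSet μ, IntegrableOn f D.1 μ) :
    ∀ᵐ x ∂μ, Tendsto (fun D : IntegrableSet μ => (∫ y in D.1, f y ∂μ) / (μ.real D.1 : ℂ))
      (V.filterAt x) (𝓝 (f x)) := by
  filter_upwards [V.ae_tendsto_average_real fun D => (hf D).re,
    V.ae_tendsto_average_real fun D => (hf D).im] with x h1 h2
  have h3 := (Complex.continuous_ofReal.tendsto _).comp h1
  have h4 := ((Complex.continuous_ofReal.tendsto _).comp h2).mul_const Complex.I
  have h5 := h3.add h4
  have h6 : ((RCLike.re (f x) : ℝ) : ℂ) + ((RCLike.im (f x) : ℝ) : ℂ) * Complex.I = f x :=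
    Complex.re_add_im (f x)
  rw [h6] at h5
  refine h5.congr fun D => ?_
  have h7 := integral_re_add_im (hf D)
  rw [← h7]
  simp only [Function.comp, Complex.ofReal_div]
  change _ = (_ + _ * Complex.I) / _
  rw [add_div]
  congr 1
  exact div_mul_eq_mul_div _ _ _

theorem VitaliSystem.tendsto_integral_zero (V : VitaliSystem μ) {f : X → ℂ}
    (hf : ∀ D : IntegrableSet μ, IntegrableOn f D.1 μ) {x : X}
    (hx : Tendsto (fun D : IntegrableSet μ => μ D.1) (V.filterAt x) (𝓝 0)) :
    Tendsto (fun D : IntegrableSet μ => ∫ y in D.1, f y ∂μ) (V.filterAt x) (𝓝 0) := by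
  rw [Metric.tendsto_nhds]
  intro ε hε
  obtain ⟨δ, hδ, H⟩ := exists_pos_setLIntegral_lt_of_integrableOn hf (ENNReal.ofReal_pos.2 hε)
  filter_upwards [hx.eventually (gt_mem_nhds hδ)] with D hD
  have h2 := (enorm_integral_le_lintegral_enorm (μ := μ.restrict D.1) f).trans_lt (H _ D.2.1 hD)
  rw [← ofReal_norm] at h2
  rw [dist_zero_right]
  exact (ENNReal.ofReal_lt_ofReal_iff hε).1 h2

end Vitali

/-! ### Derivatives of a functional and of its exponential -/

section ExpDerivative

/-- exp z - 1 is z times the slope of exp between 0 and z, which tends to 1. Using `dslope`, the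
factorisation also holds at z = 0. -/
theorem tendsto_exp_sub_one_div_iff {ι : Type*} {F : Filter ι} {z m : ι → ℂ} {c : ℂ}
    (hz : Tendsto z F (𝓝 0)) :
    Tendsto (fun i => (Complex.exp (z i) - 1) / m i) F (𝓝 c) ↔
      Tendsto (fun i => z i / m i) F (𝓝 c) := by
  have hd : Tendsto (fun i => dslope Complex.exp 0 (z i)) F (𝓝 1) := by
    have h1 := continuousAt_dslope_same.2 (Complex.hasDerivAt_exp 0).differentiableAt
    have h2 := h1.tendsto.comp hz
    rwa [dslope_same, (Complex.hasDerivAt_exp 0).deriv, Complex.exp_zero] at h2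
  have he : ∀ i, Complex.exp (z i) - 1 = z i * dslope Complex.exp 0 (z i) := by
    intro i
    have := sub_smul_dslope Complex.exp 0 (z i)
    rw [sub_zero, Complex.exp_zero, smul_eq_mul] at this
    exact this.symm
  constructor
  · intro h
    have h1 := h.div hd one_ne_zero
    rw [div_one] at h1
    refine h1.congr' ?_
    filter_upwards [hd.eventually_ne one_ne_zero] with i hi
    rw [Pi.div_apply, he]
    field_simp
  · intro h
    have h1 := h.mul hd
    rw [mul_one] at h1
    refine h1.congr fun i => ?_
    rw [he, div_mul_eq_mul_div]

end ExpDerivative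

/-! ### Restrictions and level sets of step maps -/

namespace StepMap

variable {X : Type v} [MeasurableSpace X] {μ : Measure X} {𝔟 : Type u} [Monoid 𝔟]

theorem measurableSet_supp (g : StepMap μ 𝔟) : MeasurableSet g.supp :=
  g.measurableSet_preimage {b | b ≠ 1}

/-- The restriction of a step map to a measurable set `A`: equal to `g` on `A` and to the unit
elsewhere. -/
def restrict (g : StepMap μ 𝔟) (A : Set X) (hA : MeasurableSet A) : StepMap μ 𝔟 := by
  classical
  exact
    { toFun := fun x => if x ∈ A then g x else 1
      countable_range := (g.countable_range.insert 1).mono (by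
        rintro _ ⟨x, rfl⟩
        by_cases h : x ∈ A <;> simp [h])
      measurableSet_fiber := fun c => by
        have H : (fun x => if x ∈ A then g x else 1) ⁻¹' {c} =
            (A ∩ g ⁻¹' {c}) ∪ (Aᶜ ∩ {_x | (1 : 𝔟) = c}) := by
          ext x
          by_cases h : x ∈ A <;> simp [h]
        rw [H]
        exact (hA.inter (g.measurableSet_fiber c)).union (hA.compl.inter (MeasurableSet.const _))
      support_lt_top := by
        refine lt_of_le_of_lt (measure_mono ?_) g.support_lt_top
        intro x hx h
        exact hx (by simp [h]) }

variable (g : StepMap μ 𝔟) {A : Set X} (hA : MeasurableSet A)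

theorem restrict_of_mem {x : X} (h : x ∈ A) : g.restrict A hA x = g x := by
  simp [restrict, h]

theorem restrict_of_notMem {x : X} (h : x ∉ A) : g.restrict A hA x = 1 := by
  simp [restrict, h]

theorem supp_restrict : (g.restrict A hA).supp = g.supp ∩ A := by
  ext x
  by_cases h : x ∈ A
  · simp [supp, g.restrict_of_mem hA h, h]
  · simp [supp, g.restrict_of_notMem hA h, h]

theorem restrict_univ : g.restrict Set.univ MeasurableSet.univ = g :=
  ext fun x => g.restrict_of_mem _ (Set.mem_univ x)

theorem ind_one (D : IntegrableSet μ) : (ind 1 D : StepMap μ 𝔟) = 1 := by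
  ext x
  by_cases h : x ∈ D.1
  · rw [ind_of_mem _ _ h, one_apply]
  · rw [ind_of_notMem _ _ h, one_apply]

theorem ind_mul (a b : 𝔟) (D : IntegrableSet μ) : ind (a * b) D = ind a D * ind b D := by
  ext x
  by_cases h : x ∈ D.1
  · simp [ind_of_mem _ _ h]
  · simp [ind_of_notMem _ _ h]

theorem star_ind [StarMul 𝔟] (b : 𝔟) (D : IntegrableSet μ) : star (ind b D) = ind (star b) D := by
  ext x
  by_cases h : x ∈ D.1
  · simp [ind_of_mem _ _ h]
  · simp [ind_of_notMem _ _ h]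

theorem supp_ind_subset (b : 𝔟) (D : IntegrableSet μ) : (ind b D).supp ⊆ D.1 := by
  intro x hx
  by_contra h
  exact hx (ind_of_notMem _ _ h)

/-- The restrictions of a step map to disjoint sets have as join its restriction to the union. -/
theorem isJoin_restrict {A : ℕ → Set X} (hA : ∀ n, MeasurableSet (A n))
    (hd : Pairwise (Function.onFun Disjoint A)) :
    IsJoin (fun n => g.restrict (A n) (hA n)) (g.restrict (⋃ n, A n) (MeasurableSet.iUnion hA)) := by
  refine ⟨fun m n hmn => ?_, fun n x hx => ?_, fun x hx => ?_⟩
  · simp only [supp_restrict]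
    exact (hd hmn).mono Set.inter_subset_right Set.inter_subset_right
  · rw [supp_restrict] at hx
    rw [restrict_of_mem _ _ hx.2, restrict_of_mem _ _ (Set.mem_iUnion.2 ⟨n, hx.2⟩)]
  · by_cases h : x ∈ ⋃ n, A n
    · obtain ⟨n, hn⟩ := Set.mem_iUnion.1 h
      rw [restrict_of_mem _ _ h]
      by_contra hne
      exact hx n (by rw [supp_restrict]; exact ⟨hne, hn⟩)
    · exact restrict_of_notMem _ _ h

/-- The support of a step map splits into countably many integrable sets on which the map is
constant. -/
theorem exists_levels : ∃ (b : ℕ → 𝔟) (D : ℕ → IntegrableSet μ),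
    Pairwise (Function.onFun Disjoint fun n => (D n).1) ∧ (∀ n, ∀ x ∈ (D n).1, g x = b n) ∧
      ⋃ n, (D n).1 = g.supp := by
  -- Adjoining 1 makes the set of values nonempty even if X is empty. The enumeration may repeat
  -- values, hence the passage to `disjointed`.
  obtain ⟨b, hb⟩ := (g.countable_range.insert 1).exists_eq_range (Set.insert_nonempty _ _)
  let L : ℕ → Set X := fun n => g ⁻¹' {b n} ∩ g.supp
  have hL : ∀ n, MeasurableSet (L n) := fun n =>
    (g.measurableSet_fiber (b n)).inter g.measurableSet_supp
  have hsub : ∀ n, disjointed L n ⊆ L n := disjointed_subset L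
  refine ⟨b, fun n => ⟨disjointed L n, MeasurableSet.disjointed hL n,
    (measure_mono ((hsub n).trans Set.inter_subset_right)).trans_lt g.support_lt_top⟩,
    disjoint_disjointed L, fun n x hx => (hsub n hx).1, ?_⟩
  change ⋃ n, disjointed L n = g.supp
  rw [iUnion_disjointed]
  ext x
  rw [Set.mem_iUnion]
  refine ⟨fun ⟨n, hn⟩ => hn.2, fun hx => ?_⟩
  obtain ⟨n, hn⟩ : g x ∈ Set.range b := hb ▸ Set.mem_insert_of_mem _ ⟨x, rfl⟩
  exact ⟨n, hn.symm, hx⟩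

/-- A step map is the join of indicators over sets on which it is constant. -/
theorem isJoin_ind {b : ℕ → 𝔟} {D : ℕ → IntegrableSet μ}
    (hd : Pairwise (Function.onFun Disjoint fun n => (D n).1)) (hb : ∀ n, ∀ x ∈ (D n).1, g x = b n)
    (hU : ∀ x, (∀ n, x ∉ (D n).1) → g x = 1) : IsJoin (fun n => ind (b n) (D n)) g := by
  refine ⟨fun m n hmn => (hd hmn).mono (supp_ind_subset _ _) (supp_ind_subset _ _),
    fun n x hx => ?_, fun x hx => ?_⟩
  · have hx' := supp_ind_subset _ _ hx
    rw [ind_of_mem _ _ hx', hb n x hx']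
  · by_cases h : ∃ n, x ∈ (D n).1
    · obtain ⟨n, hn⟩ := h
      by_contra hne
      refine hx n ?_
      rw [hb n x hn] at hne
      exact fun h1 => hne (by rwa [ind_of_mem _ _ hn] at h1)
    · exact hU x (not_exists.1 h)

end StepMap

/-! ### Infinitely divisible states as multiplicative measures -/

section Chaotic

variable {X : Type v} [MeasurableSpace X] {μ : Measure X} {𝔟 : Type u} [Monoid 𝔟] [StarMul 𝔟]
  {V : VitaliSystem μ} {φ : StepMap μ 𝔟 → ℂ}

/-- Absolute continuity is assumed for indicators only; g is a countable join of indicators of null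
sets, so every factor equals 1. -/
theorem InfinitelyDivisibleState.apply_of_null (h : InfinitelyDivisibleState V φ)
    (g : StepMap μ 𝔟) (hg : μ g.supp = 0) : φ g = 1 := by
  obtain ⟨b, D, hd, hb, hU⟩ := g.exists_levels
  have hj := g.isJoin_ind hd hb fun x hx => by
    by_contra hne
    obtain ⟨n, hn⟩ := Set.mem_iUnion.1 (hU ▸ (show x ∈ g.supp from hne))
    exact hx n hn
  have ht := h.chaotic.2 _ _ hj
  refine tendsto_nhds_unique ht ?_
  have : ∀ n, φ (StepMap.ind (b n) (D n)) = 1 := fun n =>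
    h.absolutelyContinuous _ _ (measure_mono_null (hU ▸ Set.subset_iUnion (fun n => (D n).1) n) hg)
  simp [this]

-- Turns the chaotic property into σ-multiplicativity over sets. The base measure is restricted to
-- the support of g, so that it is finite.
open Classical in
theorem InfinitelyDivisibleState.isMultiplicativeMeasure (h : InfinitelyDivisibleState V φ)
    (g : StepMap μ 𝔟) : IsMultiplicativeMeasure (μ.restrict g.supp)
      (fun A => if hA : MeasurableSet A then φ (g.restrict A hA) else 1) where
  tendsto_prod := by
    intro A hA hd
    simp only [hA, MeasurableSet.iUnion hA, dif_pos]
    exact h.chaotic.2 _ _ (g.isJoin_restrict hA hd)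
  ne_zero := by
    intro A hA
    simp only [hA, dif_pos]
    exact h.ne_zero _
  null := by
    intro A hA h0
    simp only [hA, dif_pos]
    refine h.apply_of_null _ ?_
    rwa [StepMap.supp_restrict, Set.inter_comm, ← Measure.restrict_apply hA]

/-- On the support of a step map an infinitely divisible state is the exponential of an integral. -/
theorem InfinitelyDivisibleState.exists_density (h : InfinitelyDivisibleState V φ)
    (g : StepMap μ 𝔟) : ∃ ρ : X → ℂ, IntegrableOn ρ g.supp μ ∧
      ∀ A (hA : MeasurableSet A),
        φ (g.restrict A hA) = Complex.exp (∫ x in A ∩ g.supp, ρ x ∂μ) := by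
  have : IsFiniteMeasure (μ.restrict g.supp) := ⟨by rw [Measure.restrict_apply_univ]; exact g.support_lt_top⟩
  obtain ⟨ρ, hρ, H⟩ := (h.isMultiplicativeMeasure g).exists_density fun δ hδ =>
    V.exists_finite_partition g.measurableSet_supp g.support_lt_top hδ
  refine ⟨ρ, hρ, fun A hA => ?_⟩
  have h1 := H A hA
  simp only [hA, dif_pos] at h1
  rw [h1, Measure.restrict_restrict hA]

end Chaotic

/-! ### The density of an infinitely divisible state -/

section Derivative

variable {X : Type v} [MeasurableSpace X] {μ : Measure X} {𝔟 : Type u} {V : VitaliSystem μ}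

theorem isVitaliDerivative_exp_sub_one_iff {lam : IntegrableSet μ → 𝔟 → ℂ} {l : X → 𝔟 → ℂ}
    (h0 : ∀ᵐ x ∂μ, ∀ b, Tendsto (fun D => lam D b) (V.filterAt x) (𝓝 0)) :
    IsVitaliDerivative V (fun D b => Complex.exp (lam D b) - 1) l ↔ IsVitaliDerivative V lam l := by
  refine eventually_congr ?_
  filter_upwards [h0] with x hx
  exact forall_congr' fun b => tendsto_exp_sub_one_div_iff (hx b)

theorem ae_tendsto_setIntegral_zero (V : VitaliSystem μ) {l : X → 𝔟 → ℂ}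
    (hl : ∀ (D : IntegrableSet μ) b, IntegrableOn (fun x => l x b) D.1 μ) :
    ∀ᵐ x ∂μ, ∀ b, Tendsto (fun D : IntegrableSet μ => ∫ y in D.1, l y b ∂μ)
      (V.filterAt x) (𝓝 0) := by
  filter_upwards [V.tendsto_zero] with x hx b
  exact V.tendsto_integral_zero (fun D => hl D b) hx

end Derivative

section Density

variable {X : Type v} [MeasurableSpace X] {μ : Measure X} {𝔟 : Type u} [Monoid 𝔟]

theorem integrableOn_of_integrable_stepMap {l : X → 𝔟 → ℂ}
    (hl : ∀ g : StepMap μ 𝔟, Integrable (fun x => l x (g x)) μ) (D : IntegrableSet μ) (b : 𝔟) :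
    IntegrableOn (fun x => l x b) D.1 μ := by
  refine ((hl (StepMap.ind b D)).integrableOn (s := D.1)).congr ?_
  filter_upwards [ae_restrict_mem D.2.1] with x hx
  rw [StepMap.ind_of_mem _ _ hx]

theorem integralFunctional_eq_setIntegral {l : X → 𝔟 → ℂ} (hl1 : ∀ᵐ x ∂μ, l x 1 = 0)
    (g : StepMap μ 𝔟) {A : Set X} (hA : ∀ x, x ∉ A → g x = 1) :
    integralFunctional μ l g = ∫ x in A, l x (g x) ∂μ := by
  refine (setIntegral_eq_integral_of_ae_compl_eq_zero ?_).symm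
  filter_upwards [hl1] with x hx hxA
  rw [hA x hxA, hx]

theorem integralFunctional_ind {l : X → 𝔟 → ℂ} (hl1 : ∀ᵐ x ∂μ, l x 1 = 0)
    (b : 𝔟) (D : IntegrableSet μ) :
    integralFunctional μ l (StepMap.ind b D) = ∫ x in D.1, l x b ∂μ := by
  rw [integralFunctional_eq_setIntegral hl1 _ fun x hx => StepMap.ind_of_notMem b D hx]
  refine setIntegral_congr_fun D.2.1 fun x hx => ?_
  simp only [StepMap.ind_of_mem b D hx]

variable {V : VitaliSystem μ} {φ : StepMap μ 𝔟 → ℂ}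

theorem IsVitaliDerivative.ae_apply_one {ν : IntegrableSet μ → 𝔟 → ℂ}
    {l : X → 𝔟 → ℂ} (hl : IsVitaliDerivative V ν l) (hν : ∀ D, ν D 1 = 0) :
    ∀ᵐ x ∂μ, l x 1 = 0 := by
  filter_upwards [hl, V.neBot] with x hx hne
  refine tendsto_nhds_unique (hx 1) ?_
  simp [hν]

/-- On B ⊆ A ∩ supp g₁ the two step maps restrict to the same step map, so the integral of ρ₁ - ρ₂
over B has exponential 1. -/
theorem ae_eq_of_density (V : VitaliSystem μ) {g₁ g₂ : StepMap μ 𝔟}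
    {ρ₁ ρ₂ : X → ℂ} (h₁ : IntegrableOn ρ₁ g₁.supp μ) (h₂ : IntegrableOn ρ₂ g₂.supp μ)
    (H₁ : ∀ A (hA : MeasurableSet A),
        φ (g₁.restrict A hA) = Complex.exp (∫ x in A ∩ g₁.supp, ρ₁ x ∂μ))
    (H₂ : ∀ A (hA : MeasurableSet A),
        φ (g₂.restrict A hA) = Complex.exp (∫ x in A ∩ g₂.supp, ρ₂ x ∂μ))
    {A : Set X} (hA : MeasurableSet A) (hg : ∀ x ∈ A, g₁ x = g₂ x) :
    ∀ᵐ x ∂μ, x ∈ A ∩ g₁.supp → ρ₁ x = ρ₂ x := by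
  have hm : MeasurableSet (A ∩ g₁.supp) := hA.inter g₁.measurableSet_supp
  have hs2 : A ∩ g₁.supp ⊆ g₂.supp := by
    rintro x ⟨hx, hx1⟩ h
    exact hx1 ((hg x hx).trans h)
  have hi1 := h₁.mono_set (t := g₁.supp) (s := A ∩ g₁.supp) Set.inter_subset_right
  have hi2 := h₂.mono_set hs2
  rw [← ae_restrict_iff' hm]
  have key := V.ae_eq_zero_of_exp_integral_eq_one (f := fun x => ρ₁ x - ρ₂ x) hm
    ((measure_mono Set.inter_subset_right).trans_lt g₁.support_lt_top) (hi1.sub hi2) (by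
      intro B hB hBm
      have hr : g₁.restrict B hBm = g₂.restrict B hBm := by
        ext x
        by_cases hx : x ∈ B
        · rw [StepMap.restrict_of_mem _ _ hx, StepMap.restrict_of_mem _ _ hx, hg x (hB hx).1]
        · rw [StepMap.restrict_of_notMem _ _ hx, StepMap.restrict_of_notMem _ _ hx]
      have e1 := H₁ B hBm
      have e2 := H₂ B hBm
      rw [hr, e2, Set.inter_eq_left.2 (hB.trans hs2),
        Set.inter_eq_left.2 (hB.trans Set.inter_subset_right)] at e1
      rw [integral_sub (hi1.mono_set hB) (hi2.mono_set hB), Complex.exp_sub, e1,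
        div_self (Complex.exp_ne_zero _)])
  filter_upwards [key] with x hx using sub_eq_zero.1 hx

/-- The densities ρ g are chosen separately for each g, each up to its own null set. They are glued
along indicators to r, and r is compared with l for one b at a time; a step map needs only the
countably many b in its range. -/
theorem InfinitelyDivisibleState.isLogDensity [StarMul 𝔟] [SigmaFinite μ]
    (h : InfinitelyDivisibleState V φ)
    {l : X → 𝔟 → ℂ} (hl : IsVitaliDerivative V (fun D b => φ (StepMap.ind b D) - 1) l) :
    IsLogDensity V φ l := by
  have hl1 : ∀ᵐ x ∂μ, l x 1 = 0 := hl.ae_apply_one fun D => by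
    simp only [StepMap.ind_one, h.chaotic.1.1, sub_self]
  choose ρ hρ H using h.exists_density
  let S : ℕ → IntegrableSet μ := fun n => ⟨disjointed (spanningSets μ) n,
    MeasurableSet.disjointed (measurableSet_spanningSets μ) n,
    (measure_mono (disjointed_subset _ n)).trans_lt (measure_spanningSets_lt_top μ n)⟩
  -- The constant map b need not have a support of finite measure, so its indicator over the
  -- σ-finite piece containing x is used.
  let r : X → 𝔟 → ℂ := fun x b => ρ (StepMap.ind b (S (spanningSetsIndex μ x))) x
  have hxS : ∀ x, x ∈ (S (spanningSetsIndex μ x)).1 := mem_disjointed_spanningSetsIndex μ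
  have hr : ∀ g : StepMap μ 𝔟, ∀ᵐ x ∂μ, x ∈ g.supp → ρ g x = r x (g x) := by
    intro g
    have h1 : ∀ᵐ x ∂μ, ∀ b ∈ Set.range g, ∀ n, x ∈ (g ⁻¹' {b} ∩ (S n).1) ∩ g.supp →
        ρ g x = ρ (StepMap.ind b (S n)) x := by
      refine (ae_ball_iff g.countable_range).2 fun b _ => ae_all_iff.2 fun n => ?_
      refine ae_eq_of_density V (hρ g) (hρ _) (H g) (H _)
        ((g.measurableSet_fiber b).inter (S n).2.1) fun x hx => ?_
      rw [StepMap.ind_of_mem _ _ hx.2]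
      exact hx.1
    filter_upwards [h1] with x hx hxs
    exact hx (g x) ⟨x, rfl⟩ _ ⟨⟨rfl, hxS x⟩, hxs⟩
  have hsupp : ∀ (b : 𝔟) (D : IntegrableSet μ), b ≠ 1 → (StepMap.ind b D).supp = D.1 := by
    intro b D hb
    refine Set.Subset.antisymm (StepMap.supp_ind_subset b D) fun x hx => ?_
    change StepMap.ind b D x ≠ 1
    rwa [StepMap.ind_of_mem _ _ hx]
  have hρr : ∀ (b : 𝔟) (D : IntegrableSet μ), b ≠ 1 →
      ∀ᵐ x ∂μ.restrict D.1, ρ (StepMap.ind b D) x = r x b := by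
    intro b D hb
    rw [ae_restrict_iff' D.2.1]
    filter_upwards [hr (StepMap.ind b D)] with x hx hxD
    rw [hsupp b D hb] at hx
    rw [hx hxD, StepMap.ind_of_mem _ _ hxD]
  have hrint : ∀ (b : 𝔟), b ≠ 1 → ∀ D : IntegrableSet μ, IntegrableOn (fun x => r x b) D.1 μ := by
    intro b hb D
    have := hρ (StepMap.ind b D)
    rw [hsupp b D hb] at this
    exact this.congr (hρr b D hb)
  have hφ : ∀ g, φ g = Complex.exp (∫ x in g.supp, ρ g x ∂μ) := by
    intro g
    have := H g Set.univ MeasurableSet.univ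
    rwa [g.restrict_univ, Set.univ_inter] at this
  have hrφ : ∀ (b : 𝔟), b ≠ 1 → ∀ D : IntegrableSet μ,
      Complex.exp (∫ x in D.1, r x b ∂μ) = φ (StepMap.ind b D) := by
    intro b hb D
    rw [hφ, hsupp b D hb, integral_congr_ae (hρr b D hb)]
  -- Both are limits of (φ_D(b) - 1)/μ(D): l by hypothesis, r by the differentiation theorem. The
  -- unit is excluded because its indicators have empty support, so nothing is known about r there.
  have hlr : ∀ b, b ≠ 1 → ∀ᵐ x ∂μ, l x b = r x b := by
    intro b hb
    filter_upwards [hl, V.neBot, V.tendsto_zero, V.ae_tendsto_average (hrint b hb)]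
      with x hx hne h0 hav
    refine tendsto_nhds_unique (hx b) ?_
    simp_rw [← hrφ b hb]
    exact (tendsto_exp_sub_one_div_iff (V.tendsto_integral_zero (hrint b hb) h0)).2 hav
  have hlg : ∀ g : StepMap μ 𝔟, g.supp.indicator (ρ g) =ᵐ[μ] fun x => l x (g x) := by
    intro g
    have h1 : ∀ᵐ x ∂μ, ∀ b ∈ Set.range g, b ≠ 1 → l x b = r x b :=
      (ae_ball_iff g.countable_range).2 fun b _ => by
        by_cases hb : b = 1
        · exact Eventually.of_forall fun x hb' => absurd hb hb'
        · filter_upwards [hlr b hb] with x hx _ using hx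
    filter_upwards [h1, hl1, hr g] with x hx h1 hrx
    by_cases hxs : x ∈ g.supp
    · rw [Set.indicator_of_mem hxs, hrx hxs, hx (g x) ⟨x, rfl⟩ hxs]
    · rw [Set.indicator_of_notMem hxs, not_not.1 (show ¬ g x ≠ 1 from hxs), h1]
  have hint : ∀ g : StepMap μ 𝔟, Integrable (fun x => l x (g x)) μ := fun g =>
    ((integrable_indicator_iff g.measurableSet_supp).2 (hρ g)).congr (hlg g)
  have hexp : ∀ g, Complex.exp (integralFunctional μ l g) = φ g := by
    intro g
    rw [hφ g, ← integral_indicator g.measurableSet_supp, integral_congr_ae (hlg g)]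
    rfl
  refine ⟨hint, hexp, ?_⟩
  rw [← isVitaliDerivative_exp_sub_one_iff
    (ae_tendsto_setIntegral_zero V (integrableOn_of_integrable_stepMap hint))]
  simp_rw [← integralFunctional_ind hl1, hexp]
  exact hl

/-! ### Properties of log-densities -/

theorem IsLogDensity.integrableOn {l : X → 𝔟 → ℂ} (h : IsLogDensity V φ l) (D : IntegrableSet μ)
    (b : 𝔟) : IntegrableOn (fun x => l x b) D.1 μ :=
  integrableOn_of_integrable_stepMap h.integrable D b

theorem IsLogDensity.derivative_exp {l : X → 𝔟 → ℂ} (h : IsLogDensity V φ l)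
    (hl1 : ∀ᵐ x ∂μ, l x 1 = 0) :
    IsVitaliDerivative V (fun D b => φ (StepMap.ind b D) - 1) l := by
  have := (isVitaliDerivative_exp_sub_one_iff
    (ae_tendsto_setIntegral_zero V h.integrableOn)).2 h.derivative
  simpa only [← integralFunctional_ind hl1, h.exp_eq] using this

theorem IsLogDensity.congr {l l' : X → 𝔟 → ℂ} (h : IsLogDensity V φ l)
    (hl : ∀ᵐ x ∂μ, ∀ b, l x b = l' x b) : IsLogDensity V φ l' where
  integrable g := (h.integrable g).congr (by filter_upwards [hl] with x hx using hx _)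
  exp_eq g := by
    rw [← h.exp_eq g]
    congr 1
    exact integral_congr_ae (by filter_upwards [hl] with x hx using (hx _).symm)
  derivative := by
    filter_upwards [h.derivative, hl] with x hx hxl b
    have : ∀ D : IntegrableSet μ, ∫ y in D.1, l' y b ∂μ = ∫ y in D.1, l y b ∂μ := fun D =>
      integral_congr_ae (ae_restrict_of_ae (by filter_upwards [hl] with x hx using (hx b).symm))
    simp_rw [this, ← hxl b]
    exact hx b

end Density

/-! ### Positive definite and conditionally positive definite functionals -/

section Positivity

variable {M : Type w}

/-- Allows positivity, stated for finitely supported coefficients, to be used for families with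
repeated members: their coefficients add up. -/
theorem finsupp_form_sum_single {ι : Type*} [Fintype ι] (f : ι → M) (c : ι → ℂ) (Q : M → M → ℂ) :
    ((∑ i, Finsupp.single (f i) (c i)).sum fun a r =>
      (∑ i, Finsupp.single (f i) (c i)).sum fun b t => r * Q a b * conj t) =
      ∑ i, ∑ j, c i * Q (f i) (f j) * conj (c j) := by
  rw [← Finsupp.sum_finsetSum_index]
  · refine Finset.sum_congr rfl fun i _ => ?_
    rw [Finsupp.sum_single_index, ← Finsupp.sum_finsetSum_index]
    · refine Finset.sum_congr rfl fun j _ => ?_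
      rw [Finsupp.sum_single_index]
      simp
    · simp
    · intro a t t'
      rw [map_add, mul_add]
    · simp [Finsupp.sum]
  · simp [Finsupp.sum]
  · intro a r r'
    simp only [Finsupp.sum, add_mul, Finset.sum_add_distrib]

variable [Monoid M] [StarMul M]

theorem IsState.sum_nonneg {φ : M → ℂ} (h : IsState φ) {ι : Type*} [Fintype ι] (f : ι → M)
    (c : ι → ℂ) : 0 ≤ ∑ i, ∑ j, c i * φ (f i * star (f j)) * conj (c j) := by
  rw [← finsupp_form_sum_single f c fun a b => φ (a * star b)]
  exact h.2 _

theorem IsCumulant.sum_nonneg {lam : M → ℂ} (h : IsCumulant lam) {ι : Type*} [Fintype ι]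
    (f : ι → M) (c : ι → ℂ) (hc : ∑ i, c i = 0) :
    0 ≤ ∑ i, ∑ j, c i * lam (f i * star (f j)) * conj (c j) := by
  rw [← finsupp_form_sum_single f c fun a b => lam (a * star b)]
  refine h.1 _ ?_
  change (∑ i, Finsupp.single (f i) (c i)).sum (fun _ r => r) = 0
  rw [← Finsupp.sum_finsetSum_index (fun _ => rfl) (fun _ _ _ => rfl), ← hc]
  exact Finset.sum_congr rfl fun i _ => Finsupp.sum_single_index rfl

/-- Being nonnegative includes being real. At the points 1, b the coefficients (1, 1) and (1, i)
compare the imaginary and the real parts of φ(b⋆) and conj φ(b). -/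
theorem IsState.star_eq {φ : M → ℂ} (h : IsState φ) (b : M) : φ (star b) = conj (φ b) := by
  have h0 := (Complex.nonneg_iff.1 (h.sum_nonneg (fun _ : Unit => b) fun _ => 1)).2
  have h1 := (Complex.nonneg_iff.1 (h.sum_nonneg ![1, b] ![1, 1])).2
  have h2 := (Complex.nonneg_iff.1 (h.sum_nonneg ![1, b] ![1, Complex.I])).2
  simp [Fin.sum_univ_two, h.1] at h0 h1 h2
  apply Complex.ext
  · simp
    linarith
  · simp
    linarith

/-- If `φ` is a state, `φ - 1` is a cumulant functional. -/
theorem IsState.isCumulant_sub_one {φ : M → ℂ} (h : IsState φ) :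
    IsCumulant fun b => φ b - 1 := by
  refine ⟨fun κ hκ => ?_, by simp [h.1], fun b => by simp [h.star_eq b]⟩
  have h1 : ∑ a ∈ κ.support, ∑ c ∈ κ.support, κ a * (φ (a * star c) - 1) * conj (κ c) =
      ∑ a ∈ κ.support, ∑ c ∈ κ.support, κ a * φ (a * star c) * conj (κ c) := by
    have h2 : ∑ a ∈ κ.support, ∑ c ∈ κ.support, κ a * conj (κ c) = 0 := by
      rw [← Finset.sum_mul_sum, hκ, zero_mul]
    rw [← sub_eq_zero, ← Finset.sum_sub_distrib]
    simp_rw [← Finset.sum_sub_distrib]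
    rw [← neg_eq_zero, ← h2, ← Finset.sum_neg_distrib]
    refine Finset.sum_congr rfl fun a _ => ?_
    rw [← Finset.sum_neg_distrib]
    exact Finset.sum_congr rfl fun c _ => by ring
  rw [h1]
  exact h.2 κ

theorem IsCumulant.zero : IsCumulant fun _ : M => (0 : ℂ) := by
  refine ⟨fun κ _ => ?_, rfl, fun b => by simp⟩
  simp

/-- The positive definite kernel of a cumulant functional. -/
theorem IsCumulant.kernel_sum_nonneg {lam : M → ℂ} (h : IsCumulant lam) {ι : Type*} [Fintype ι]
    (f : ι → M) (c : ι → ℂ) :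
    0 ≤ ∑ i, ∑ j, c i * (lam (f i * star (f j)) - lam (f i) - lam (star (f j))) * conj (c j) := by
  -- The unit is adjoined with the coefficient that makes the total zero; its cross terms produce
  -- -λ(a) - λ(c⋆).
  have h1 := h.sum_nonneg (fun i : Option ι => i.elim 1 f)
    (fun i : Option ι => i.elim (-∑ j, c j) c) (by simp [Fintype.sum_option])
  simp only [Fintype.sum_option, Option.elim, star_one, mul_one, one_mul, h.2.1, mul_zero, zero_mul,
    zero_add, Finset.sum_add_distrib] at h1
  convert h1 using 1
  simp only [mul_sub, sub_mul, Finset.sum_sub_distrib, map_neg, map_sum, mul_neg, neg_mul,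
    Finset.sum_neg_distrib, Finset.mul_sum, Finset.sum_mul]
  rw [Finset.sum_comm (f := fun x i => c i * lam (star (f x)) * conj (c x))]
  ring

/-- Schoenberg's theorem: the exponential of a cumulant functional is a state. -/
theorem IsCumulant.isState_exp {lam : M → ℂ} (h : IsCumulant lam) :
    IsState fun b => Complex.exp (lam b) := by
  refine ⟨by simp [h.2.1], fun κ => ?_⟩
  -- Since λ(ac⋆) = λ(a) + K(a,c) + λ(c⋆), the exponential is e^{K} entrywise, up to factors
  -- absorbed into the coefficients x below. Entrywise powers of K are positive by the Schur product
  -- theorem, hence so is the exponential series.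
  let K : Matrix κ.support κ.support ℂ := Matrix.of fun i j =>
    lam (i.1 * star j.1) - lam i.1 - lam (star j.1)
  have hquad : ∀ (N : Matrix κ.support κ.support ℂ) (x : κ.support → ℂ),
      star x ⬝ᵥ N.mulVec x = ∑ i, ∑ j, conj (x i) * N i j * x j := by
    intro N x
    simp only [dotProduct, Matrix.mulVec, Finset.mul_sum, Pi.star_apply, mul_assoc]
    rfl
  have hK : K.PosSemidef := by
    refine Matrix.PosSemidef.of_dotProduct_mulVec_nonneg ?_ fun x => ?_
    · ext i j
      simp only [K, Matrix.conjTranspose_apply, Matrix.of_apply, star_sub]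
      have h2 : ∀ b, star (lam b) = lam (star b) := fun b => (h.2.2 b).symm
      simp only [h2, star_mul, star_star]
      ring
    · rw [hquad]
      have := h.kernel_sum_nonneg (fun i : κ.support => i.1) fun i => conj (x i)
      simp only [Complex.conj_conj] at this
      exact this
  have hpow : ∀ n : ℕ, (Matrix.of fun i j => K i j ^ n : Matrix κ.support κ.support ℂ).PosSemidef := by
    intro n
    induction n with
    | zero =>
      refine Matrix.PosSemidef.of_dotProduct_mulVec_nonneg ?_ fun x => ?_
      · ext i j
        simp [Matrix.conjTranspose_apply]
      · rw [hquad]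
        simp only [Matrix.of_apply, pow_zero, mul_one]
        rw [← Finset.sum_mul_sum, ← map_sum]
        exact star_mul_self_nonneg _
    | succ n ih =>
      have e : (Matrix.of fun i j => K i j ^ (n + 1) : Matrix κ.support κ.support ℂ) =
          (Matrix.of fun i j => K i j ^ n).hadamard K := by
        ext i j
        simp [Matrix.hadamard, pow_succ]
      rw [e]
      exact ih.hadamard hK
  let x : κ.support → ℂ := fun i => conj (κ i.1 * Complex.exp (lam i.1))
  have hlim : HasSum (fun n : ℕ => ∑ i, ∑ j, conj (x i) * (K i j ^ n / (n.factorial : ℂ)) * x j)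
      (∑ i, ∑ j, conj (x i) * Complex.exp (K i j) * x j) := by
    refine hasSum_sum fun i _ => hasSum_sum fun j _ => ?_
    refine HasSum.mul_right _ (HasSum.mul_left _ ?_)
    rw [Complex.exp_eq_exp_ℂ]
    exact NormedSpace.expSeries_div_hasSum_exp (K i j)
  have hnn : 0 ≤ ∑ i, ∑ j, conj (x i) * Complex.exp (K i j) * x j := by
    refine hlim.nonneg fun n => ?_
    have h1 := (hpow n).dotProduct_mulVec_nonneg x
    rw [hquad] at h1
    have h2 : ∑ i, ∑ j, conj (x i) * (K i j ^ n / (n.factorial : ℂ)) * x j =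
        (((n.factorial : ℝ)⁻¹ : ℝ) : ℂ) * ∑ i, ∑ j, conj (x i) * K i j ^ n * x j := by
      simp only [Finset.mul_sum]
      refine Finset.sum_congr rfl fun i _ => Finset.sum_congr rfl fun j _ => ?_
      push_cast
      ring
    rw [h2]
    exact mul_nonneg (Complex.zero_le_real.2 (by positivity)) h1
  rw [← Finset.sum_coe_sort κ.support]
  simp_rw [← Finset.sum_coe_sort κ.support]
  convert hnn using 1
  refine Finset.sum_congr rfl fun i _ => Finset.sum_congr rfl fun j _ => ?_
  simp only [x, K, Matrix.of_apply, Complex.conj_conj, map_mul, ← Complex.exp_conj, ← h.2.2, star_star]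
  have e : lam (i.1 * star j.1) = lam i.1 + (lam (i.1 * star j.1) - lam i.1 - lam (star j.1)) +
    lam (star j.1) := by ring
  rw [e, Complex.exp_add, Complex.exp_add]
  ring_nf

theorem IsState.comp {N : Type*} [Monoid N] [StarMul N] {φ : M → ℂ} (h : IsState φ) (f : N →* M)
    (hf : ∀ b, f (star b) = star (f b)) : IsState fun b => φ (f b) := by
  refine ⟨by simp [h.1], fun κ => ?_⟩
  rw [← Finset.sum_coe_sort κ.support]
  simp_rw [← Finset.sum_coe_sort κ.support]
  have := h.sum_nonneg (fun i : κ.support => f i.1) fun i => κ i.1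
  simpa only [map_mul, hf] using this

end Positivity

/-! ### Differentiation and integration of cumulant functionals -/

section Derivative

variable {X : Type v} [MeasurableSpace X] {μ : Measure X} {𝔟 : Type u} [Monoid 𝔟] [StarMul 𝔟]
  {V : VitaliSystem μ}

/-- The Vitali derivative of a family of cumulant functionals consists of cumulant functionals. -/
theorem IsVitaliDerivative.ae_isCumulant {ν : IntegrableSet μ → 𝔟 → ℂ} {l : X → 𝔟 → ℂ}
    (hl : IsVitaliDerivative V ν l) (hν : ∀ D, IsCumulant (ν D)) : ∀ᵐ x ∂μ, IsCumulant (l x) := by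
  filter_upwards [hl, V.neBot] with x hx hne
  refine ⟨fun κ hκ => ?_, ?_, fun b => ?_⟩
  · have ht : Tendsto (fun D : IntegrableSet μ => ∑ a ∈ κ.support, ∑ c ∈ κ.support,
        κ a * (ν D (a * star c) / (μ.real D.1 : ℂ)) * conj (κ c)) (V.filterAt x)
        (𝓝 (∑ a ∈ κ.support, ∑ c ∈ κ.support, κ a * l x (a * star c) * conj (κ c))) :=
      tendsto_finsetSum _ fun a _ => tendsto_finsetSum _ fun c _ =>
        ((hx _).const_mul _).mul_const _
    refine ge_of_tendsto' ht fun D => ?_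
    have h1 : ∑ a ∈ κ.support, ∑ c ∈ κ.support,
        κ a * (ν D (a * star c) / (μ.real D.1 : ℂ)) * conj (κ c) =
        (((μ.real D.1)⁻¹ : ℝ) : ℂ) * ∑ a ∈ κ.support, ∑ c ∈ κ.support,
          κ a * ν D (a * star c) * conj (κ c) := by
      simp only [Finset.mul_sum]
      refine Finset.sum_congr rfl fun i _ => Finset.sum_congr rfl fun j _ => ?_
      push_cast
      ring
    rw [h1]
    exact mul_nonneg (Complex.zero_le_real.2 (by positivity)) ((hν D).1 κ hκ)
  · refine tendsto_nhds_unique (hx 1) ?_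
    simp [(hν _).2.1]
  · refine tendsto_nhds_unique (hx (star b)) ?_
    have h1 := (Complex.continuous_conj.tendsto _).comp (hx b)
    refine h1.congr fun D => ?_
    simp [(hν D).2.2 b]

/-- The integral of a field of cumulant functionals is a cumulant functional. -/
theorem isCumulant_integralFunctional {l : X → 𝔟 → ℂ}
    (hint : ∀ g : StepMap μ 𝔟, Integrable (fun x => l x (g x)) μ)
    (hl : ∀ᵐ x ∂μ, IsCumulant (l x)) : IsCumulant (integralFunctional μ l) := by
  refine ⟨fun κ hκ => ?_, ?_, fun g => ?_⟩
  · unfold integralFunctional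
    simp_rw [← integral_const_mul, ← integral_mul_const]
    have hi : ∀ a c : StepMap μ 𝔟,
        Integrable (fun x => κ a * l x ((a * star c) x) * conj (κ c)) μ :=
      fun a c => ((hint _).const_mul _).mul_const _
    have h1 : ∀ a ∈ κ.support, ∑ c ∈ κ.support, ∫ x, κ a * l x ((a * star c) x) * conj (κ c) ∂μ =
        ∫ x, ∑ c ∈ κ.support, κ a * l x ((a * star c) x) * conj (κ c) ∂μ := fun a _ =>
      (integral_finsetSum _ fun c _ => hi a c).symm
    rw [Finset.sum_congr rfl h1,
      ← integral_finsetSum _ fun a _ => integrable_finsetSum _ fun c _ => hi a c]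
    refine integral_nonneg_of_ae ?_
    filter_upwards [hl] with x hx
    rw [← Finset.sum_coe_sort κ.support]
    simp_rw [← Finset.sum_coe_sort κ.support]
    refine hx.sum_nonneg (fun i : κ.support => i.1 x) (fun i => κ i.1) ?_
    rw [← hκ]
    exact Finset.sum_coe_sort κ.support κ
  · refine integral_eq_zero_of_ae ?_
    filter_upwards [hl] with x hx using hx.2.1
  · unfold integralFunctional
    rw [← integral_conj]
    refine integral_congr_ae ?_
    filter_upwards [hl] with x hx using hx.2.2 _

end Derivative

/-! ### The symmetry semigroup and null sets -/

namespace Symmetry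

variable {S : Type w} [Semigroup S] {X : Type v} [MeasurableSpace X] {μ : Measure X}
  {𝔟 : Type u} [Monoid 𝔟] [StarMul 𝔟] (σ : Symmetry S μ 𝔟)

theorem map_restrict (s : S) {D : Set X} (hD : MeasurableSet D) :
    (μ.restrict D).map (σ.act s) = μ.restrict (σ.act s '' D) := by
  have he := σ.measurableEmbedding s
  ext A hA
  rw [he.map_apply, Measure.restrict_apply (he.measurable hA), Measure.restrict_apply hA,
    ← σ.measure_image s ((he.measurable hA).inter hD), Set.image_preimage_inter]

theorem map_act (s : S) : μ.map (σ.act s) = μ.restrict (Set.range (σ.act s)) := by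
  have := σ.map_restrict s MeasurableSet.univ
  rwa [Measure.restrict_univ, Set.image_univ] at this

theorem ae_act (s : S) {p : X → Prop} (h : ∀ᵐ y ∂μ, p y) : ∀ᵐ x ∂μ, p (σ.act s x) := by
  rw [← (σ.measurableEmbedding s).ae_map_iff, σ.map_act]
  exact ae_restrict_of_ae h

theorem ae_image (s : S) {D : Set X} (hD : MeasurableSet D) {p : X → Prop}
    (h : ∀ᵐ x ∂μ.restrict D, p x) :
    ∀ᵐ y ∂μ.restrict (σ.act s '' D), ∃ x, σ.act s x = y ∧ p x := by
  rw [← σ.map_restrict s hD, (σ.measurableEmbedding s).ae_map_iff]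
  filter_upwards [h] with x hx using ⟨x, rfl, hx⟩

theorem ae_range (s : S) {p : X → Prop} (h : ∀ᵐ x ∂μ, p x) :
    ∀ᵐ y ∂μ, y ∈ Set.range (σ.act s) → ∃ x, σ.act s x = y ∧ p x := by
  have := σ.ae_image s MeasurableSet.univ (p := p) (by rwa [Measure.restrict_univ])
  rwa [Set.image_univ, ae_restrict_iff' (σ.measurableEmbedding s).measurableSet_range] at this

theorem shift_act (s : S) (g : StepMap μ 𝔟) (x : X) :
    σ.shift s g (σ.act s x) = σ.θ s (g x) :=
  σ.shiftFun_act s g x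

theorem shift_of_notMem (s : S) (g : StepMap μ 𝔟) {y : X} (hy : y ∉ Set.range (σ.act s)) :
    σ.shift s g y = 1 :=
  σ.shiftFun_of_notMem s g hy

theorem shift_ind (s : S) (b : 𝔟) (D : IntegrableSet μ) :
    σ.shift s (StepMap.ind b D) = StepMap.ind (σ.θ s b) (σ.image s D) := by
  ext y
  by_cases hy : y ∈ Set.range (σ.act s)
  · obtain ⟨x, rfl⟩ := hy
    rw [shift_act]
    by_cases hx : x ∈ D.1
    · rw [StepMap.ind_of_mem _ _ hx, StepMap.ind_of_mem _ _
        (show σ.act s x ∈ (σ.image s D).1 from ⟨x, hx, rfl⟩)]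
    · rw [StepMap.ind_of_notMem _ _ hx, map_one, StepMap.ind_of_notMem]
      rintro ⟨z, hz, hzx⟩
      exact hx ((σ.measurableEmbedding s).injective hzx ▸ hz)
  · rw [σ.shift_of_notMem s _ hy, StepMap.ind_of_notMem]
    rintro ⟨z, _, hz⟩
    exact hy ⟨z, hz⟩

theorem measureReal_image (s : S) (D : IntegrableSet μ) :
    μ.real (σ.image s D).1 = μ.real D.1 :=
  congrArg ENNReal.toReal (σ.measure_image s D.2.1)

variable {σ} {V : VitaliSystem μ} {φ : StepMap μ 𝔟 → ℂ}

/-- Homogeneity gives φ_{sD}(b_s) = φ_D(b), and μ(sD) = μ(D). As sD ↓ {sx} when D ↓ {x}, both sides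
are limits of the same quotients. -/
theorem isCovariantDensity_of_derivative (hV : σ.Respects V) (hφ : σ.IsHomogeneous φ)
    {l : X → 𝔟 → ℂ} (hl : IsVitaliDerivative V (fun D b => φ (StepMap.ind b D) - 1) l) :
    σ.IsCovariantDensity l := by
  intro s
  filter_upwards [hl, σ.ae_act s hl, hV s, V.neBot] with x hx hsx hr hne b
  refine tendsto_nhds_unique ?_ (hx b)
  refine ((hsx (σ.θ s b)).comp hr).congr fun D => ?_
  simp only [Function.comp, measureReal_image, ← shift_ind, hφ s]

theorem isHomogeneous_integralFunctional {l : X → 𝔟 → ℂ} (hl : σ.IsCovariantDensity l)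
    (hl1 : ∀ᵐ x ∂μ, l x 1 = 0) : σ.IsHomogeneous (integralFunctional μ l) := by
  intro s g
  rw [integralFunctional_eq_setIntegral hl1 _ fun y hy => σ.shift_of_notMem s g hy, ← σ.map_act,
    (σ.measurableEmbedding s).integral_map]
  refine integral_congr_ae ?_
  filter_upwards [hl s] with x hx
  simp only [shift_act, hx]

end Symmetry

/-! ### Cumulant densities -/

section Core

variable {X : Type v} [MeasurableSpace X] {μ : Measure X} {𝔟 : Type u} [Monoid 𝔟] [StarMul 𝔟]
  {V : VitaliSystem μ} {φ : StepMap μ 𝔟 → ℂ}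

theorem IsCumulant.comp {M : Type*} [Monoid M] [StarMul M] {lam : M → ℂ} (h : IsCumulant lam)
    (f : 𝔟 →* M) (hf : ∀ b, f (star b) = star (f b)) : IsCumulant fun b => lam (f b) := by
  refine ⟨fun κ hκ => ?_, by simp [h.2.1], fun b => by simp only [hf, h.2.2]⟩
  rw [← Finset.sum_coe_sort κ.support]
  simp_rw [← Finset.sum_coe_sort κ.support]
  have := h.sum_nonneg (fun i : κ.support => f i.1) (fun i => κ i.1)
    ((Finset.sum_coe_sort κ.support κ).trans hκ)
  simpa only [map_mul, hf] using this

/-- The `⋆`-homomorphism `b ↦ b_D`. -/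
def indHom (D : IntegrableSet μ) : 𝔟 →* StepMap μ 𝔟 where
  toFun b := StepMap.ind b D
  map_one' := StepMap.ind_one D
  map_mul' a b := StepMap.ind_mul a b D

/-- A log-density consisting of cumulant functionals. -/
structure IsCumulantDensity (V : VitaliSystem μ) (φ : StepMap μ 𝔟 → ℂ) (l : X → 𝔟 → ℂ) : Prop
    extends IsLogDensity V φ l where
  isCumulant : ∀ x, IsCumulant (l x)

/-- One null set serves for all b, so putting zero there changes no integral. Cumulant functionals
at every point allow the GNS construction in every fibre. -/
theorem IsLogDensity.exists_isCumulantDensity {l : X → 𝔟 → ℂ} (h : IsLogDensity V φ l)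
    (hl : ∀ᵐ x ∂μ, IsCumulant (l x)) : ∃ l', IsCumulantDensity V φ l' := by
  classical
  refine ⟨fun x => if IsCumulant (l x) then l x else fun _ => 0, h.congr ?_, fun x => ?_⟩
  · filter_upwards [hl] with x hx b
    rw [if_pos hx]
  · split_ifs with hx
    · exact hx
    · exact IsCumulant.zero

theorem InfinitelyDivisibleState.exists_isCumulantDensity [SigmaFinite μ]
    (h : InfinitelyDivisibleState V φ) : ∃ l, IsCumulantDensity V φ l := by
  obtain ⟨l, hl⟩ := h.exists_derivative
  exact (h.isLogDensity hl).exists_isCumulantDensity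
    (hl.ae_isCumulant fun D => (h.isState D).isCumulant_sub_one)

namespace IsCumulantDensity

variable {l : X → 𝔟 → ℂ}

theorem apply_one (h : IsCumulantDensity V φ l) (x : X) : l x 1 = 0 := (h.isCumulant x).2.1

theorem integral_ind (h : IsCumulantDensity V φ l) (b : 𝔟) (D : IntegrableSet μ) :
    integralFunctional μ l (StepMap.ind b D) = ∫ x in D.1, l x b ∂μ :=
  integralFunctional_ind (ae_of_all _ h.apply_one) b D

theorem isCumulant_integral (h : IsCumulantDensity V φ l) :
    IsCumulant (integralFunctional μ l) :=
  isCumulant_integralFunctional h.integrable (ae_of_all _ h.isCumulant)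

theorem hasSum (h : IsCumulantDensity V φ l) (g : ℕ → StepMap μ 𝔟) (f : StepMap μ 𝔟)
    (hj : StepMap.IsJoin g f) :
    HasSum (fun n => integralFunctional μ l (g n)) (integralFunctional μ l f) := by
  have hl1 := ae_of_all μ h.apply_one
  have h1 := hasSum_integral_iUnion (fun n => (g n).measurableSet_supp) (fun m n hmn => hj.1 hmn)
    ((h.integrable f).integrableOn (s := ⋃ n, (g n).supp))
  rw [← integralFunctional_eq_setIntegral hl1 f fun x hx =>
    hj.2.2 x fun n hn => hx (Set.mem_iUnion.2 ⟨n, hn⟩)] at h1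
  refine (congrArg (HasSum · _) (funext fun n => ?_)).mpr h1
  rw [integralFunctional_eq_setIntegral hl1 (g n) (A := (g n).supp) fun x hx => not_not.1 hx]
  refine setIntegral_congr_fun (g n).measurableSet_supp fun x hx => ?_
  simp only [hj.2.1 n x hx]

theorem derivative_ind (h : IsCumulantDensity V φ l) :
    IsVitaliDerivative V (fun D b => φ (StepMap.ind b D) - 1) l :=
  h.toIsLogDensity.derivative_exp (ae_of_all _ h.apply_one)

theorem infinitelyDivisibleState (h : IsCumulantDensity V φ l) :
    InfinitelyDivisibleState V φ := by
  have hstate : IsState φ := by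
    have := h.isCumulant_integral.isState_exp
    rwa [show (fun g => Complex.exp (integralFunctional μ l g)) = φ from funext h.exp_eq] at this
  refine ⟨fun D => hstate.comp (indHom D) fun b => (StepMap.star_ind b D).symm, ⟨hstate, ?_⟩,
    fun g => ?_, fun D b hD => ?_, ⟨l, h.derivative_ind⟩⟩
  · intro g f hj
    have h1 := (h.hasSum g f hj).tendsto_sum_nat.cexp
    simpa only [Complex.exp_sum, h.exp_eq] using h1
  · rw [← h.exp_eq]
    exact Complex.exp_ne_zero _
  · rw [← h.exp_eq, h.integral_ind, Measure.restrict_eq_zero.2 hD]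
    simp

theorem isCovariantDensity (h : IsCumulantDensity V φ l) {S : Type w} [Semigroup S]
    {σ : Symmetry S μ 𝔟} (hV : σ.Respects V) (hφ : σ.IsHomogeneous φ) : σ.IsCovariantDensity l :=
  Symmetry.isCovariantDensity_of_derivative hV hφ h.derivative_ind

theorem cumulantFunctional (h : IsCumulantDensity V φ l) {S : Type w} [Semigroup S]
    {σ : Symmetry S μ 𝔟} (hV : σ.Respects V) (hφ : σ.IsHomogeneous φ) : CumulantFunctional σ V φ (integralFunctional μ l) l where
  exp_eq := h.exp_eq
  sigmaAdditive := h.hasSum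
  absolutelyContinuous D b hD := by
    rw [h.integral_ind, Measure.restrict_eq_zero.2 hD]
    simp
  homogeneous := Symmetry.isHomogeneous_integralFunctional (h.isCovariantDensity hV hφ)
    (ae_of_all _ h.apply_one)
  cumulant D := h.isCumulant_integral.comp (indHom D) fun b => (StepMap.star_ind b D).symm
  integrableOn := h.toIsLogDensity.integrableOn
  eq_integral D b := h.integral_ind b D
  derivative := by
    simp_rw [h.integral_ind]
    exact h.derivative
  covariant := h.isCovariantDensity hV hφ

end IsCumulantDensity

/-- The real and imaginary parts are split by sign. The norm is bounded by the sum of four integrals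
over measurable sets, each at most some ‖∫_A f‖, whence the constant 4. -/
theorem exists_integral_norm_le {ν : Measure X} {f : X → ℂ} (hf : Integrable f ν) :
    ∃ A, MeasurableSet A ∧ ∫ x, ‖f x‖ ∂ν ≤ 4 * ‖∫ x in A, f x ∂ν‖ := by
  have hreal : ∀ u : X → ℝ, Integrable u ν → ∃ P, MeasurableSet P ∧
      ∫ x, |u x| ∂ν = ∫ x in P, u x ∂ν - ∫ x in Pᶜ, u x ∂ν := by
    intro u hu
    have hm := hu.1.aemeasurable
    refine ⟨{x | 0 ≤ hm.mk u x}, measurableSet_le measurable_const hm.measurable_mk, ?_⟩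
    have hPm : MeasurableSet {x | 0 ≤ hm.mk u x} := measurableSet_le measurable_const hm.measurable_mk
    rw [← integral_add_compl hPm hu.abs, sub_eq_add_neg, ← integral_neg]
    congr 1
    · refine integral_congr_ae ?_
      filter_upwards [ae_restrict_of_ae hm.ae_eq_mk, ae_restrict_mem hPm] with x h1 h2
      rw [abs_of_nonneg (h1 ▸ h2)]
    · refine integral_congr_ae ?_
      filter_upwards [ae_restrict_of_ae hm.ae_eq_mk, ae_restrict_mem hPm.compl] with x h1 h2
      rw [abs_of_nonpos (h1 ▸ (not_le.1 (show ¬ 0 ≤ hm.mk u x from h2)).le)]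
  obtain ⟨P, hP, hPe⟩ := hreal _ hf.re
  obtain ⟨Q, hQ, hQe⟩ := hreal _ hf.im
  by_contra! hcon
  have h1 : ∫ x, ‖f x‖ ∂ν ≤ ∫ x, |RCLike.re (f x)| ∂ν + ∫ x, |RCLike.im (f x)| ∂ν := by
    rw [← integral_add hf.re.abs hf.im.abs]
    exact integral_mono hf.norm (hf.re.abs.add hf.im.abs) fun x => Complex.norm_le_abs_re_add_abs_im _
  have hre : ∀ A, MeasurableSet A → 4 * |∫ x in A, RCLike.re (f x) ∂ν| < ∫ x, ‖f x‖ ∂ν := by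
    intro A hA
    refine lt_of_le_of_lt ?_ (hcon A hA)
    rw [integral_re hf.integrableOn]
    gcongr
    exact RCLike.abs_re_le_norm _
  have him : ∀ A, MeasurableSet A → 4 * |∫ x in A, RCLike.im (f x) ∂ν| < ∫ x, ‖f x‖ ∂ν := by
    intro A hA
    refine lt_of_le_of_lt ?_ (hcon A hA)
    rw [integral_im hf.integrableOn]
    gcongr
    exact RCLike.abs_im_le_norm _
  rw [hPe, hQe] at h1
  have a1 := le_abs_self (∫ x in P, RCLike.re (f x) ∂ν)
  have a2 := neg_abs_le (∫ x in Pᶜ, RCLike.re (f x) ∂ν)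
  have a3 := le_abs_self (∫ x in Q, RCLike.im (f x) ∂ν)
  have a4 := neg_abs_le (∫ x in Qᶜ, RCLike.im (f x) ∂ν)
  linarith [hre P hP, hre Pᶜ hP.compl, him Q hQ, him Qᶜ hQ.compl]

/-- The density is integrable on each level set of g; the issue is its integrability over their
union. On every level a subset is chosen whose integral controls the L¹ norm, and the join of g over
these subsets has, by σ-additivity, an absolutely convergent series of values. -/
theorem CumulantFunctional.exists_isCumulantDensity {S : Type w} [Semigroup S]
    {σ : Symmetry S μ 𝔟} {lam : StepMap μ 𝔟 → ℂ} {l : X → 𝔟 → ℂ}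
    (h : CumulantFunctional σ V φ lam l) : ∃ l', IsCumulantDensity V φ l' := by
  have hcum : ∀ᵐ x ∂μ, IsCumulant (l x) := h.derivative.ae_isCumulant h.cumulant
  have hl1 : ∀ᵐ x ∂μ, l x 1 = 0 := by filter_upwards [hcum] with x hx using hx.2.1
  have key : ∀ g : StepMap μ 𝔟, Integrable (fun x => l x (g x)) μ ∧
      lam g = integralFunctional μ l g := by
    intro g
    obtain ⟨b, D, hd, hb, hU⟩ := g.exists_levels
    have hbD : ∀ n, ∀ A ⊆ (D n).1, MeasurableSet A →
        ∫ x in A, l x (b n) ∂μ = ∫ x in A, l x (g x) ∂μ := fun n A hAD hA =>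
      setIntegral_congr_fun hA fun x hx => by simp only [hb n x (hAD hx)]
    have hint : ∀ n, IntegrableOn (fun x => l x (g x)) (D n).1 μ := fun n =>
      (h.integrableOn (D n) (b n)).congr_fun (fun x hx => by simp only [hb n x hx]) (D n).2.1
    choose A hA hAle using fun n => exists_integral_norm_le (hint n)
    let T : ℕ → IntegrableSet μ := fun n => ⟨A n ∩ (D n).1, (hA n).inter (D n).2.1,
      (measure_mono Set.inter_subset_right).trans_lt (D n).2.2⟩
    have hTm : MeasurableSet (⋃ n, (T n).1) := MeasurableSet.iUnion fun n => (T n).2.1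
    have hjT := (g.restrict _ hTm).isJoin_ind (b := b) (D := T)
      (fun m n hmn => (hd hmn).mono Set.inter_subset_right Set.inter_subset_right)
      (fun n x hx => by rw [g.restrict_of_mem _ (Set.mem_iUnion.2 ⟨n, hx⟩), hb n x hx.2])
      (fun x hx => g.restrict_of_notMem _ fun hx' => by
        obtain ⟨n, hn⟩ := Set.mem_iUnion.1 hx'
        exact hx n hn)
    have hsum := (h.sigmaAdditive _ _ hjT).summable.norm
    have hsum' : Summable fun n => ∫ x in (D n).1, ‖l x (g x)‖ ∂μ := by
      refine Summable.of_nonneg_of_le (fun n => integral_nonneg fun x => norm_nonneg _)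
        (fun n => ?_) (hsum.mul_left 4)
      refine (hAle n).trans_eq ?_
      rw [Measure.restrict_restrict (hA n), h.eq_integral]
      congr 2
      exact (hbD n _ Set.inter_subset_right (T n).2.1).symm
    have hIU := integrableOn_iUnion_of_summable_integral_norm hint hsum'
    have hI : Integrable (fun x => l x (g x)) μ := by
      refine hIU.integrable_of_ae_notMem_eq_zero ?_
      filter_upwards [hl1] with x hx hxn
      rw [hU] at hxn
      rw [not_not.1 (show ¬ g x ≠ 1 from hxn), hx]
    refine ⟨hI, ?_⟩
    have hj := g.isJoin_ind hd hb fun x hx => by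
      by_contra hne
      obtain ⟨n, hn⟩ := Set.mem_iUnion.1 (hU ▸ (show x ∈ g.supp from hne))
      exact hx n hn
    have h1 := h.sigmaAdditive _ _ hj
    have h2 := hasSum_integral_iUnion (fun n => (D n).2.1) hd hIU
    rw [hU, ← integralFunctional_eq_setIntegral hl1 g (A := g.supp)
      fun x hx => not_not.1 hx] at h2
    refine h1.unique ((congrArg (HasSum · _) (funext fun n => ?_)).mpr h2)
    rw [h.eq_integral]
    exact hbD n _ subset_rfl (D n).2.1
  refine IsLogDensity.exists_isCumulantDensity (l := l)
    ⟨fun g => (key g).1, fun g => by rw [← (key g).2, h.exp_eq], ?_⟩ hcum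
  have := h.derivative
  simp_rw [h.eq_integral] at this
  exact this

end Core

/-! ### The pre-Hilbert space of a positive definite kernel -/

section Kernel

variable {ι : Type u}

/-- A positive definite kernel defines a semi-definite scalar product on finitely supported
functions. -/
abbrev kernelCore (Q : ι → ι → ℂ) (hQ : ∀ a c, conj (Q a c) = Q c a)
    (hpos : ∀ κ : ι →₀ ℂ, 0 ≤ (κ.sum fun a r => κ.sum fun c t => conj r * Q a c * t).re) :
    PreInnerProductSpace.Core ℂ (ι →₀ ℂ) where
  inner κ κ' := κ.sum fun a r => κ'.sum fun c t => conj r * Q a c * t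
  conj_inner_symm κ κ' := by
    rw [Finsupp.sum_comm]
    simp only [Finsupp.sum, map_sum, map_mul, Complex.conj_conj, hQ]
    exact Finset.sum_congr rfl fun a _ => Finset.sum_congr rfl fun c _ => by ring
  re_inner_nonneg κ := hpos κ
  add_left κ κ' η := by
    rw [Finsupp.sum_add_index'] <;> simp [← Finsupp.sum_add, add_mul]
  smul_left κ κ' r := by
    rw [Finsupp.sum_smul_index] <;> simp [Finsupp.mul_sum, ← mul_assoc]

/-- Finitely supported functions modulo null vectors, without completion: the vectors k a span the
whole space algebraically, so linear maps are determined by their values on them. -/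
theorem exists_space_of_kernel (Q : ι → ι → ℂ) (hQ : ∀ a c, conj (Q a c) = Q c a)
    (hpos : ∀ κ : ι →₀ ℂ, 0 ≤ (κ.sum fun a r => κ.sum fun c t => conj r * Q a c * t).re) :
    ∃ (E : Type u) (_ : NormedAddCommGroup E) (_ : InnerProductSpace ℂ E) (k : ι → E),
      (∀ a c, ⟪k a, k c⟫_ℂ = Q a c) ∧ Submodule.span ℂ (Set.range k) = ⊤ := by
  let core := kernelCore Q hQ hpos
  let : SeminormedAddCommGroup (ι →₀ ℂ) :=
    InnerProductSpace.Core.toSeminormedAddCommGroup (𝕜 := ℂ) (F := ι →₀ ℂ)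
  let : InnerProductSpace ℂ (ι →₀ ℂ) := .ofCore _
  refine ⟨SeparationQuotient (ι →₀ ℂ), inferInstance, inferInstance,
    fun a => SeparationQuotient.mk (Finsupp.single a 1), fun a c => ?_, ?_⟩
  · rw [SeparationQuotient.inner_mk_mk]
    change ((Finsupp.single a (1 : ℂ)).sum fun a r =>
      (Finsupp.single c (1 : ℂ)).sum fun c t => conj r * Q a c * t) = Q a c
    rw [Finsupp.sum_single_index, Finsupp.sum_single_index] <;> simp
  · rw [eq_top_iff]
    rintro y -
    obtain ⟨κ, rfl⟩ := SeparationQuotient.surjective_mk y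
    induction κ using Finsupp.induction_linear with
    | zero => exact zero_mem _
    | add f g hf hg => exact add_mem hf hg
    | single a r =>
      have : SeparationQuotient.mk (Finsupp.single a r) =
          r • (SeparationQuotient.mk (Finsupp.single a (1 : ℂ)) :
            SeparationQuotient (ι →₀ ℂ)) := by
        rw [← SeparationQuotient.mk_smul, Finsupp.smul_single, smul_eq_mul, mul_one]
      rw [this]
      exact Submodule.smul_mem _ _ (Submodule.subset_span ⟨a, rfl⟩)

theorem exists_linearMap_of_span {E F : Type*} [AddCommGroup E] [Module ℂ E] [AddCommGroup F]
    [Module ℂ F] {ι : Type*} {v : ι → E} {w : ι → F} (hv : Submodule.span ℂ (Set.range v) = ⊤)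
    (h : ∀ c : ι →₀ ℂ, Finsupp.linearCombination ℂ v c = 0 →
      Finsupp.linearCombination ℂ w c = 0) :
    ∃ T : E →ₗ[ℂ] F, ∀ i, T (v i) = w i := by
  have hs : LinearMap.range (Finsupp.linearCombination ℂ v) = ⊤ := by
    rw [Finsupp.range_linearCombination, hv]
  let e := (Finsupp.linearCombination ℂ v).quotKerEquivOfSurjective (LinearMap.range_eq_top.1 hs)
  have hker : LinearMap.ker (Finsupp.linearCombination ℂ v) ≤
      LinearMap.ker (Finsupp.linearCombination ℂ w) := fun c hc =>
    LinearMap.mem_ker.2 (h c (LinearMap.mem_ker.1 hc))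
  refine ⟨Submodule.liftQ _ _ hker ∘ₗ e.symm.toLinearMap, fun i => ?_⟩
  have : e.symm (v i) = Submodule.Quotient.mk (Finsupp.single i 1) := by
    rw [LinearEquiv.symm_apply_eq]
    simp [e]
  rw [LinearMap.comp_apply, LinearEquiv.coe_coe, this, Submodule.liftQ_apply]
  simp

/-- Equal Gram matrices give corresponding combinations equal norms; in particular linear relations
among the v i hold among the w i. -/
theorem exists_isometric_of_gram {E F : Type*} [NormedAddCommGroup E] [InnerProductSpace ℂ E]
    [NormedAddCommGroup F] [InnerProductSpace ℂ F] {ι : Type*} {v : ι → E} {w : ι → F}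
    (hv : Submodule.span ℂ (Set.range v) = ⊤) (h : ∀ i j, ⟪w i, w j⟫_ℂ = ⟪v i, v j⟫_ℂ) :
    ∃ T : E →ₗ[ℂ] F, (∀ i, T (v i) = w i) ∧ ∀ e, ‖T e‖ = ‖e‖ := by
  have hin : ∀ c : ι →₀ ℂ, ⟪Finsupp.linearCombination ℂ w c, Finsupp.linearCombination ℂ w c⟫_ℂ =
      ⟪Finsupp.linearCombination ℂ v c, Finsupp.linearCombination ℂ v c⟫_ℂ := by
    intro c
    simp only [Finsupp.linearCombination_apply, Finsupp.sum, sum_inner, inner_sum, inner_smul_left,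
      inner_smul_right, h]
  have hnorm : ∀ c : ι →₀ ℂ, ‖Finsupp.linearCombination ℂ w c‖ =
      ‖Finsupp.linearCombination ℂ v c‖ := by
    intro c
    rw [norm_eq_sqrt_re_inner (𝕜 := ℂ), norm_eq_sqrt_re_inner (𝕜 := ℂ), hin]
  obtain ⟨T, hT⟩ := exists_linearMap_of_span (w := w) hv fun c hc => by
    rw [← norm_eq_zero, hnorm, hc, norm_zero]
  refine ⟨T, hT, fun e => ?_⟩
  obtain ⟨c, rfl⟩ : e ∈ LinearMap.range (Finsupp.linearCombination ℂ v) := by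
    rw [Finsupp.range_linearCombination, hv]
    trivial
  rw [← hnorm c]
  congr 1
  simp only [Finsupp.linearCombination_apply, Finsupp.sum, map_sum, map_smul, hT]

end Kernel

/-! ### The canonical triple of a cumulant functional -/

section Triple

variable {𝔟 : Type u} [Monoid 𝔟] [StarMul 𝔟]

/-- The cocycle `k` and the representation `j` associated with a cumulant functional. -/
structure IsTriple {E : Type u} [NormedAddCommGroup E] [InnerProductSpace ℂ E] (lam : 𝔟 → ℂ)
    (k : 𝔟 → E) (j : 𝔟 → E →ₗ[ℂ] E) : Prop where
  lam_one : lam 1 = 0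
  lam_star : ∀ b, lam (star b) = conj (lam b)
  inner_k : ∀ a c, ⟪k a, k c⟫_ℂ = lam (star a * c) - lam (star a) - lam c
  span_k : Submodule.span ℂ (Set.range k) = ⊤
  j_k : ∀ g c, j g (k c) = k (g * c) - k g

theorem inner_ext_of_span {E : Type*} [NormedAddCommGroup E] [InnerProductSpace ℂ E] {ι : Type*}
    {v : ι → E} (hv : Submodule.span ℂ (Set.range v) = ⊤) {e : E} (h : ∀ i, ⟪e, v i⟫_ℂ = 0) :
    e = 0 := by
  have h1 : ∀ y ∈ Submodule.span ℂ (Set.range v), ⟪e, y⟫_ℂ = 0 := by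
    intro y hy
    induction hy using Submodule.span_induction with
    | mem x hx =>
      obtain ⟨i, rfl⟩ := hx
      exact h i
    | zero => exact inner_zero_right _
    | add x y _ _ hx hy => rw [inner_add_right, hx, hy, add_zero]
    | smul r x _ hx => rw [inner_smul_right, hx, mul_zero]
  exact inner_self_eq_zero.1 (h1 e (hv ▸ Submodule.mem_top))

/-- The prescription k(c) ↦ k(gc) - k(g) respects linear relations because it has the formal adjoint
k(c) ↦ k(g⋆c) - k(g⋆): the image of a vanishing combination is orthogonal to all k(d). No
boundedness is needed. -/
theorem IsCumulant.exists_isTriple {lam : 𝔟 → ℂ} (h : IsCumulant lam) :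
    ∃ (E : Type u) (_ : NormedAddCommGroup E) (_ : InnerProductSpace ℂ E) (k : 𝔟 → E)
      (j : 𝔟 → E →ₗ[ℂ] E), IsTriple lam k j := by
  obtain ⟨E, _, _, k, hk, hspan⟩ := exists_space_of_kernel
    (fun a c : 𝔟 => lam (star a * c) - lam (star a) - lam c)
    (fun a c => by
      simp only [map_sub, ← h.2.2, star_mul, star_star]
      ring)
    (fun κ => by
      have h1 := h.kernel_sum_nonneg (fun i : κ.support => star i.1) fun i => conj (κ i.1)
      simp only [star_star, Complex.conj_conj] at h1
      have h2 : (κ.sum fun a r => κ.sum fun c t =>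
          conj r * (lam (star a * c) - lam (star a) - lam c) * t) =
          ∑ i : κ.support, ∑ j : κ.support, conj (κ i.1) *
            (lam (star i.1 * j.1) - lam (star i.1) - lam j.1) * κ j.1 := by
        simp only [Finsupp.sum]
        rw [← Finset.sum_coe_sort κ.support]
        simp_rw [← Finset.sum_coe_sort κ.support]
      rw [h2]
      exact (Complex.nonneg_iff.1 h1).1)
  have hadj : ∀ g a c, ⟪k (g * a) - k g, k c⟫_ℂ = ⟪k a, k (star g * c) - k (star g)⟫_ℂ := by
    intro g a c
    simp only [inner_sub_left, inner_sub_right, hk, star_mul, mul_assoc]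
    ring
  have hj : ∀ g, ∃ T : E →ₗ[ℂ] E, ∀ c, T (k c) = k (g * c) - k g := by
    intro g
    refine exists_linearMap_of_span (w := fun c => k (g * c) - k g) hspan fun c hc => ?_
    refine inner_ext_of_span hspan fun d => ?_
    have h1 : ⟪Finsupp.linearCombination ℂ k c, k (star g * d) - k (star g)⟫_ℂ = 0 := by
      rw [hc, inner_zero_left]
    rw [← h1]
    simp only [Finsupp.linearCombination_apply, Finsupp.sum, sum_inner, inner_smul_left, hadj]
  choose j hj using hj
  exact ⟨E, _, _, k, j, h.2.1, h.2.2, hk, hspan, hj⟩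

namespace IsTriple

variable {E : Type u} [NormedAddCommGroup E] [InnerProductSpace ℂ E] {lam : 𝔟 → ℂ}
    {k : 𝔟 → E} {j : 𝔟 → E →ₗ[ℂ] E}

theorem k_one (h : IsTriple lam k j) : k 1 = 0 := by
  rw [← inner_self_eq_zero (𝕜 := ℂ), h.inner_k]
  simp [h.lam_one]

theorem linearMap_ext (h : IsTriple lam k j) {F : Type*} [AddCommGroup F] [Module ℂ F]
    {T T' : E →ₗ[ℂ] F} (hT : ∀ b, T (k b) = T' (k b)) : T = T' :=
  LinearMap.ext_on_range h.span_k hT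

theorem j_one (h : IsTriple lam k j) : j 1 = LinearMap.id :=
  h.linearMap_ext fun b => by simp [h.j_k, h.k_one]

theorem j_mul (h : IsTriple lam k j) (a b : 𝔟) : j (a * b) = j a ∘ₗ j b :=
  h.linearMap_ext fun c => by simp [h.j_k, mul_assoc]

theorem inner_j_star (h : IsTriple lam k j) (b : 𝔟) (e f : E) :
    ⟪j (star b) e, f⟫_ℂ = ⟪e, j b f⟫_ℂ := by
  have hk : ∀ a c, ⟪j (star b) (k a), k c⟫_ℂ = ⟪k a, j b (k c)⟫_ℂ := by
    intro a c
    simp only [h.j_k, inner_sub_left, inner_sub_right, h.inner_k, star_mul, star_star, mul_assoc]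
    ring
  have h1 : ∀ c, ∀ e ∈ Submodule.span ℂ (Set.range k), ⟪j (star b) e, k c⟫_ℂ = ⟪e, j b (k c)⟫_ℂ := by
    intro c e he
    induction he using Submodule.span_induction with
    | mem x hx =>
      obtain ⟨a, rfl⟩ := hx
      exact hk a c
    | zero => simp
    | add x y _ _ hx hy => rw [map_add, inner_add_left, inner_add_left, hx, hy]
    | smul r x _ hx => rw [map_smul, inner_smul_left, inner_smul_left, hx]
  have h2 : ∀ f ∈ Submodule.span ℂ (Set.range k), ⟪j (star b) e, f⟫_ℂ = ⟪e, j b f⟫_ℂ := by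
    intro f hf
    induction hf using Submodule.span_induction with
    | mem x hx =>
      obtain ⟨c, rfl⟩ := hx
      exact h1 c e (h.span_k ▸ Submodule.mem_top)
    | zero => simp
    | add x y _ _ hx hy => rw [map_add, inner_add_right, inner_add_right, hx, hy]
    | smul r x _ hx => rw [map_smul, inner_smul_right, inner_smul_right, hx]
  exact h2 f (h.span_k ▸ Submodule.mem_top)

end IsTriple

end Triple

/-! ### Scalar products on pre-Hilbert subspaces of direct integrals -/

section DirectIntegral

variable {X : Type v} [MeasurableSpace X] {ν : Measure X}
  {E : X → Type u} [∀ x, NormedAddCommGroup (E x)] [∀ x, InnerProductSpace ℂ (E x)]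

theorem cls_eq_iff {ξ η : ∀ x, E x} : cls ν ξ = cls ν η ↔ ∀ᵐ x ∂ν, ξ x = η x := by
  unfold cls
  rw [Submodule.Quotient.eq]
  change (∀ᵐ x ∂ν, ξ x - η x = 0) ↔ _
  simp only [sub_eq_zero]

theorem exists_cls (ξ : SectionClass ν E) : ∃ ζ : ∀ x, E x, cls ν ζ = ξ :=
  Submodule.Quotient.mk_surjective _ ξ

theorem cls_add (ξ η : ∀ x, E x) : cls ν (ξ + η) = cls ν ξ + cls ν η := rfl

theorem cls_smul (c : ℂ) (ξ : ∀ x, E x) : cls ν (c • ξ) = c • cls ν ξ := rfl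

theorem sprod_conj (ξ η : SectionClass ν E) : conj (sprod ξ η) = sprod η ξ := by
  obtain ⟨ξ, rfl⟩ := exists_cls ξ
  obtain ⟨η, rfl⟩ := exists_cls η
  rw [sprod_cls, sprod_cls, ← integral_conj]
  simp only [inner_conj_symm]

theorem sprod_smul_right (c : ℂ) (ξ η : SectionClass ν E) :
    sprod ξ (c • η) = c * sprod ξ η := by
  obtain ⟨ξ, rfl⟩ := exists_cls ξ
  obtain ⟨η, rfl⟩ := exists_cls η
  rw [← cls_smul, sprod_cls, sprod_cls, ← integral_const_mul]
  simp only [Pi.smul_apply, inner_smul_right]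

theorem sprod_smul_left (c : ℂ) (ξ η : SectionClass ν E) :
    sprod (c • ξ) η = conj c * sprod ξ η := by
  rw [← sprod_conj, sprod_smul_right, map_mul, sprod_conj]

theorem sprod_self_nonneg (ξ : SectionClass ν E) : 0 ≤ sprod ξ ξ := by
  obtain ⟨ξ, rfl⟩ := exists_cls ξ
  rw [sprod_cls]
  refine integral_nonneg fun x => ?_
  simp only [inner_self_eq_norm_sq_to_K]
  change (0 : ℂ) ≤ ((‖ξ x‖ : ℝ) : ℂ) ^ 2
  rw [← Complex.ofReal_pow]
  exact Complex.zero_le_real.2 (by positivity)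

namespace IsPreHilbert

variable {K : Submodule ℂ (SectionClass ν E)}

/-- Unlike homogeneity and conjugate symmetry, additivity needs integrability, hence membership in a
pre-Hilbert subspace. -/
theorem sprod_add_right (hK : IsPreHilbert K) {ξ η ζ : SectionClass ν E} (hξ : ξ ∈ K)
    (hη : η ∈ K) (hζ : ζ ∈ K) : sprod ξ (η + ζ) = sprod ξ η + sprod ξ ζ := by
  obtain ⟨ξ, rfl⟩ := exists_cls ξ
  obtain ⟨η, rfl⟩ := exists_cls η
  obtain ⟨ζ, rfl⟩ := exists_cls ζ
  rw [← cls_add, sprod_cls, sprod_cls, sprod_cls, ← integral_add (hK _ _ hξ hη) (hK _ _ hξ hζ)]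
  simp only [Pi.add_apply, inner_add_right]

theorem sprod_add_left (hK : IsPreHilbert K) {ξ η ζ : SectionClass ν E} (hξ : ξ ∈ K)
    (hη : η ∈ K) (hζ : ζ ∈ K) : sprod (ξ + η) ζ = sprod ξ ζ + sprod η ζ := by
  rw [← sprod_conj, hK.sprod_add_right hζ hξ hη, map_add, sprod_conj, sprod_conj]

/-- The scalar product of a pre-Hilbert subspace as a sesquilinear map. -/
def form (hK : IsPreHilbert K) : K →ₗ⋆[ℂ] K →ₗ[ℂ] ℂ :=
  LinearMap.mk₂'ₛₗ (starRingEnd ℂ) (RingHom.id ℂ)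
    (fun ξ η => sprod (ξ : SectionClass ν E) (η : SectionClass ν E))
    (fun ξ η ζ => hK.sprod_add_left ξ.2 η.2 ζ.2)
    (fun c _ _ => sprod_smul_left c _ _)
    (fun ξ η ζ => hK.sprod_add_right ξ.2 η.2 ζ.2)
    (fun c _ _ => sprod_smul_right c _ _)

theorem form_apply (hK : IsPreHilbert K) (ξ η : K) :
    hK.form ξ η = sprod (ξ : SectionClass ν E) (η : SectionClass ν E) := rfl

theorem sprod_sub_left (hK : IsPreHilbert K) {ξ η ζ : SectionClass ν E} (hξ : ξ ∈ K)
    (hη : η ∈ K) (hζ : ζ ∈ K) : sprod (ξ - η) ζ = sprod ξ ζ - sprod η ζ := by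
  have := congrArg (fun T => T (⟨ζ, hζ⟩ : K)) (map_sub hK.form (⟨ξ, hξ⟩ : K) ⟨η, hη⟩)
  exact this

end IsPreHilbert

/-- The span of sections with integrable mutual scalar products is pre-Hilbert. -/
theorem isPreHilbert_span {ι : Type*} {v : ι → ∀ x, E x}
    (hv : ∀ i j, Integrable (fun x => ⟪v i x, v j x⟫_ℂ) ν) :
    IsPreHilbert (Submodule.span ℂ (Set.range fun i => cls ν (v i))) := by
  have hR : ∀ i, ∀ η' ∈ Submodule.span ℂ (Set.range fun i => cls ν (v i)), ∀ η : ∀ x, E x,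
      cls ν η = η' → Integrable (fun x => ⟪v i x, η x⟫_ℂ) ν := by
    intro i η' hη'
    induction hη' using Submodule.span_induction with
    | mem y hy =>
      rintro η he
      obtain ⟨j, rfl⟩ := hy
      refine (hv i j).congr ?_
      filter_upwards [cls_eq_iff.1 he] with x hx
      rw [hx]
    | zero =>
      intro η he
      refine (integrable_zero _ _ _).congr ?_
      filter_upwards [cls_eq_iff.1 (he.trans (show (0 : SectionClass ν E) = cls ν 0 from rfl))]
        with x hx
      rw [show η x = 0 from hx, inner_zero_right]
      rfl
    | add y z _ _ hy hz =>
      intro η he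
      obtain ⟨y, rfl⟩ := exists_cls y
      obtain ⟨z, rfl⟩ := exists_cls z
      rw [← cls_add] at he
      refine ((hy y rfl).add (hz z rfl)).congr ?_
      filter_upwards [cls_eq_iff.1 he] with x hx
      rw [hx, Pi.add_apply, Pi.add_apply, inner_add_right]
    | smul c y _ hy =>
      intro η he
      obtain ⟨y, rfl⟩ := exists_cls y
      rw [← cls_smul] at he
      refine ((hy y rfl).const_mul c).congr ?_
      filter_upwards [cls_eq_iff.1 he] with x hx
      rw [hx, Pi.smul_apply, inner_smul_right]
  intro ξ η hξ hη
  have hL : ∀ ξ' ∈ Submodule.span ℂ (Set.range fun i => cls ν (v i)), ∀ ξ : ∀ x, E x,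
      cls ν ξ = ξ' → Integrable (fun x => ⟪ξ x, η x⟫_ℂ) ν := by
    intro ξ' hξ'
    induction hξ' using Submodule.span_induction with
    | mem y hy =>
      rintro ξ he
      obtain ⟨j, rfl⟩ := hy
      refine (hR j _ hη η rfl).congr ?_
      filter_upwards [cls_eq_iff.1 he] with x hx
      rw [hx]
    | zero =>
      intro ξ he
      refine (integrable_zero _ _ _).congr ?_
      filter_upwards [cls_eq_iff.1 (he.trans (show (0 : SectionClass ν E) = cls ν 0 from rfl))]
        with x hx
      rw [show ξ x = 0 from hx, inner_zero_left]
      rfl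
    | add y z _ _ hy hz =>
      intro ξ he
      obtain ⟨y, rfl⟩ := exists_cls y
      obtain ⟨z, rfl⟩ := exists_cls z
      rw [← cls_add] at he
      refine ((hy y rfl).add (hz z rfl)).congr ?_
      filter_upwards [cls_eq_iff.1 he] with x hx
      rw [hx, Pi.add_apply, Pi.add_apply, inner_add_left]
    | smul c y _ hy =>
      intro ξ he
      obtain ⟨y, rfl⟩ := exists_cls y
      rw [← cls_smul] at he
      refine ((hy y rfl).const_mul (conj c)).congr ?_
      filter_upwards [cls_eq_iff.1 he] with x hx
      rw [hx, Pi.smul_apply, inner_smul_left]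
  exact hL _ hξ ξ rfl

/-- A functional whose coboundary is given by scalar products is a cumulant functional. -/
theorem isCumulant_of_sprod {M : Type*} [Monoid M] [StarMul M] {lam : M → ℂ}
    {K : Submodule ℂ (SectionClass ν E)} (hK : IsPreHilbert K) (k : M → K)
    (hk : ∀ a c, sprod (k (star a) : SectionClass ν E) (k c : SectionClass ν E) =
      lam (a * c) - lam a - lam c)
    (h1 : lam 1 = 0) (hs : ∀ b, lam (star b) = conj (lam b)) : IsCumulant lam := by
  refine ⟨fun κ hκ => ?_, h1, hs⟩
  -- In the squared norm of Σ conj(κ a) k(a⋆), the terms with λ(a) or λ(c⋆) alone carry a factor Σκ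
  -- or its conjugate, which is zero.
  have hw := sprod_self_nonneg ((∑ a ∈ κ.support, conj (κ a) • k (star a) : K) : SectionClass ν E)
  rw [← hK.form_apply] at hw
  have hκ' : ∑ c ∈ κ.support, conj (κ c) = 0 := by rw [← map_sum, hκ, map_zero]
  have he : hK.form (∑ a ∈ κ.support, conj (κ a) • k (star a))
      (∑ a ∈ κ.support, conj (κ a) • k (star a)) =
      ∑ a ∈ κ.support, ∑ c ∈ κ.support, (κ a * lam (a * star c) * conj (κ c)
        - κ a * lam a * conj (κ c) - κ a * (lam (star c) * conj (κ c))) := by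
    rw [map_sum hK.form, LinearMap.sum_apply]
    refine Finset.sum_congr rfl fun a _ => ?_
    rw [map_sum]
    refine Finset.sum_congr rfl fun c _ => ?_
    rw [map_smul, LinearMap.map_smulₛₗ hK.form, LinearMap.smul_apply, hK.form_apply, hk, smul_eq_mul,
      smul_eq_mul, Complex.conj_conj]
    ring
  rw [he] at hw
  simp only [Finset.sum_sub_distrib, ← Finset.sum_mul_sum, hκ, hκ', zero_mul, mul_zero,
    sub_zero] at hw
  exact hw

end DirectIntegral

/-! ### Transport of sections by isometric fibre maps -/

section Push

variable {S : Type w} [Semigroup S] {X : Type v} [MeasurableSpace X] {μ : Measure X}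
  {𝔟 : Type u} [Monoid 𝔟] [StarMul 𝔟] (σ : Symmetry S μ 𝔟)
  {E : X → Type u} [∀ x, NormedAddCommGroup (E x)] [∀ x, InnerProductSpace ℂ (E x)]
  (W : ∀ s x, E x →ₗ[ℂ] E (σ.act s x))

theorem push_add (s : S) (ξ η : ∀ x, E x) : push σ W s (ξ + η) = push σ W s ξ + push σ W s η := by
  funext y
  by_cases hy : ∃ x, σ.act s x = y
  · obtain ⟨x, rfl⟩ := hy
    simp only [push_act, Pi.add_apply, map_add]
  · simp only [push_of_notMem σ W s _ hy, Pi.add_apply, add_zero]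

theorem push_smul (s : S) (c : ℂ) (ξ : ∀ x, E x) : push σ W s (c • ξ) = c • push σ W s ξ := by
  funext y
  by_cases hy : ∃ x, σ.act s x = y
  · obtain ⟨x, rfl⟩ := hy
    simp only [push_act, Pi.smul_apply, map_smul]
  · simp only [push_of_notMem σ W s _ hy, Pi.smul_apply, smul_zero]

/-- The transport of sections as a linear map. -/
def pushLinear (s : S) : (∀ x, E x) →ₗ[ℂ] (∀ x, E x) where
  toFun := push σ W s
  map_add' := push_add σ W s
  map_smul' := push_smul σ W s

/-- The transport of classes of sections over `X`. -/
def pushClass (s : S) : SectionClass μ E →ₗ[ℂ] SectionClass μ E :=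
  Submodule.mapQ _ _ (pushLinear σ W s) (by
    intro ξ hξ
    change ∀ᵐ y ∂μ, push σ W s ξ y = 0
    filter_upwards [σ.ae_range s (show ∀ᵐ x ∂μ, ξ x = 0 from hξ)] with y hy
    by_cases hr : y ∈ Set.range (σ.act s)
    · obtain ⟨x, rfl, hx⟩ := hy hr
      rw [push_act, hx, map_zero]
    · exact push_of_notMem σ W s ξ hr)

theorem pushClass_cls (s : S) (ξ : ∀ x, E x) :
    pushClass σ W s (cls μ ξ) = cls μ (push σ W s ξ) := rfl

/-- The transport of classes of sections over an integrable set. -/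
def pushClassOn (s : S) (D : IntegrableSet μ) :
    SectionClass (μ.restrict D.1) E →ₗ[ℂ] SectionClass (μ.restrict (σ.image s D).1) E :=
  Submodule.mapQ _ _ (pushLinear σ W s) (by
    intro ξ hξ
    change ∀ᵐ y ∂μ.restrict (σ.act s '' D.1), push σ W s ξ y = 0
    filter_upwards [σ.ae_image s D.2.1 (show ∀ᵐ x ∂μ.restrict D.1, ξ x = 0 from hξ)] with y hy
    obtain ⟨x, rfl, hx⟩ := hy
    rw [push_act, hx, map_zero])

theorem pushClassOn_cls (s : S) (D : IntegrableSet μ) (ξ : ∀ x, E x) :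
    pushClassOn σ W s D (cls (μ.restrict D.1) ξ) =
      cls (μ.restrict (σ.image s D).1) (push σ W s ξ) := rfl

variable {σ W}

theorem cls_push_eq_iff {s : S} {D : IntegrableSet μ} {ξ η : ∀ x, E x} :
    cls (μ.restrict (σ.image s D).1) (push σ W s ξ) = cls (μ.restrict (σ.image s D).1) η ↔
      ∀ᵐ x ∂μ.restrict D.1, W s x (ξ x) = η (σ.act s x) := by
  have hm : μ.restrict (σ.image s D).1 = (μ.restrict D.1).map (σ.act s) :=
    (σ.map_restrict s D.2.1).symm
  rw [cls_eq_iff, hm, (σ.measurableEmbedding s).ae_map_iff]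
  simp only [push_act]

theorem sprod_pushOn {s : S} (hW : ∀ᵐ x ∂μ, ∀ e, ‖W s x e‖ = ‖e‖) (D : IntegrableSet μ)
    (ξ η : SectionClass (μ.restrict D.1) E) :
    sprod (pushClassOn σ W s D ξ) (pushClassOn σ W s D η) = sprod ξ η := by
  obtain ⟨ξ, rfl⟩ := exists_cls ξ
  obtain ⟨η, rfl⟩ := exists_cls η
  have hm : μ.restrict (σ.image s D).1 = (μ.restrict D.1).map (σ.act s) :=
    (σ.map_restrict s D.2.1).symm
  rw [pushClassOn_cls, pushClassOn_cls, sprod_cls, sprod_cls, hm,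
    (σ.measurableEmbedding s).integral_map]
  refine integral_congr_ae ?_
  filter_upwards [ae_restrict_of_ae hW] with x hx
  rw [push_act, push_act]
  exact (LinearMap.norm_map_iff_inner_map_map (W s x)).1 hx _ _

theorem sprod_push {s : S} (hW : ∀ᵐ x ∂μ, ∀ e, ‖W s x e‖ = ‖e‖) (ξ η : ∀ x, E x) :
    sprod (cls μ (push σ W s ξ)) (cls μ (push σ W s η)) = sprod (cls μ ξ) (cls μ η) := by
  rw [sprod_cls, sprod_cls, ← setIntegral_eq_integral_of_forall_compl_eq_zero
    (s := Set.range (σ.act s)), ← σ.map_act, (σ.measurableEmbedding s).integral_map]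
  · refine integral_congr_ae ?_
    filter_upwards [hW] with x hx
    rw [push_act, push_act]
    exact (LinearMap.norm_map_iff_inner_map_map (W s x)).1 hx _ _
  · intro y hy
    rw [push_of_notMem σ W s ξ hy, inner_zero_left]

end Push

/-! ### Fields of triples -/

section Field

variable {S : Type w} [Semigroup S] {X : Type v} [MeasurableSpace X] {μ : Measure X}
  {𝔟 : Type u} [Monoid 𝔟] [StarMul 𝔟] {σ : Symmetry S μ 𝔟}
  {E : X → Type u} [∀ x, NormedAddCommGroup (E x)] [∀ x, InnerProductSpace ℂ (E x)]
  {l : X → 𝔟 → ℂ} {k : ∀ x, 𝔟 → E x} {j : ∀ x, 𝔟 → E x →ₗ[ℂ] E x}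
  {W : ∀ s x, E x →ₗ[ℂ] E (σ.act s x)}

/-- The fibre maps intertwine the cocycles and are isometric almost everywhere. -/
structure IsCovariantField (σ : Symmetry S μ 𝔟) (k : ∀ x, 𝔟 → E x)
    (W : ∀ s x, E x →ₗ[ℂ] E (σ.act s x)) : Prop where
  isometric : ∀ s, ∀ᵐ x ∂μ, ∀ e, ‖W s x e‖ = ‖e‖
  k_covariant : ∀ s, ∀ᵐ x ∂μ, ∀ b, k (σ.act s x) (σ.θ s b) = W s x (k x b)

/-- Covariance of l gives the families k_x(b) and k_{sx}(b_s) the same Gram matrix. At the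
exceptional points the zero map is chosen. -/
theorem exists_isCovariantField (hT : ∀ x, IsTriple (l x) (k x) (j x))
    (hl : σ.IsCovariantDensity l) :
    ∃ W : ∀ s x, E x →ₗ[ℂ] E (σ.act s x), IsCovariantField σ k W := by
  have hex : ∀ s x, ∃ T : E x →ₗ[ℂ] E (σ.act s x),
      (∀ b, l (σ.act s x) (σ.θ s b) = l x b) →
        (∀ b, T (k x b) = k (σ.act s x) (σ.θ s b)) ∧ ∀ e, ‖T e‖ = ‖e‖ := by
    intro s x
    by_cases h : ∀ b, l (σ.act s x) (σ.θ s b) = l x b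
    · obtain ⟨T, hT'⟩ := exists_isometric_of_gram (w := fun b => k (σ.act s x) (σ.θ s b))
        (hT x).span_k fun a c => by
          rw [(hT _).inner_k, (hT x).inner_k, ← σ.θ_star, ← map_mul, h, h, h]
      exact ⟨T, fun _ => hT'⟩
    · exact ⟨0, fun h' => absurd h' h⟩
  choose W hW using hex
  refine ⟨W, fun s => ?_, fun s => ?_⟩
  · filter_upwards [hl s] with x hx using (hW s x hx).2
  · filter_upwards [hl s] with x hx b using ((hW s x hx).1 b).symm

namespace IsCovariantField

theorem isIsometricRep (hW : IsCovariantField σ k W) (hT : ∀ x, IsTriple (l x) (k x) (j x)) :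
    IsIsometricRep σ W := by
  refine ⟨hW.isometric, fun s t ξ => cls_eq_iff.2 ?_⟩
  filter_upwards [σ.ae_range (s * t) (((hW.k_covariant (s * t)).and (hW.k_covariant t)).and
    (σ.ae_act t (hW.k_covariant s)))] with y hy
  by_cases hr : y ∈ Set.range (σ.act (s * t))
  · obtain ⟨x, rfl, ⟨hst, ht⟩, hs⟩ := hy hr
    -- (st)x and s(tx) are equal but not definitionally so, and their fibres are different types;
    -- the base point z is therefore generalised. On the spanning cocycle both maps take k_x(b) to
    -- the vector of b_{st}.
    have key : ∀ z, z = σ.act (s * t) x → ∀ T : E x →ₗ[ℂ] E z,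
        (∀ b, T (k x b) = k z (σ.θ (s * t) b)) → push σ W (s * t) ξ z = T (ξ x) := by
      rintro z rfl T hTk
      rw [push_act]
      exact congrArg (fun L : E x →ₗ[ℂ] _ => L (ξ x))
        ((hT x).linearMap_ext fun b => by rw [hTk, hst])
    rw [σ.act_mul]
    rw [key _ (σ.act_mul s t x).symm (W s (σ.act t x) ∘ₗ W t x) fun b => by
      rw [LinearMap.comp_apply, ← ht, ← hs, σ.θ_mul], push_act, push_act]
    rfl
  · rw [push_of_notMem σ W _ ξ hr]
    by_cases hs : y ∈ Set.range (σ.act s)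
    · obtain ⟨z, rfl⟩ := hs
      rw [push_act, push_of_notMem σ W t ξ, map_zero]
      rintro ⟨x, rfl⟩
      exact hr ⟨x, σ.act_mul s t x⟩
    · rw [push_of_notMem σ W s _ hs]

theorem j_covariant (hW : IsCovariantField σ k W) (hT : ∀ x, IsTriple (l x) (k x) (j x)) (s : S) :
    ∀ᵐ x ∂μ, ∀ b e, W s x (j x b e) = j (σ.act s x) (σ.θ s b) (W s x e) := by
  filter_upwards [hW.k_covariant s] with x hx b e
  refine congrArg (fun L : E x →ₗ[ℂ] _ => L e)
    ((hT x).linearMap_ext (T := W s x ∘ₗ j x b) (T' := j (σ.act s x) (σ.θ s b) ∘ₗ W s x) fun c => ?_)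
  simp only [LinearMap.comp_apply, (hT _).j_k, map_sub, ← hx, map_mul]

end IsCovariantField

/-- The integral of the scalar products of the cocycle. -/
theorem integrable_inner_vec (hT : ∀ x, IsTriple (l x) (k x) (j x))
    (hint : ∀ g : StepMap μ 𝔟, Integrable (fun x => l x (g x)) μ) (f h : StepMap μ 𝔟) :
    Integrable (fun x => ⟪k x (f x), k x (h x)⟫_ℂ) μ := by
  simp only [(hT _).inner_k]
  exact ((hint (star f * h)).sub (hint (star f))).sub (hint h)

theorem integrable_inner_k (hT : ∀ x, IsTriple (l x) (k x) (j x)) {D : IntegrableSet μ}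
    (hint : ∀ b, IntegrableOn (fun x => l x b) D.1 μ) (a c : 𝔟) :
    Integrable (fun x => ⟪k x a, k x c⟫_ℂ) (μ.restrict D.1) := by
  simp only [(hT _).inner_k]
  exact ((hint _).sub (hint _)).sub (hint _)

end Field

/-! ### The canonical triple over the direct integral -/

theorem map_mem_of_mem_span {M N ι : Type*} [AddCommGroup M] [Module ℂ M] [AddCommGroup N]
    [Module ℂ N] (T : M →ₗ[ℂ] N) {v : ι → M} {P : Submodule ℂ N} (h : ∀ i, T (v i) ∈ P) :
    ∀ ξ ∈ Submodule.span ℂ (Set.range v), T ξ ∈ P := by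
  intro ξ hξ
  induction hξ using Submodule.span_induction with
  | mem _ hx =>
    obtain ⟨i, rfl⟩ := hx
    exact h i
  | zero => rw [map_zero]; exact P.zero_mem
  | add x y _ _ hx hy => rw [map_add]; exact P.add_mem hx hy
  | smul c x _ hx => rw [map_smul]; exact P.smul_mem c hx

section Canonical

variable {S : Type w} [Semigroup S] {X : Type v} [MeasurableSpace X] {μ : Measure X}
  {𝔟 : Type u} [Monoid 𝔟] [StarMul 𝔟] {σ : Symmetry S μ 𝔟} {V : VitaliSystem μ}
  {φ : StepMap μ 𝔟 → ℂ}
  {E : X → Type u} [∀ x, NormedAddCommGroup (E x)] [∀ x, InnerProductSpace ℂ (E x)]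
  {l : X → 𝔟 → ℂ} {k : ∀ x, 𝔟 → E x} {j : ∀ x, 𝔟 → E x →ₗ[ℂ] E x}
  {W : ∀ s x, E x →ₗ[ℂ] E (σ.act s x)}

/-- K is the span of the vectors k(g). The algebraic identities hold in each fibre, almost
everywhere for those involving W, and are integrated; invariance of K is checked on the generators.
-/
theorem IsCumulantDensity.canonicalTriple (h : IsCumulantDensity V φ l)
    (hV : σ.Respects V) (hφ : σ.IsHomogeneous φ) (hT : ∀ x, IsTriple (l x) (k x) (j x))
    (hW : IsCovariantField σ k W) :
    CanonicalTriple σ V φ l k j W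
      (Submodule.span ℂ (Set.range fun g : StepMap μ 𝔟 => vec k g)) := by
  have hcov := h.isCovariantDensity hV hφ
  have hK : IsPreHilbert (Submodule.span ℂ (Set.range fun g : StepMap μ 𝔟 => vec k g)) :=
    isPreHilbert_span (integrable_inner_vec hT h.integrable)
  have hmem : ∀ g : StepMap μ 𝔟, vec k g ∈ Submodule.span ℂ
      (Set.range fun g : StepMap μ 𝔟 => vec k g) := fun g => Submodule.subset_span ⟨g, rfl⟩
  have hstar : ∀ g (ξ η : SectionClass μ E),
      sprod (oper j (star g) ξ) η = sprod ξ (oper j g η) := by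
    intro g ξ η
    obtain ⟨ξ, rfl⟩ := exists_cls ξ
    obtain ⟨η, rfl⟩ := exists_cls η
    refine integral_congr_ae (ae_of_all _ fun x => ?_)
    exact (hT x).inner_j_star (g x) _ _
  have hvec : ∀ g f : StepMap μ 𝔟, oper j g (vec k f) = vec k (g * f) - vec k g := fun g f =>
    cls_eq_iff.2 (ae_of_all _ fun x => (hT x).j_k (g x) (f x))
  have hmul : ∀ g f (ξ : SectionClass μ E), oper j (g * f) ξ = oper j g (oper j f ξ) := by
    intro g f ξ
    obtain ⟨ξ, rfl⟩ := exists_cls ξ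
    refine cls_eq_iff.2 (ae_of_all _ fun x => ?_)
    change j x (g x * f x) (ξ x) = j x (g x) (j x (f x) (ξ x))
    rw [(hT x).j_mul, LinearMap.comp_apply]
  have hpush : ∀ s (g : StepMap μ 𝔟), pushClass σ W s (vec k g) = vec k (σ.shift s g) := by
    intro s g
    rw [vec, vec, pushClass_cls, cls_eq_iff]
    filter_upwards [σ.ae_range s (hW.k_covariant s)] with y hy
    by_cases hr : y ∈ Set.range (σ.act s)
    · obtain ⟨x, rfl, hx⟩ := hy hr
      rw [push_act, σ.shift_act, hx]
    · rw [push_of_notMem σ W s _ hr, σ.shift_of_notMem s g hr, (hT y).k_one]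
  have hoper : ∀ g, ∀ ξ ∈ Submodule.span ℂ (Set.range fun g : StepMap μ 𝔟 => vec k g),
      oper j g ξ ∈ Submodule.span ℂ (Set.range fun g : StepMap μ 𝔟 => vec k g) := by
    intro g
    refine map_mem_of_mem_span (oper j g) fun f => ?_
    rw [hvec]
    exact sub_mem (hmem _) (hmem _)
  have hpushmem : ∀ s, ∀ ξ ∈ Submodule.span ℂ (Set.range fun g : StepMap μ 𝔟 => vec k g),
      pushClass σ W s ξ ∈ Submodule.span ℂ (Set.range fun g : StepMap μ 𝔟 => vec k g) := by
    intro s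
    refine map_mem_of_mem_span (pushClass σ W s) fun f => ?_
    rw [hpush]
    exact hmem _
  exact
  { logDensity := h.toIsLogDensity
    homogeneous := Symmetry.isHomogeneous_integralFunctional hcov (ae_of_all _ h.apply_one)
    covariant := hcov
    l_star := fun x b => (h.isCumulant x).2.2 b
    l_one := h.apply_one
    preHilbert := hK
    vec_mem := hmem
    k_one := fun x => (hT x).k_one
    isometricRep := hW.isIsometricRep hT
    push_mem := fun s ξ hξ => hpushmem s _ hξ
    push_isometric := fun s ξ _ => sprod_push (hW.isometric s) ξ ξ
    k_covariant := hW.k_covariant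
    covec_vec := by
      intro f g
      change ∫ x, ⟪k x (star (f x)), k x (g x)⟫_ℂ ∂μ = _
      simp only [(hT _).inner_k, star_star]
      have h1 := h.integrable (f * g)
      have h2 : Integrable (fun x => l x ((f * g) x) - l x (f x)) μ := h1.sub (h.integrable f)
      simp only [StepMap.mul_apply] at h1 h2
      rw [integral_sub h2 (h.integrable g), integral_sub h1 (h.integrable f)]
      rfl
    j_one := fun x => (hT x).j_one
    oper_mem := hoper
    oper_mul := fun g f ξ _ => hmul g f ξ
    oper_star := fun g ξ _ η _ => hstar g ξ η
    oper_one := by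
      intro ξ _
      obtain ⟨ξ, rfl⟩ := exists_cls ξ
      refine cls_eq_iff.2 (ae_of_all _ fun x => ?_)
      change j x 1 (ξ x) = ξ x
      rw [(hT x).j_one, LinearMap.id_apply]
    oper_covariant := by
      intro s g ξ _
      refine cls_eq_iff.2 ?_
      filter_upwards [σ.ae_range s (hW.j_covariant hT s)] with y hy
      change _ = j y (σ.shift s g y) (push σ W s ξ y)
      by_cases hr : y ∈ Set.range (σ.act s)
      · obtain ⟨x, rfl, hx⟩ := hy hr
        rw [push_act, push_act, σ.shift_act, hx]
      · rw [push_of_notMem σ W s _ hr, push_of_notMem σ W s _ hr, map_zero]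
    oper_vec := hvec
    covec_oper := by
      intro f g ξ hξ
      unfold covec
      rw [← hstar, hvec, hK.sprod_sub_left (hmem _) (hmem _) hξ, star_mul]
    oper_continuous := by
      intro g f
      -- Multiplicativity of j turns the bound into an equality with the single seminorm of f * g.
      refine ⟨{f * g}, 1, fun ξ _ => ?_⟩
      rw [Finset.sum_singleton, one_mul]
      unfold polynorm
      rw [hmul] }

/-- The identity for k⋆(f)k(h) makes λ a cumulant functional on step maps. Along b ↦ b_D it gives
cumulant functionals λ_D, whose derivative is l. -/
theorem CanonicalTriple.exists_isCumulantDensity {K : Submodule ℂ (SectionClass μ E)}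
    (h : CanonicalTriple σ V φ l k j W K) : ∃ l', IsCumulantDensity V φ l' := by
  have hcum : IsCumulant (integralFunctional μ l) := by
    refine isCumulant_of_sprod h.preHilbert (fun g => ⟨vec k g, h.vec_mem g⟩) h.covec_vec ?_
      fun g => ?_
    · simp [integralFunctional, h.l_one]
    · unfold integralFunctional
      rw [← integral_conj]
      simp only [StepMap.star_apply, h.l_star]
  refine h.logDensity.exists_isCumulantDensity (h.logDensity.derivative.ae_isCumulant fun D => ?_)
  simp_rw [← integralFunctional_ind (ae_of_all μ h.l_one)]
  exact hcum.comp (indHom D) fun b => (StepMap.star_ind b D).symm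

end Canonical

/-! ### Triangular operators -/

section Triangular

variable {X : Type v} [MeasurableSpace X] {ν : Measure X}
  {E : X → Type u} [∀ x, NormedAddCommGroup (E x)] [∀ x, InnerProductSpace ℂ (E x)]
  {K : Submodule ℂ (SectionClass ν E)}

theorem sprod_zero_right (ξ : SectionClass ν E) : sprod ξ 0 = 0 := by
  rw [← zero_smul ℂ (0 : SectionClass ν E), sprod_smul_right, zero_mul]

/-- The triangular operator with rows `(1, ⟨η, ·⟩, c)`, `(0, A, ζ)`, `(0, 0, 1)`. -/
def triangular (hK : IsPreHilbert K) (η ζ : K) (A : K →ₗ[ℂ] K) (c : ℂ) :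
    Module.End ℂ (ℂ × K × ℂ) where
  toFun p := (p.1 + hK.form η p.2.1 + c * p.2.2, A p.2.1 + p.2.2 • ζ, p.2.2)
  map_add' p q := by
    refine Prod.ext ?_ (Prod.ext ?_ rfl)
    · simp only [Prod.fst_add, Prod.snd_add, map_add]
      ring
    · simp only [Prod.fst_add, Prod.snd_add, map_add, add_smul]
      abel
  map_smul' r p := by
    refine Prod.ext ?_ (Prod.ext ?_ rfl)
    · simp only [Prod.smul_fst, Prod.smul_snd, map_smul, smul_eq_mul, RingHom.id_apply]
      ring
    · simp only [Prod.smul_fst, Prod.smul_snd, map_smul, smul_eq_mul, mul_smul, smul_add,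
        RingHom.id_apply]

theorem triangular_apply (hK : IsPreHilbert K) (η ζ : K) (A : K →ₗ[ℂ] K) (c : ℂ)
    (p : ℂ × K × ℂ) : triangular hK η ζ A c p =
      (p.1 + hK.form η p.2.1 + c * p.2.2, A p.2.1 + p.2.2 • ζ, p.2.2) := rfl

theorem minkowski_eq (hK : IsPreHilbert K) (p q : ℂ × K × ℂ) :
    minkowski p q = conj p.1 * q.2.2 + hK.form p.2.1 q.2.1 + conj p.2.2 * q.1 := rfl

theorem IsPreHilbert.form_conj (hK : IsPreHilbert K) (ξ η : K) :
    conj (hK.form ξ η) = hK.form η ξ := sprod_conj _ _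

variable {M : Type*} [Monoid M] [StarMul M] {lam : M → ℂ} {k : M → K} {A : M → K →ₗ[ℂ] K}

/-- Entrywise: λ(ab) = λ(a) + k⋆(a)k(b) + λ(b), k(ab) = j(a)k(b) + k(a), and k⋆(ab) = k⋆(b) +
k⋆(a)j(b), the last being the adjoint of the cocycle identity. -/
theorem triangular_mul (hK : IsPreHilbert K)
    (hk : ∀ a b, hK.form (k (star a)) (k b) = lam (a * b) - lam a - lam b)
    (hAk : ∀ a b, A a (k b) = k (a * b) - k a) (hA : ∀ a b, A (a * b) = A a ∘ₗ A b)
    (hs : ∀ b ξ η, hK.form (A (star b) ξ) η = hK.form ξ (A b η)) (a b : M) :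
    triangular hK (k (star (a * b))) (k (a * b)) (A (a * b)) (lam (a * b)) =
      triangular hK (k (star a)) (k a) (A a) (lam a) *
        triangular hK (k (star b)) (k b) (A b) (lam b) := by
  refine LinearMap.ext fun p => ?_
  rw [Module.End.mul_apply]
  simp only [triangular_apply]
  refine Prod.ext ?_ (Prod.ext ?_ rfl)
  · simp only [map_add, map_smul, hk, ← hs, hAk, map_sub, LinearMap.sub_apply, star_mul,
      smul_eq_mul]
    ring
  · simp only [map_add, map_smul, hAk, hA, LinearMap.comp_apply, smul_sub]
    abel

theorem triangular_star (hK : IsPreHilbert K) (hl : ∀ b, lam (star b) = conj (lam b))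
    (hs : ∀ b ξ η, hK.form (A (star b) ξ) η = hK.form ξ (A b η)) (b : M) (p q : ℂ × K × ℂ) :
    minkowski (triangular hK (k (star (star b))) (k (star b)) (A (star b)) (lam (star b)) p) q =
      minkowski p (triangular hK (k (star b)) (k b) (A b) (lam b) q) := by
  simp only [minkowski_eq hK, triangular_apply, map_add, map_mul, map_smul, LinearMap.add_apply,
    LinearMap.map_smulₛₗ hK.form, LinearMap.smul_apply, hK.form_conj, hl, star_star,
    Complex.conj_conj, hs, smul_eq_mul]
  ring

theorem triangular_one (hK : IsPreHilbert K) (hk : k 1 = 0) (hl : lam 1 = 0)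
    (hA : A 1 = LinearMap.id) : triangular hK (k (star 1)) (k 1) (A 1) (lam 1) = 1 := by
  refine LinearMap.ext fun p => ?_
  rw [triangular_apply, star_one, hk, hl, hA]
  simp

theorem minkowski_triangular (hK : IsPreHilbert K) (η ζ : K) (c : ℂ) (T : K →ₗ[ℂ] K) :
    minkowski ((0, 0, 1) : ℂ × K × ℂ) (triangular hK η ζ T c (0, 0, 1)) = c := by
  simp [minkowski_eq hK, triangular_apply]

/-! ### Block diagonal operators -/

variable {ν' : Measure X} {K' : Submodule ℂ (SectionClass ν' E)}

/-- The block diagonal operator `diag(1, T, 1)`. -/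
def blockDiag (T : K →ₗ[ℂ] K') : (ℂ × K × ℂ) →ₗ[ℂ] (ℂ × K' × ℂ) :=
  LinearMap.prodMap LinearMap.id (LinearMap.prodMap T LinearMap.id)

theorem blockDiag_apply (T : K →ₗ[ℂ] K') (p : ℂ × K × ℂ) :
    blockDiag T p = (p.1, T p.2.1, p.2.2) := rfl

theorem blockDiag_fst (T : K →ₗ[ℂ] K') (p : ℂ × K × ℂ) : (blockDiag T p).1 = p.1 := rfl

theorem blockDiag_snd_fst (T : K →ₗ[ℂ] K') (p : ℂ × K × ℂ) :
    (blockDiag T p).2.1 = T p.2.1 := rfl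

theorem blockDiag_snd_snd (T : K →ₗ[ℂ] K') (p : ℂ × K × ℂ) :
    (blockDiag T p).2.2 = p.2.2 := rfl

theorem minkowski_blockDiag (hK : IsPreHilbert K) (hK' : IsPreHilbert K') {T : K →ₗ[ℂ] K'}
    (hT : ∀ ξ η, hK'.form (T ξ) (T η) = hK.form ξ η) (p q : ℂ × K × ℂ) :
    minkowski (blockDiag T p) (blockDiag T q) = minkowski p q := by
  rw [minkowski_eq hK, minkowski_eq hK', blockDiag_apply, blockDiag_apply, hT]

theorem blockDiag_triangular (hK : IsPreHilbert K) (hK' : IsPreHilbert K') {T : K →ₗ[ℂ] K'}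
    (hT : ∀ ξ η, hK'.form (T ξ) (T η) = hK.form ξ η) {η ζ : K} {η' ζ' : K'}
    {A : K →ₗ[ℂ] K} {A' : K' →ₗ[ℂ] K'} {c c' : ℂ} (hη : T η = η') (hζ : T ζ = ζ')
    (hA : ∀ ξ, T (A ξ) = A' (T ξ)) (hc : c' = c) (p : ℂ × K × ℂ) :
    blockDiag T (triangular hK η ζ A c p) = triangular hK' η' ζ' A' c' (blockDiag T p) := by
  subst hη hζ hc
  simp only [blockDiag_apply, triangular_apply, map_add, map_smul, hA, hT]

end Triangular

/-! ### The cocycle over a measure -/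

section Cocycle

variable {X : Type v} [MeasurableSpace X] {ν : Measure X} {𝔟 : Type u} [Monoid 𝔟] [StarMul 𝔟]
  {E : X → Type u} [∀ x, NormedAddCommGroup (E x)] [∀ x, InnerProductSpace ℂ (E x)]
  {l : X → 𝔟 → ℂ} {k : ∀ x, 𝔟 → E x} {j : ∀ x, 𝔟 → E x →ₗ[ℂ] E x}

/-- The space spanned by the classes of the cocycle. -/
def cocycleSpan (ν : Measure X) (k : ∀ x, 𝔟 → E x) : Submodule ℂ (SectionClass ν E) :=
  Submodule.span ℂ (Set.range fun b => cls ν fun x => k x b)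

/-- The class of the cocycle at `b`. -/
def cocycleVec (ν : Measure X) (k : ∀ x, 𝔟 → E x) (b : 𝔟) : cocycleSpan ν k :=
  ⟨cls ν fun x => k x b, Submodule.subset_span ⟨b, rfl⟩⟩

theorem decomposable_cocycle (hT : ∀ x, IsTriple (l x) (k x) (j x)) (a b : 𝔟) :
    decomposable (fun x => j x a) (cls ν fun x => k x b) =
      (cls ν fun x => k x (a * b)) - cls ν fun x => k x a :=
  cls_eq_iff.2 (ae_of_all _ fun x => (hT x).j_k a b)

theorem decomposable_mem_cocycleSpan (hT : ∀ x, IsTriple (l x) (k x) (j x)) (b : 𝔟)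
    (ξ : SectionClass ν E) (hξ : ξ ∈ cocycleSpan ν k) :
    decomposable (fun x => j x b) ξ ∈ cocycleSpan ν k := by
  refine map_mem_of_mem_span (decomposable fun x => j x b) (fun c => ?_) ξ hξ
  rw [decomposable_cocycle hT]
  exact sub_mem (Submodule.subset_span ⟨b * c, rfl⟩) (Submodule.subset_span ⟨b, rfl⟩)

/-- The decomposable operator on the span of the cocycle. -/
def cocycleOper (ν : Measure X) (hT : ∀ x, IsTriple (l x) (k x) (j x)) (b : 𝔟) :
    cocycleSpan ν k →ₗ[ℂ] cocycleSpan ν k :=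
  (decomposable fun x => j x b).restrict (decomposable_mem_cocycleSpan hT b)

theorem cocycleOper_mul (hT : ∀ x, IsTriple (l x) (k x) (j x)) (a b : 𝔟) :
    cocycleOper ν hT (a * b) = cocycleOper ν hT a ∘ₗ cocycleOper ν hT b := by
  refine LinearMap.ext fun ⟨ξ, hξ⟩ => Subtype.ext ?_
  change decomposable (fun x => j x (a * b)) ξ =
    decomposable (fun x => j x a) (decomposable (fun x => j x b) ξ)
  obtain ⟨ξ, rfl⟩ := exists_cls ξ
  rw [decomposable_cls, decomposable_cls, decomposable_cls]
  simp only [(hT _).j_mul, LinearMap.comp_apply]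

theorem cocycleOper_one (hT : ∀ x, IsTriple (l x) (k x) (j x)) :
    cocycleOper ν hT 1 = LinearMap.id := by
  refine LinearMap.ext fun ⟨ξ, hξ⟩ => Subtype.ext ?_
  change decomposable (fun x => j x 1) ξ = ξ
  obtain ⟨ξ, rfl⟩ := exists_cls ξ
  rw [decomposable_cls]
  simp only [(hT _).j_one, LinearMap.id_apply]

theorem cocycleOper_vec (hT : ∀ x, IsTriple (l x) (k x) (j x)) (a b : 𝔟) :
    cocycleOper ν hT a (cocycleVec ν k b) = cocycleVec ν k (a * b) - cocycleVec ν k a :=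
  Subtype.ext (decomposable_cocycle hT a b)

theorem cocycleVec_one (hT : ∀ x, IsTriple (l x) (k x) (j x)) : cocycleVec ν k 1 = 0 :=
  Subtype.ext (cls_eq_iff.2 (ae_of_all _ fun x => (hT x).k_one))

theorem form_cocycleOper_star (hT : ∀ x, IsTriple (l x) (k x) (j x))
    (hK : IsPreHilbert (cocycleSpan ν k)) (b : 𝔟) (ξ η : cocycleSpan ν k) :
    hK.form (cocycleOper ν hT (star b) ξ) η = hK.form ξ (cocycleOper ν hT b η) := by
  obtain ⟨ξ, hξ⟩ := ξ
  obtain ⟨η, hη⟩ := η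
  change sprod (decomposable (fun x => j x (star b)) ξ) η =
    sprod ξ (decomposable (fun x => j x b) η)
  obtain ⟨ξ, rfl⟩ := exists_cls ξ
  obtain ⟨η, rfl⟩ := exists_cls η
  rw [decomposable_cls, decomposable_cls, sprod_cls, sprod_cls]
  simp only [(hT _).inner_j_star]

theorem form_cocycleVec (hT : ∀ x, IsTriple (l x) (k x) (j x))
    (hi : ∀ b, Integrable (fun x => l x b) ν) (hK : IsPreHilbert (cocycleSpan ν k)) (a b : 𝔟) :
    hK.form (cocycleVec ν k (star a)) (cocycleVec ν k b) =
      ∫ x, l x (a * b) ∂ν - ∫ x, l x a ∂ν - ∫ x, l x b ∂ν := by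
  change sprod (cls ν fun x => k x (star a)) (cls ν fun x => k x b) = _
  rw [sprod_cls]
  simp only [(hT _).inner_k, star_star]
  have h2 : Integrable (fun x => l x (a * b) - l x a) ν := (hi _).sub (hi _)
  rw [integral_sub h2 (hi _), integral_sub (hi _) (hi _)]

end Cocycle

/-! ### The covariant triangular representation -/

section Minkowski

variable {S : Type w} [Semigroup S] {X : Type v} [MeasurableSpace X] {μ : Measure X}
  {𝔟 : Type u} [Monoid 𝔟] [StarMul 𝔟] {σ : Symmetry S μ 𝔟} {V : VitaliSystem μ}
  {φ : StepMap μ 𝔟 → ℂ}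
  {E : X → Type u} [∀ x, NormedAddCommGroup (E x)] [∀ x, InnerProductSpace ℂ (E x)]
  {l : X → 𝔟 → ℂ} {k : ∀ x, 𝔟 → E x} {j : ∀ x, 𝔟 → E x →ₗ[ℂ] E x}
  {W : ∀ s x, E x →ₗ[ℂ] E (σ.act s x)}

theorem pushClassOn_cocycle (hW : IsCovariantField σ k W) (s : S) (D : IntegrableSet μ) (b : 𝔟) :
    pushClassOn σ W s D (cls (μ.restrict D.1) fun x => k x b) =
      cls (μ.restrict (σ.image s D).1) fun x => k x (σ.θ s b) := by
  rw [pushClassOn_cls, cls_push_eq_iff]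
  filter_upwards [ae_restrict_of_ae (hW.k_covariant s)] with x hx using (hx b).symm

theorem pushClassOn_mem_cocycleSpan (hW : IsCovariantField σ k W) (s : S) (D : IntegrableSet μ)
    (ξ : SectionClass (μ.restrict D.1) E) (hξ : ξ ∈ cocycleSpan (μ.restrict D.1) k) :
    pushClassOn σ W s D ξ ∈ cocycleSpan (μ.restrict (σ.image s D).1) k := by
  refine map_mem_of_mem_span (pushClassOn σ W s D) (fun b => ?_) ξ hξ
  rw [pushClassOn_cocycle hW]
  exact Submodule.subset_span ⟨σ.θ s b, rfl⟩

/-- The transport of the span of the cocycle over an integrable set. -/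
def cocyclePush (hW : IsCovariantField σ k W) (s : S) (D : IntegrableSet μ) :
    cocycleSpan (μ.restrict D.1) k →ₗ[ℂ] cocycleSpan (μ.restrict (σ.image s D).1) k :=
  (pushClassOn σ W s D).restrict (pushClassOn_mem_cocycleSpan hW s D)

theorem cocyclePush_vec (hW : IsCovariantField σ k W) (s : S) (D : IntegrableSet μ) (b : 𝔟) :
    cocyclePush hW s D (cocycleVec _ k b) = cocycleVec _ k (σ.θ s b) :=
  Subtype.ext (pushClassOn_cocycle hW s D b)

theorem form_cocyclePush (hW : IsCovariantField σ k W) (s : S) (D : IntegrableSet μ)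
    (hK : IsPreHilbert (cocycleSpan (μ.restrict D.1) k))
    (hK' : IsPreHilbert (cocycleSpan (μ.restrict (σ.image s D).1) k))
    (ξ η : cocycleSpan (μ.restrict D.1) k) :
    hK'.form (cocyclePush hW s D ξ) (cocyclePush hW s D η) = hK.form ξ η :=
  sprod_pushOn (hW.isometric s) D _ _

theorem cocyclePush_oper (hW : IsCovariantField σ k W) (hT : ∀ x, IsTriple (l x) (k x) (j x))
    (s : S) (D : IntegrableSet μ) (b : 𝔟) (ξ : cocycleSpan (μ.restrict D.1) k) :
    cocyclePush hW s D (cocycleOper _ hT b ξ) =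
      cocycleOper _ hT (σ.θ s b) (cocyclePush hW s D ξ) := by
  obtain ⟨ξ, hξ⟩ := ξ
  refine Subtype.ext ?_
  change pushClassOn σ W s D (decomposable (fun x => j x b) ξ) =
    decomposable (fun x => j x (σ.θ s b)) (pushClassOn σ W s D ξ)
  obtain ⟨ξ, rfl⟩ := exists_cls ξ
  rw [decomposable_cls, pushClassOn_cls, pushClassOn_cls, decomposable_cls, cls_push_eq_iff]
  filter_upwards [ae_restrict_of_ae (hW.j_covariant hT s)] with x hx
  rw [push_act, hx]

theorem setIntegral_image (hcov : σ.IsCovariantDensity l) (s : S) (D : IntegrableSet μ) (b : 𝔟) :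
    ∫ x in (σ.image s D).1, l x (σ.θ s b) ∂μ = ∫ x in D.1, l x b ∂μ := by
  have hm : μ.restrict (σ.image s D).1 = (μ.restrict D.1).map (σ.act s) :=
    (σ.map_restrict s D.2.1).symm
  rw [hm, (σ.measurableEmbedding s).integral_map]
  refine integral_congr_ae ?_
  filter_upwards [ae_restrict_of_ae (hcov s)] with x hx using hx b

/-- Over D only the constant b are needed, so K_D is the span of the vectors k_D(b). The operators W
map it into the corresponding span over sD. -/
theorem IsCumulantDensity.exists_minkowskiRep (h : IsCumulantDensity V φ l)
    (hV : σ.Respects V) (hφ : σ.IsHomogeneous φ) (hT : ∀ x, IsTriple (l x) (k x) (j x))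
    (hW : IsCovariantField σ k W) :
    ∃ J : ∀ D : IntegrableSet μ, 𝔟 → Module.End ℂ (ℂ × cocycleSpan (μ.restrict D.1) k × ℂ),
      MinkowskiRep σ V φ l k j W (fun D => cocycleSpan (μ.restrict D.1) k) J
        fun s D => blockDiag (cocyclePush hW s D) := by
  have hcov := h.isCovariantDensity hV hφ
  have hi := fun D => h.toIsLogDensity.integrableOn D
  have hK : ∀ D : IntegrableSet μ, IsPreHilbert (cocycleSpan (μ.restrict D.1) k) := fun D =>
    isPreHilbert_span (integrable_inner_k hT (hi D))
  have hls : ∀ (D : IntegrableSet μ) (b : 𝔟),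
      ∫ x in D.1, l x (star b) ∂μ = conj (∫ x in D.1, l x b ∂μ) := by
    intro D b
    rw [← integral_conj]
    simp only [(h.isCumulant _).2.2]
  refine ⟨fun D b => triangular (hK D) (cocycleVec _ k (star b)) (cocycleVec _ k b)
    (cocycleOper _ hT b) (∫ x in D.1, l x b ∂μ), ?_⟩
  constructor
  case logDensity => exact h.toIsLogDensity
  case preHilbert => exact hK
  case map_mul =>
    exact fun D a b => triangular_mul (lam := fun b => ∫ x in D.1, l x b ∂μ) (hK D)
      (form_cocycleVec hT (hi D) (hK D)) (cocycleOper_vec hT) (cocycleOper_mul hT)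
      (form_cocycleOper_star hT (hK D)) a b
  case map_star =>
    exact fun D b p q => triangular_star (lam := fun b => ∫ x in D.1, l x b ∂μ) (hK D)
      (hls D) (form_cocycleOper_star hT (hK D)) b p q
  case map_one =>
    exact fun D => triangular_one (lam := fun b => ∫ x in D.1, l x b ∂μ) (hK D)
      (cocycleVec_one hT) (by simp only [h.apply_one, integral_zero]) (cocycleOper_one hT)
  case row_minus => intro D b p; rw [triangular_apply]; rfl
  case row_circ => intro D b p; rw [triangular_apply]; rfl
  case row_plus => intro D b p; rw [triangular_apply]
  case corner => exact fun D b => minkowski_triangular (hK D) _ _ _ _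
  case null_vector =>
    intro D
    simp [minkowski_eq (hK D)]
  case exp_corner => exact fun D b => by rw [← h.integral_ind, h.exp_eq]
  case isometricRep => exact hW.isIsometricRep hT
  case block_minus => exact fun s D p => blockDiag_fst _ p
  case block_circ =>
    intro s D p ξ hξ
    rw [blockDiag_snd_fst, ← pushClassOn_cls, ← hξ]
    rfl
  case block_plus => exact fun s D p => blockDiag_snd_snd _ p
  case pseudoIsometric =>
    exact fun s D p q => minkowski_blockDiag (hK D) (hK _) (form_cocyclePush hW s D _ _) p q
  case intertwines =>
    intro s D b p
    refine blockDiag_triangular (hK D) (hK _) (form_cocyclePush hW s D _ _) ?_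
      (cocyclePush_vec hW s D b) (cocyclePush_oper hW hT s D b) (setIntegral_image hcov s D b) p
    rw [cocyclePush_vec, σ.θ_star]

/-- The column J(b)e is (λ_D(b), k_D(b), 1). The upper entry of J(ac)e = J(a)J(c)e is the coboundary
identity that makes λ_D a cumulant functional. -/
theorem MinkowskiRep.exists_isCumulantDensity
    {K : ∀ D : IntegrableSet μ, Submodule ℂ (SectionClass (μ.restrict D.1) E)}
    {J : ∀ D, 𝔟 → Module.End ℂ (ℂ × K D × ℂ)}
    {U : ∀ s D, (ℂ × K D × ℂ) →ₗ[ℂ] (ℂ × K (σ.image s D) × ℂ)}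
    (h : MinkowskiRep σ V φ l k j W K J U) : ∃ l', IsCumulantDensity V φ l' := by
  refine h.logDensity.exists_isCumulantDensity (h.logDensity.derivative.ae_isCumulant fun D => ?_)
  have hcirc : ∀ b, ((J D b (0, 0, 1)).2.1 : SectionClass (μ.restrict D.1) E) =
      cls (μ.restrict D.1) fun x => k x b := by
    intro b
    rw [h.row_circ]
    simp
  have hminus : ∀ b, (J D b (0, 0, 1)).1 = ∫ x in D.1, l x b ∂μ := by
    intro b
    rw [h.row_minus]
    simp [sprod_zero_right]
  refine isCumulant_of_sprod (h.preHilbert D) (fun b => (J D b (0, 0, 1)).2.1)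
    (fun a c => ?_) ?_ fun b => ?_
  · have he := hminus (a * c)
    rw [h.map_mul, Module.End.mul_apply, h.row_minus, h.row_plus, hminus, mul_one] at he
    rw [hcirc (star a), ← he]
    ring
  · rw [← hminus, h.map_one, Module.End.one_apply]
  · have he := h.map_star D b (0, 0, 1) (0, 0, 1)
    rw [h.corner] at he
    unfold minkowski at he
    rw [h.row_plus, hminus] at he
    simp only [Submodule.coe_zero, sprod_zero_right, mul_one, mul_zero, add_zero] at he
    rw [← he, Complex.conj_conj]

end Minkowski

end LevyField

end

-- The equivalence of the four conditions

universe u v w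

open MeasureTheory LevyField in
theorem theorem1 {S : Type w} [Semigroup S]
    {X : Type v} [MeasurableSpace X] (μ : Measure X) [SigmaFinite μ] (hμ : IsAtomless μ)
    {𝔟 : Type u} [Monoid 𝔟] [StarMul 𝔟]
    (σ : Symmetry S μ 𝔟) (V : VitaliSystem μ) (hV : σ.Respects V)
    (φ : StepMap μ 𝔟 → ℂ) (hφ : σ.IsHomogeneous φ) :
    List.TFAE
      [ -- the `φ_D` are absolutely continuous infinitely divisible states with Vitali derivative
        InfinitelyDivisibleState V φ,
        -- `ln φ` is a covariant absolutely continuous cumulant generating functional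
        ∃ (lam : StepMap μ 𝔟 → ℂ) (l : X → 𝔟 → ℂ), CumulantFunctional σ V φ lam l,
        -- canonical triple over a direct integral of pre-Hilbert spaces
        ∃ (E : X → Type u) (_ : ∀ x, NormedAddCommGroup (E x))
          (_ : ∀ x, InnerProductSpace ℂ (E x))
          (l : X → 𝔟 → ℂ) (k : ∀ x, 𝔟 → E x) (j : ∀ x, 𝔟 → E x →ₗ[ℂ] E x)
          (W : ∀ s x, E x →ₗ[ℂ] E (σ.act s x)) (K : Submodule ℂ (SectionClass μ E)),
          CanonicalTriple σ V φ l k j W K,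
        -- covariant triangular representations on the Minkowski spaces `ℂ ⊕ K_D ⊕ ℂ`
        ∃ (E : X → Type u) (_ : ∀ x, NormedAddCommGroup (E x))
          (_ : ∀ x, InnerProductSpace ℂ (E x))
          (l : X → 𝔟 → ℂ) (k : ∀ x, 𝔟 → E x) (j : ∀ x, 𝔟 → E x →ₗ[ℂ] E x)
          (W : ∀ s x, E x →ₗ[ℂ] E (σ.act s x))
          (K : ∀ D : IntegrableSet μ, Submodule ℂ (SectionClass (μ.restrict D.1) E))
          (J : ∀ D, 𝔟 → Module.End ℂ (ℂ × K D × ℂ))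
          (U : ∀ s D, (ℂ × K D × ℂ) →ₗ[ℂ] (ℂ × K (σ.image s D) × ℂ)),
          MinkowskiRep σ V φ l k j W K J U ] := by
  -- The existence of a cumulant density is the hub through which all implications pass.
  have h1 : InfinitelyDivisibleState V φ ↔ ∃ l, IsCumulantDensity V φ l :=
    ⟨fun h => h.exists_isCumulantDensity, fun ⟨_, h⟩ => h.infinitelyDivisibleState⟩
  tfae_have 1 ↔ 2 := by
    rw [h1]
    exact ⟨fun ⟨l, h⟩ => ⟨_, l, h.cumulantFunctional hV hφ⟩,
      fun ⟨_, _, h⟩ => h.exists_isCumulantDensity⟩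
  tfae_have 1 → 3 := by
    rw [h1]
    rintro ⟨l, h⟩
    choose E iN iI k j hT using fun x => (h.isCumulant x).exists_isTriple
    obtain ⟨W, hW⟩ := exists_isCovariantField hT (h.isCovariantDensity hV hφ)
    exact ⟨E, iN, iI, l, k, j, W, _, h.canonicalTriple hV hφ hT hW⟩
  tfae_have 3 → 1 := by
    rw [h1]
    rintro ⟨E, _, _, l, k, j, W, K, h⟩
    exact h.exists_isCumulantDensity
  tfae_have 1 → 4 := by
    rw [h1]
    rintro ⟨l, h⟩
    choose E iN iI k j hT using fun x => (h.isCumulant x).exists_isTriple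
    obtain ⟨W, hW⟩ := exists_isCovariantField hT (h.isCovariantDensity hV hφ)
    obtain ⟨J, hJ⟩ := h.exists_minkowskiRep hV hφ hT hW
    exact ⟨E, iN, iI, l, k, j, W, _, J, _, hJ⟩
  tfae_have 4 → 1 := by
    rw [h1]
    rintro ⟨E, _, _, l, k, j, W, K, J, U, h⟩
    exact h.exists_isCumulantDensity
  tfae_finish
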